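/- **Setting.** For $0<p<1$ and $0<\rho\le 1$ let $\mathcal P_0$ be the law of two independent Erdős–Rényi graphs $G_1,G_2\sim\mathcal G(n,p)$ on $[n]$. Let $\mathcal P_1$ be the law of the correlated Erdős–Rényi pair: $\pi$ is a uniformly random bijection of $[n]$ and, given $\pi$, the pairs $(\mathbf 1\{e\in E(G_1)\},\mathbf 1\{\pi(e)\in E(G_2)\})$, over all vertex pairs $e$, are independent, each consisting of two Bernoulli($p$) variables with correlation coefficient $\rho$. For integers $N_{\mathsf e},d$ let $\mathcal M(N_{\mathsf e},d)$ be the set of all isomorphism classes of connected simple graphs with $N_{\mathsf e}$ edges and maximum degree at most $d$. For a motif $\mathsf M$ with $\mathsf v(\mathsf M)$ vertices, $\mathsf e(\mathsf M)$ edges and $\mathsf{aut}(\mathsf M)$ automorphisms, and a graph $G$ on $[n]$, let $$\mathsf{inj}(\mathsf M,\bar G)=\sum_{\varphi:V(\mathsf M)\to[n]\text{ injective}}\ \prod_{uv\in E(\mathsf M)}\bigl(\mathbf 1\{\varphi(u)\varphi(v)\in E(G)\}-p\bigr),\qquad \omega_{\mathsf M}=\frac{\rho^{\mathsf e(\mathsf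 M)}\,(n-\mathsf v(\mathsf M))!}{n!\,(p(1-p))^{\mathsf e(\mathsf M)}\,\mathsf{aut}(\mathsf M)},$$ $$\mathcal T_{\mathcal M(N_{\mathsf e},d)}=\sum_{\mathsf M\in\mathcal M(N_{\mathsf e},d)}\omega_{\mathsf M}\,\mathsf{inj}(\mathsf M,\bar G_1)\,\mathsf{inj}(\mathsf M,\bar G_2),\qquad \tau=\tfrac12\,\mathbb E_{\mathcal P_1}\bigl[\mathcal T_{\mathcal M(N_{\mathsf e},d)}\bigr].$$ Below $\rho=\rho_n\in(0,1]$ and $N_{\mathsf e}=N_{\mathsf e}(n)$ may depend on $n$, while $a$, $\epsilon$ and $d$ are constants. **Theorem.** 1. For every integer $d$ there is a constant $C_1(d)>0$ with the following property. Let $p=n^{-a}$ with a constant $0<a<\frac23$, and let $d=3$ if $\frac25<a<\frac23$ and $d=\lfloor 2/a\rfloor-1$ if $0<a\le\frac25$. If $N_{\mathsf e}=o\Bigl(\frac{\log n}{\max(\log\log n,\,-\log\rho)}\Bigr)$ and $N_{\mathsf e}\ge C_1(d)\,\rho^{-2d/(d-2)}$ for all large $n$, then for all sufficiently large $n$ $$\mathcal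 P_0\bigl(\mathcal T_{\mathcal M(N_{\mathsf e},d)}\ge\tau\bigr)+\mathcal P_1\bigl(\mathcal T_{\mathcal M(N_{\mathsf e},d)}<\tau\bigr)\le 0.05 .$$ 2. For every $\epsilon>0$ there is a constant $C_2(\epsilon)>0$ with the following property. Let $d=\lfloor 4/\epsilon\rfloor+3$, and let $p=p_n\in(0,1)$ with $p=n^{-o(1)}$ and $1-p=n^{-o(1)}$ (the latter holds in particular if $p\le\frac12$). If $N_{\mathsf e}=o\Bigl(\frac{\log n}{\max(\log\log n,\,-\log\rho)}\Bigr)$ and $N_{\mathsf e}\ge C_2(\epsilon)\,\rho^{-(2+\epsilon)}$ for all large $n$, then the same inequality holds for all sufficiently large $n$. 3. There is a single program for a random access machine with real registers (unit-cost addition, subtraction and comparison of integers, unit-cost field operations on reals, unit-cost adjacency queries to $G_1$ and $G_2$, indirect addressing) that, given $n,N_{\mathsf e},d,p,\rho$ and access to $G_1,G_2$, always halts with the exact value of $\mathcal T_{\mathcal M(N_{\mathsf e},d)}$. Whenever $d$ is constant and $N_{\mathsf e}=o\Bigl(\frac{\log n}{\max(\log\log n,\,-\log\rho)}\Bigr)$,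 its worst-case number of steps is at most $n^{N_{\mathsf e}+1+o(1)}$. -/

import Mathlib

open Filter Asymptotics

/-! ### Motifs -/

/-- Two graphs on `v` vertices are identified when they are isomorphic. -/
def graphIsoSetoid (v : ℕ) : Setoid (SimpleGraph (Fin v)) where
  r M M' := Nonempty (M ≃g M')
  iseqv := ⟨fun _ => ⟨SimpleGraph.Iso.refl⟩, fun ⟨f⟩ => ⟨f.symm⟩, fun ⟨f⟩ ⟨g⟩ => ⟨f.trans g⟩⟩

/-- A motif: a finite simple graph up to isomorphism, given by its number of vertices and an
isomorphism class of graphs with that many vertices. -/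
abbrev Motif : Type := Σ v : ℕ, Quotient (graphIsoSetoid v)

namespace Motif

/-- A representative of the isomorphism class. All quantities below are isomorphism invariant. -/
noncomputable def graph (M : Motif) : SimpleGraph (Fin M.1) := Quotient.out M.2

/-- The number of edges of the motif. -/
noncomputable def numEdges (M : Motif) : ℕ := M.graph.edgeSet.ncard

/-- The number of automorphisms of the motif. -/
noncomputable def aut (M : Motif) : ℕ := Nat.card (M.graph ≃g M.graph)

/-- A connected graph with `N` edges and all degrees at most `d`. -/
def IsBounded (N d : ℕ) (M : Motif) : Prop :=
  M.graph.Connected ∧ M.numEdges = N ∧ ∀ x, (M.graph.neighborSet x).ncard ≤ d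

end Motif

open Classical in
/-- The family of all connected motifs with `N` edges and maximum degree at most `d`. The
restriction to at most `N + 1` vertices is automatic, see `mem_motifFamily`. -/
noncomputable def motifFamily (N d : ℕ) : Finset Motif :=
  ((Finset.range (N + 2)).sigma fun _ => Finset.univ).filter (Motif.IsBounded N d)

theorem mem_motifFamily {N d : ℕ} {M : Motif} : M ∈ motifFamily N d ↔ M.IsBounded N d := by
  classical
  simp only [motifFamily, Finset.mem_filter, Finset.mem_sigma, Finset.mem_range,
    Finset.mem_univ, and_true, and_iff_right_iff_imp]
  rintro ⟨hc, he, -⟩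
  have h := hc.card_vert_le_card_edgeSet_add_one
  rw [Nat.card_eq_fintype_card, Fintype.card_fin, Nat.card_coe_set_eq] at h
  unfold Motif.numEdges at he
  omega

/-! ### The motif counting statistic -/

/-- A pair of graphs on the vertex set `{0, …, n - 1}`. -/
abbrev GraphPair (n : ℕ) : Type := SimpleGraph (Fin n) × SimpleGraph (Fin n)

open Classical in
/-- The weight of the vertex pair `e` in the centered graph: `1{e ∈ E(G)} - p`. -/
noncomputable def centeredWeight {n : ℕ} (p : ℝ) (G : SimpleGraph (Fin n)) (e : Sym2 (Fin n)) : ℝ :=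
  (if e ∈ G.edgeSet then 1 else 0) - p

open Classical in
/-- The weighted number of injective homomorphisms of `M` into the centered graph of `G`. -/
noncomputable def injCount {n : ℕ} (p : ℝ) (M : Motif) (G : SimpleGraph (Fin n)) : ℝ :=
  ∑ φ : Fin M.1 ↪ Fin n, ∏ e ∈ M.graph.edgeFinset, centeredWeight p G (e.map φ)

/-- The weight of the motif `M` in the statistic. -/
noncomputable def motifWeight (n : ℕ) (p ρ : ℝ) (M : Motif) : ℝ :=
  ρ ^ M.numEdges * ((n - M.1).factorial : ℝ) /
    ((n.factorial : ℝ) * (p * (1 - p)) ^ M.numEdges * (M.aut : ℝ))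

/-- The motif counting statistic of the family of all connected motifs with `N` edges and maximum
degree at most `d`. -/
noncomputable def motifStat {n : ℕ} (p ρ : ℝ) (N d : ℕ) (x : GraphPair n) : ℝ :=
  ∑ M ∈ motifFamily N d, motifWeight n p ρ M * injCount p M x.1 * injCount p M x.2

/-! ### The two hypotheses -/

open Classical in
/-- Probability mass function of the Erdős–Rényi graph with edge probability `p`. -/
noncomputable def erMass {n : ℕ} (p : ℝ) (G : SimpleGraph (Fin n)) : ℝ :=
  ∏ e ∈ (⊤ : SimpleGraph (Fin n)).edgeFinset, if e ∈ G.edgeSet then p else 1 - p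

/-- The null hypothesis: two independent Erdős–Rényi graphs. -/
noncomputable def nullMass {n : ℕ} (p : ℝ) (x : GraphPair n) : ℝ :=
  erMass p x.1 * erMass p x.2

open Classical in
/-- The law of two Bernoulli variables with mean `p` and correlation coefficient `ρ`: the
probability that they are the indicators of `a` and `b`. -/
noncomputable def bernoulliPairMass (p ρ : ℝ) (a b : Prop) : ℝ :=
  if a then (if b then p ^ 2 + ρ * (p * (1 - p)) else (1 - ρ) * (p * (1 - p)))
  else (if b then (1 - ρ) * (p * (1 - p)) else (1 - p) ^ 2 + ρ * (p * (1 - p)))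

/-- The alternative hypothesis: the correlated Erdős–Rényi graphs. A latent bijection `π` is
drawn uniformly; given `π`, the pairs of indicators of `e ∈ E(G₁)` and `π(e) ∈ E(G₂)`, over all
vertex pairs `e`, are independent correlated Bernoulli pairs. -/
noncomputable def altMass {n : ℕ} (p ρ : ℝ) (x : GraphPair n) : ℝ :=
  (∑ π : Equiv.Perm (Fin n), ∏ e ∈ (⊤ : SimpleGraph (Fin n)).edgeFinset,
    bernoulliPairMass p ρ (e ∈ x.1.edgeSet) (e.map π ∈ x.2.edgeSet)) / (n.factorial : ℝ)

open Classical in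
/-- Probability of an event under a mass function. -/
noncomputable def massProb {n : ℕ} (μ : GraphPair n → ℝ) (A : Set (GraphPair n)) : ℝ :=
  ∑ x with x ∈ A, μ x

open Classical in
/-- Expectation under a mass function. -/
noncomputable def massExp {n : ℕ} (μ : GraphPair n → ℝ) (f : GraphPair n → ℝ) : ℝ :=
  ∑ x, μ x * f x

/-- The threshold of the test: half of the mean of the statistic under the alternative. -/
noncomputable def testThreshold (n : ℕ) (p ρ : ℝ) (N d : ℕ) : ℝ :=
  massExp (n := n) (altMass p ρ) (motifStat p ρ N d) / 2

/-- The sum of the Type I and Type II errors of the test that rejects the null hypothesis when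
the statistic is at least the threshold. -/
noncomputable def totalError (n : ℕ) (p ρ : ℝ) (N d : ℕ) : ℝ :=
  massProb (n := n) (nullMass p) {x | testThreshold n p ρ N d ≤ motifStat p ρ N d x} +
  massProb (n := n) (altMass p ρ) {x | motifStat p ρ N d x < testThreshold n p ρ N d}

/-! ### The conditions on the parameters -/

/-- The maximum degree used for the edge probability `n ^ (-a)`. -/
noncomputable def degreeBound (a : ℝ) : ℕ := if 2 / 5 < a then 3 else ⌊2 / a⌋₊ - 1

/-- `N = o(log n / max(log log n, - log ρ))`. -/
def SmallMotifs (N : ℕ → ℕ) (ρ : ℕ → ℝ) : Prop :=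
  (fun n => (N n : ℝ)) =o[atTop]
    fun n : ℕ => Real.log n / max (Real.log (Real.log n)) (-Real.log (ρ n))

/-! ### Running time: programs of a random access machine with real registers

The machine has an integer memory and a real memory, both indexed by `ℕ` and with indirect
addressing. Integers can be added, subtracted (truncated at 0) and compared; reals can be added,
subtracted, multiplied and divided; one adjacency of one of the two input graphs can be queried.
Each of these operations, and each evaluation of a branching or loop condition, costs one step.
A program is a fixed finite object, and control flow depends on the integer memory only. -/

/-- Contents of the two memories. -/
structure MachineState where
  int : ℕ → ℕ
  real : ℕ → ℝ

/-- Arithmetic operations on reals. -/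
inductive RealOp
  | add | sub | mul | div

/-- The value of a real operation. -/
noncomputable def RealOp.eval : RealOp → ℝ → ℝ → ℝ
  | .add, x, y => x + y
  | .sub, x, y => x - y
  | .mul, x, y => x * y
  | .div, x, y => x / y

/-- Elementary instructions; the arguments are addresses, except the constants `c`. -/
inductive Instr
  | const (i c : ℕ)
  | add (i j k : ℕ)
  | sub (i j k : ℕ)
  | load (i j : ℕ)
  | store (i j : ℕ)
  | edge₁ (i j k : ℕ)
  | edge₂ (i j k : ℕ)
  | realConst (i c : ℕ)
  | realOp (o : RealOp) (i j k : ℕ)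
  | realLoad (i j : ℕ)
  | realStore (i j : ℕ)

open Classical in
/-- The answer to the query whether `a` and `b` are adjacent vertices of `G`: `1` or `0`. -/
noncomputable def edgeQuery {n : ℕ} (G : SimpleGraph (Fin n)) (a b : ℕ) : ℕ :=
  if ∃ (ha : a < n) (hb : b < n), G.Adj ⟨a, ha⟩ ⟨b, hb⟩ then 1 else 0

/-- Effect of an elementary instruction. -/
noncomputable def Instr.exec {n : ℕ} (x : GraphPair n) (s : MachineState) : Instr → MachineState
  | .const i c => { s with int := Function.update s.int i c }
  | .add i j k => { s with int := Function.update s.int i (s.int j + s.int k) }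
  | .sub i j k => { s with int := Function.update s.int i (s.int j - s.int k) }
  | .load i j => { s with int := Function.update s.int i (s.int (s.int j)) }
  | .store i j => { s with int := Function.update s.int (s.int i) (s.int j) }
  | .edge₁ i j k => { s with int := Function.update s.int i (edgeQuery x.1 (s.int j) (s.int k)) }
  | .edge₂ i j k => { s with int := Function.update s.int i (edgeQuery x.2 (s.int j) (s.int k)) }
  | .realConst i c => { s with real := Function.update s.real i (c : ℝ) }
  | .realOp o i j k =>
      { s with real := Function.update s.real i (o.eval (s.real j) (s.real k)) }
  | .realLoad i j => { s with real := Function.update s.real i (s.real (s.int j)) }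
  | .realStore i j => { s with real := Function.update s.real (s.int i) (s.real j) }

/-- Programs: `ifLt i j P Q` and `whileLt i j P` test whether the integer in cell `i` is smaller
than the integer in cell `j`. -/
inductive Program
  | skip
  | instr (c : Instr)
  | seq (P Q : Program)
  | ifLt (i j : ℕ) (P Q : Program)
  | whileLt (i j : ℕ) (P : Program)

/-- `Runs x P s t s'`: on the input graphs `x`, the program `P` started in the state `s` halts
after exactly `t` steps in the state `s'`. -/
inductive Runs {n : ℕ} (x : GraphPair n) : Program → MachineState → ℕ → MachineState → Prop
  | skip (s : MachineState) : Runs x .skip s 0 s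
  | instr (c : Instr) (s : MachineState) : Runs x (.instr c) s 1 (c.exec x s)
  | seq {P Q : Program} {s s' s'' : MachineState} {t t' : ℕ} :
      Runs x P s t s' → Runs x Q s' t' s'' → Runs x (.seq P Q) s (t + t') s''
  | ifTrue {i j : ℕ} {P Q : Program} {s s' : MachineState} {t : ℕ} :
      s.int i < s.int j → Runs x P s t s' → Runs x (.ifLt i j P Q) s (t + 1) s'
  | ifFalse {i j : ℕ} {P Q : Program} {s s' : MachineState} {t : ℕ} :
      ¬ s.int i < s.int j → Runs x Q s t s' → Runs x (.ifLt i j P Q) s (t + 1) s'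
  | whileTrue {i j : ℕ} {P : Program} {s s' s'' : MachineState} {t t' : ℕ} :
      s.int i < s.int j → Runs x P s t s' → Runs x (.whileLt i j P) s' t' s'' →
      Runs x (.whileLt i j P) s (t + t' + 1) s''
  | whileFalse {i j : ℕ} {P : Program} {s : MachineState} :
      ¬ s.int i < s.int j → Runs x (.whileLt i j P) s 1 s

/-- The initial state: `n`, `N`, `d` in the first three integer cells and `p`, `ρ` in the first
two real cells; all other cells hold `0`. -/
noncomputable def initState (n N d : ℕ) (p ρ : ℝ) : MachineState where
  int i := if i = 0 then n else if i = 1 then N else if i = 2 then d else 0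
  real i := if i = 0 then p else if i = 1 then ρ else 0

/-- The program `P` computes the statistic on every input, leaving its value in real cell `0`,
with at most `time n N d` steps on graphs with `n` vertices. -/
def ComputesStatWithin (P : Program) (time : ℕ → ℕ → ℕ → ℕ) : Prop :=
  ∀ (n N d : ℕ) (p ρ : ℝ), 0 < p → p < 1 → 0 < ρ → ρ ≤ 1 → ∀ x : GraphPair n,
    ∃ t ≤ time n N d, ∃ s : MachineState,
      Runs x P (initState n N d p ρ) t s ∧ s.real 0 = motifStat p ρ N d x

/-! Detection is a second moment argument. The statistic does not change when G₂ is relabelled, so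
the latent bijection can be taken to be the identity (`massExp_altMass`); the null law is this
aligned law with correlation 0. One estimate for the aligned law with correlation r, used for r = 0
and r = ρ, therefore controls both errors.

The statistic is a weighted sum over pairs of labelled copies of a common motif. The weights make
every motif contribute ρ^(2N) to the mean, so the mean is ρ^(2N) |F| with F the family. In the
second moment four copies meet, and the expectation factors over vertex pairs. It vanishes if some
edge lies in exactly one copy. Otherwise every vertex lies in at least two copies. If none lies in
three, connectivity forces the copies to coincide in pairs (`paired_of_vertexMult_le`); the three
pairings give the squared mean and two terms at most ρ^(2N) |F|. If some vertex lies in three or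
more copies, then the degree bound d makes the loss of edges at most d/2 times the loss of vertices
(`excess_edges_le`). Losing an edge costs 1/(p(1-p)), losing a vertex gains n, and p(1-p) is larger
than n^(-2/d) by a power of n, so each such overlap gains a power n^(-δ/2) (`overlap_exponent_le`).
The number of overlap patterns is N^O(N), and this as well as ρ^(-2N) is n^o(1) by the smallness of
N. Chebyshev's inequality gives the error 12/(ρ^(2N) |F|) + o(1) (`totalError_le`).

It remains that |F| beats ρ^(-2N). Put D = d - 2. Take a path and join D of its blocks to D others
by arbitrary perfect matchings: these graphs have degree at most d and depend on D² permutations. An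
isomorphism onto a fixed graph carries the Hamiltonian path to a walk, and there are only V d^(V-1)
walks, so few of these graphs are isomorphic (`card_motifFamily_ge`). Hence |F| is at least
(cN)^(N(d-2)/d), and N ≥ C ρ^(-2d/(d-2)) suffices (`exists_signal_constant`). For subpolynomial
densities every constant d is allowed, and a large d brings the exponent 2 + 4/(d-2) below 2 + ε.

The program lists, for each v ≤ N + 1, all lists of N pairs of numbers below v, keeps those that are
the edges of an admissible connected graph, and sums over all n^v maps of the vertices. A labelled
graph occurs in N! lists and a motif has v!/aut labelled versions on v vertices, so dividing by N!
and v! reproduces the motif weights (`card_simpleList`, `sum_quotient_eq_sum_graphs`). Isomorphism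
tests are thus never needed, and the overhead over n^(N+1) is N^O(N) = n^o(1). Correctness and
running time are proved together in a small calculus of triples with step bounds (`Ends`, `Tests`).
-/

/-! ### Expectations of products over the vertex pairs -/

/-- The pairs of distinct vertices. -/
def vertexPairs (n : ℕ) : Finset (Sym2 (Fin n)) := Finset.univ.filter fun e => ¬ e.IsDiag

theorem mem_vertexPairs {n : ℕ} {e : Sym2 (Fin n)} : e ∈ vertexPairs n ↔ ¬ e.IsDiag := by
  simp [vertexPairs]

theorem SimpleGraph.mem_vertexPairs_of_mem_edgeSet {n : ℕ} {G : SimpleGraph (Fin n)}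
    {e : Sym2 (Fin n)} (h : e ∈ G.edgeSet) : e ∈ vertexPairs n :=
  mem_vertexPairs.2 (G.not_isDiag_of_mem_edgeSet h)

theorem edgeFinset_top_eq_vertexPairs (n : ℕ) [Fintype (⊤ : SimpleGraph (Fin n)).edgeSet] :
    (⊤ : SimpleGraph (Fin n)).edgeFinset = vertexPairs n := by
  ext e
  rw [SimpleGraph.mem_edgeFinset, mem_vertexPairs, SimpleGraph.edgeSet_top]
  rfl

open Classical in
/-- A graph is given by the indicators of its edges. -/
noncomputable def graphEquivIndicator (n : ℕ) : SimpleGraph (Fin n) ≃ (vertexPairs n → Bool) where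
  toFun G e := decide (e.1 ∈ G.edgeSet)
  invFun f := SimpleGraph.fromEdgeSet {e | ∃ h : e ∈ vertexPairs n, f ⟨e, h⟩ = true}
  left_inv G := by
    rw [← SimpleGraph.edgeSet_inj]
    ext e
    simp only [SimpleGraph.edgeSet_fromEdgeSet, Set.mem_sdiff, Set.mem_ofPred_eq, decide_eq_true_eq,
      exists_prop]
    constructor
    · rintro ⟨⟨-, h⟩, -⟩
      exact h
    · intro h
      exact ⟨⟨SimpleGraph.mem_vertexPairs_of_mem_edgeSet h, h⟩, G.not_isDiag_of_mem_edgeSet h⟩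
  right_inv f := by
    funext ⟨e, he⟩
    refine Bool.eq_iff_iff.2 ((@decide_eq_true_iff _ (_)).trans ?_)
    simp only [SimpleGraph.edgeSet_fromEdgeSet, Set.mem_sdiff, Set.mem_ofPred_eq]
    constructor
    · rintro ⟨⟨_, h⟩, _⟩
      exact h
    · exact fun h => ⟨⟨he, h⟩, mem_vertexPairs.1 he⟩

/-- Independence of the vertex pairs: a pair of graphs is a free choice of two bits for each vertex
pair, so the sum of products is a product of four-term sums. -/
theorem sum_graphPair_prod {n : ℕ} (F : Sym2 (Fin n) → Prop → Prop → ℝ) :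
    ∑ x : GraphPair n, ∏ e ∈ vertexPairs n, F e (e ∈ x.1.edgeSet) (e ∈ x.2.edgeSet) =
      ∏ e ∈ vertexPairs n,
        (F e True True + F e True False + F e False True + F e False False) := by
  classical
  have key : ∑ x : GraphPair n, ∏ e ∈ vertexPairs n, F e (e ∈ x.1.edgeSet) (e ∈ x.2.edgeSet) =
      ∑ f : vertexPairs n → Bool × Bool, ∏ e, F e.1 ((f e).1 = true) ((f e).2 = true) := by
    refine Fintype.sum_equiv (((graphEquivIndicator n).prodCongr (graphEquivIndicator n)).trans
      (Equiv.arrowProdEquivProdArrow _ (fun _ => Bool) (fun _ => Bool)).symm) _ _ fun x => ?_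
    rw [← Finset.prod_coe_sort]
    refine Finset.prod_congr rfl fun e _ => ?_
    simp [graphEquivIndicator, Equiv.arrowProdEquivProdArrow]
  rw [key, ← Finset.prod_coe_sort (vertexPairs n), ← Fintype.piFinset_univ]
  rw [← Finset.prod_univ_sum (fun _ => Finset.univ)
    fun (e : vertexPairs n) (b : Bool × Bool) => F e.1 (b.1 = true) (b.2 = true)]
  refine Finset.prod_congr rfl fun e _ => ?_
  simp [Fintype.sum_prod_type]
  ring

/-! ### The correlated pair with the identity as latent bijection -/

/-- The law of the correlated pair given that the latent bijection is the identity. -/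
noncomputable def alignedMass {n : ℕ} (p ρ : ℝ) (x : GraphPair n) : ℝ :=
  ∏ e ∈ vertexPairs n, bernoulliPairMass p ρ (e ∈ x.1.edgeSet) (e ∈ x.2.edgeSet)

/-- Uncorrelated Bernoulli variables are independent, so the null hypothesis needs no moment
computation of its own. -/
theorem nullMass_eq_alignedMass {n : ℕ} (p : ℝ) : nullMass (n := n) p = alignedMass p 0 := by
  classical
  funext x
  unfold nullMass erMass alignedMass
  rw [edgeFinset_top_eq_vertexPairs, ← Finset.prod_mul_distrib]
  refine Finset.prod_congr rfl fun e _ => ?_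
  unfold bernoulliPairMass
  split_ifs <;> ring

/-- Relabelling the vertices of a graph. -/
def relabelEquiv {n : ℕ} (π : Equiv.Perm (Fin n)) : SimpleGraph (Fin n) ≃ SimpleGraph (Fin n) where
  toFun G := G.comap π
  invFun G := G.comap π.symm
  left_inv G := by ext a b; simp
  right_inv G := by ext a b; simp

theorem mem_edgeSet_relabelEquiv {n : ℕ} (π : Equiv.Perm (Fin n)) (G : SimpleGraph (Fin n))
    (e : Sym2 (Fin n)) : e ∈ (relabelEquiv π G).edgeSet ↔ e.map π ∈ G.edgeSet := by
  induction e with | _ a b => simp [relabelEquiv]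

/-- For each fixed π, substituting the relabelled G₂ absorbs π into the summation variable; all n!
terms of the average become equal. -/
theorem massExp_altMass {n : ℕ} (p ρ : ℝ) (f : GraphPair n → ℝ)
    (hf : ∀ x π, f (x.1, relabelEquiv π x.2) = f x) :
    massExp (altMass p ρ) f = massExp (alignedMass p ρ) f := by
  classical
  unfold massExp altMass
  have h : ∀ π : Equiv.Perm (Fin n), ∑ x : GraphPair n, (∏ e ∈ vertexPairs n,
      bernoulliPairMass p ρ (e ∈ x.1.edgeSet) (e.map π ∈ x.2.edgeSet)) * f x =
      ∑ x, alignedMass p ρ x * f x := by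
    intro π
    refine Fintype.sum_equiv ((Equiv.refl _).prodCongr (relabelEquiv π)) _ _ fun x => ?_
    simp only [alignedMass, Equiv.prodCongr_apply, Prod.map, Equiv.refl_apply,
      mem_edgeSet_relabelEquiv, hf]
  simp_rw [edgeFinset_top_eq_vertexPairs, div_mul_eq_mul_div, ← Finset.sum_div, Finset.sum_mul]
  rw [Finset.sum_comm]
  simp_rw [h]
  rw [Finset.sum_const, Finset.card_univ, Fintype.card_perm, Fintype.card_fin, nsmul_eq_mul,
    mul_div_cancel_left₀ _ (by positivity)]

theorem bernoulliPairMass_nonneg {p ρ : ℝ} (hp : 0 ≤ p) (hp1 : p ≤ 1) (hρ : 0 ≤ ρ) (hρ1 : ρ ≤ 1)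
    (a b : Prop) : 0 ≤ bernoulliPairMass p ρ a b := by
  have h1 : 0 ≤ 1 - p := by linarith
  have h2 : 0 ≤ 1 - ρ := by linarith
  unfold bernoulliPairMass
  split_ifs <;> positivity

theorem alignedMass_nonneg {n : ℕ} {p ρ : ℝ} (hp : 0 ≤ p) (hp1 : p ≤ 1) (hρ : 0 ≤ ρ) (hρ1 : ρ ≤ 1)
    (x : GraphPair n) : 0 ≤ alignedMass p ρ x :=
  Finset.prod_nonneg fun _ _ => bernoulliPairMass_nonneg hp hp1 hρ hρ1 _ _

theorem altMass_nonneg {n : ℕ} {p ρ : ℝ} (hp : 0 ≤ p) (hp1 : p ≤ 1) (hρ : 0 ≤ ρ) (hρ1 : ρ ≤ 1)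
    (x : GraphPair n) : 0 ≤ altMass p ρ x :=
  div_nonneg (Finset.sum_nonneg fun _ _ => Finset.prod_nonneg fun _ _ =>
    bernoulliPairMass_nonneg hp hp1 hρ hρ1 _ _) (Nat.cast_nonneg _)

/-- The mixed moments of two centered Bernoulli variables with correlation `ρ`. -/
noncomputable def pairMoment (p ρ : ℝ) (i j : ℕ) : ℝ :=
  (p ^ 2 + ρ * (p * (1 - p))) * ((1 - p) ^ i * (1 - p) ^ j) +
  (1 - ρ) * (p * (1 - p)) * ((1 - p) ^ i * (-p) ^ j) +
  (1 - ρ) * (p * (1 - p)) * ((-p) ^ i * (1 - p) ^ j) +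
  ((1 - p) ^ 2 + ρ * (p * (1 - p))) * ((-p) ^ i * (-p) ^ j)

theorem massExp_alignedMass_prod {n : ℕ} (p ρ : ℝ) (i j : Sym2 (Fin n) → ℕ) :
    massExp (alignedMass p ρ) (fun x => (∏ e ∈ vertexPairs n, centeredWeight p x.1 e ^ i e) *
      ∏ e ∈ vertexPairs n, centeredWeight p x.2 e ^ j e) =
      ∏ e ∈ vertexPairs n, pairMoment p ρ (i e) (j e) := by
  classical
  unfold massExp alignedMass
  simp_rw [← Finset.prod_mul_distrib]
  have := sum_graphPair_prod (n := n) fun e a b => bernoulliPairMass p ρ a b *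
    (((if a then 1 else 0) - p) ^ i e * ((if b then 1 else 0) - p) ^ j e)
  unfold centeredWeight
  rw [show (∏ e ∈ vertexPairs n, pairMoment p ρ (i e) (j e)) = _ from
    Finset.prod_congr rfl fun e _ => ?_, ← this]
  · simp_rw [Finset.prod_mul_distrib]
    congr!
  · unfold pairMoment bernoulliPairMass
    simp

theorem massExp_alignedMass_one {n : ℕ} (p ρ : ℝ) :
    massExp (n := n) (alignedMass p ρ) (fun _ => 1) = 1 := by
  have := massExp_alignedMass_prod (n := n) p ρ (fun _ => 0) (fun _ => 0)
  simp only [pow_zero, Finset.prod_const_one, mul_one] at this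
  rw [this]
  refine Finset.prod_eq_one fun e _ => ?_
  unfold pairMoment
  ring

theorem pairMoment_zero_zero (p ρ : ℝ) : pairMoment p ρ 0 0 = 1 := by
  unfold pairMoment; ring

theorem pairMoment_one_zero (p ρ : ℝ) : pairMoment p ρ 1 0 = 0 := by
  unfold pairMoment; ring

theorem pairMoment_zero_one (p ρ : ℝ) : pairMoment p ρ 0 1 = 0 := by
  unfold pairMoment; ring

theorem pairMoment_one_one (p ρ : ℝ) : pairMoment p ρ 1 1 = ρ * (p * (1 - p)) := by
  unfold pairMoment; ring

theorem pairMoment_two_zero (p ρ : ℝ) : pairMoment p ρ 2 0 = p * (1 - p) := by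
  unfold pairMoment; ring

theorem pairMoment_zero_two (p ρ : ℝ) : pairMoment p ρ 0 2 = p * (1 - p) := by
  unfold pairMoment; ring

theorem pairMoment_two_one (p ρ : ℝ) :
    pairMoment p ρ 2 1 = ρ * (1 - 2 * p) * (p * (1 - p)) := by
  unfold pairMoment; ring

theorem pairMoment_one_two (p ρ : ℝ) :
    pairMoment p ρ 1 2 = ρ * (1 - 2 * p) * (p * (1 - p)) := by
  unfold pairMoment; ring

theorem pairMoment_two_two (p ρ : ℝ) :
    pairMoment p ρ 2 2 = (p * (1 - p) + ρ * (1 - 2 * p) ^ 2) * (p * (1 - p)) := by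
  unfold pairMoment; ring

/-- Each nonconstant moment is p(1-p) times a factor of modulus at most 1; for i = j = 2 this uses
(1-2p)² = 1 - 4p(1-p). Thus an edge of the union of four copies costs one factor p(1-p), whatever
its multiplicity. -/
theorem abs_pairMoment_le {p ρ : ℝ} (hp : 0 ≤ p) (hp1 : p ≤ 1) (hρ : 0 ≤ ρ) (hρ1 : ρ ≤ 1) {i j : ℕ}
    (hi : i ≤ 2) (hj : j ≤ 2) (hij : 0 < i + j) : |pairMoment p ρ i j| ≤ p * (1 - p) := by
  have hs : 0 ≤ p * (1 - p) := mul_nonneg hp (by linarith)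
  have hs4 : (1 - 2 * p) ^ 2 = 1 - 4 * (p * (1 - p)) := by ring
  have key : ∀ c : ℝ, |c| ≤ 1 → |c * (p * (1 - p))| ≤ p * (1 - p) := by
    intro c hc
    rw [abs_mul, abs_of_nonneg hs]
    exact mul_le_of_le_one_left hs hc
  have h12 : |ρ * (1 - 2 * p)| ≤ 1 := by
    rw [abs_mul, abs_of_nonneg hρ]
    exact mul_le_one₀ hρ1 (abs_nonneg _) (by rw [abs_le]; constructor <;> linarith)
  have h22 : |p * (1 - p) + ρ * (1 - 2 * p) ^ 2| ≤ 1 := by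
    rw [abs_of_nonneg (by positivity)]
    have := mul_le_of_le_one_left (sq_nonneg (1 - 2 * p)) hρ1
    nlinarith
  interval_cases i <;> interval_cases j
  · omega
  · rw [pairMoment_zero_one, abs_zero]; exact hs
  · rw [pairMoment_zero_two, abs_of_nonneg hs]
  · rw [pairMoment_one_zero, abs_zero]; exact hs
  · rw [pairMoment_one_one]; exact key ρ (by rwa [abs_of_nonneg hρ])
  · rw [pairMoment_one_two]; exact key _ h12
  · rw [pairMoment_two_zero, abs_of_nonneg hs]
  · rw [pairMoment_two_one]; exact key _ h12
  · rw [pairMoment_two_two]; exact key _ h22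

/-- The first moment of a product of edge sets: with `X_S = ∏_{e ∈ S}`, the expectation of
`X_S(G₁) X_T(G₂)`. -/
theorem prod_eq_prod_vertexPairs_pow {n : ℕ} {S : Finset (Sym2 (Fin n))} (hS : S ⊆ vertexPairs n)
    [DecidableEq (Sym2 (Fin n))] (f : Sym2 (Fin n) → ℝ) :
    ∏ e ∈ S, f e = ∏ e ∈ vertexPairs n, f e ^ (if e ∈ S then 1 else 0) := by
  rw [← Finset.prod_subset hS (f := fun e => f e ^ (if e ∈ S then 1 else 0))]
  · refine Finset.prod_congr rfl fun e he => ?_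
    simp [he]
  · intro e _ he
    simp [he]

/-! ### Copies of a motif -/

/-- The edge set of a graph as a `Finset`. -/
noncomputable def edgesOf {n : ℕ} (G : SimpleGraph (Fin n)) : Finset (Sym2 (Fin n)) :=
  (Set.toFinite G.edgeSet).toFinset

theorem mem_edgesOf {n : ℕ} {G : SimpleGraph (Fin n)} {e : Sym2 (Fin n)} :
    e ∈ edgesOf G ↔ e ∈ G.edgeSet := by
  simp [edgesOf]

theorem edgesOf_injective {n : ℕ} : Function.Injective (edgesOf (n := n)) := by
  intro G H h
  rw [← SimpleGraph.edgeSet_inj]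
  ext e
  rw [← mem_edgesOf, h, mem_edgesOf]

theorem edgesOf_subset {n : ℕ} (G : SimpleGraph (Fin n)) : edgesOf G ⊆ vertexPairs n :=
  fun _ he => SimpleGraph.mem_vertexPairs_of_mem_edgeSet (mem_edgesOf.1 he)

theorem edgesOf_map {v n : ℕ} (H : SimpleGraph (Fin v)) (φ : Fin v ↪ Fin n) :
    edgesOf (H.map φ) = (edgesOf H).map φ.sym2Map := by
  ext e
  rw [mem_edgesOf, SimpleGraph.edgeSet_map]
  simp [mem_edgesOf]

theorem card_edgesOf {n : ℕ} (G : SimpleGraph (Fin n)) : (edgesOf G).card = G.edgeSet.ncard := by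
  rw [edgesOf, Set.ncard_eq_toFinset_card _ (Set.toFinite _)]

/-- The product of the centered weights over a set of vertex pairs. -/
noncomputable def weightProd {n : ℕ} (p : ℝ) (S : Finset (Sym2 (Fin n)))
    (G : SimpleGraph (Fin n)) : ℝ :=
  ∏ e ∈ S, centeredWeight p G e

open Classical in
theorem injCount_eq {n : ℕ} (p : ℝ) (M : Motif) (G : SimpleGraph (Fin n)) :
    injCount p M G = ∑ φ : Fin M.1 ↪ Fin n, weightProd p (edgesOf (M.graph.map φ)) G := by
  unfold injCount weightProd
  refine Finset.sum_congr rfl fun φ _ => ?_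
  rw [edgesOf_map, Finset.prod_map]
  refine Finset.prod_congr ?_ fun e _ => rfl
  ext e
  simp [mem_edgesOf]

theorem centeredWeight_congr {n m : ℕ} (p : ℝ) {G : SimpleGraph (Fin n)} {e : Sym2 (Fin n)}
    {G' : SimpleGraph (Fin m)} {e' : Sym2 (Fin m)} (h : e ∈ G.edgeSet ↔ e' ∈ G'.edgeSet) :
    centeredWeight p G e = centeredWeight p G' e' := by
  unfold centeredWeight
  by_cases h1 : e ∈ G.edgeSet
  · rw [if_pos h1, if_pos (h.1 h1)]
  · rw [if_neg h1, if_neg fun h2 => h1 (h.2 h2)]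

theorem injCount_relabelEquiv {n : ℕ} (p : ℝ) (M : Motif) (G : SimpleGraph (Fin n))
    (π : Equiv.Perm (Fin n)) : injCount p M (relabelEquiv π G) = injCount p M G := by
  unfold injCount
  refine Fintype.sum_equiv (Equiv.embeddingCongr (Equiv.refl _) π) _ _ fun φ => ?_
  refine Finset.prod_congr rfl fun e _ => ?_
  refine centeredWeight_congr p ((mem_edgeSet_relabelEquiv _ _ _).trans ?_)
  rw [Sym2.map_map]
  rfl

/-! ### Coinciding copies and automorphisms. -/

theorem SimpleGraph.exists_iso_of_map_eq {α β γ : Type*} {H : SimpleGraph α} {H' : SimpleGraph β}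
    (φ : α ↪ γ) (ψ : β ↪ γ) (hH : ∀ x, ∃ y, H.Adj x y) (hH' : ∀ x, ∃ y, H'.Adj x y)
    (h : H.map φ = H'.map ψ) : ∃ f : H ≃g H', ∀ x, ψ (f x) = φ x := by
  have h1 : ∀ x, ∃ z, ψ z = φ x := by
    intro x
    obtain ⟨y, hy⟩ := hH x
    have : (H'.map ψ).Adj (φ x) (φ y) := by
      rw [← h]; exact SimpleGraph.map_adj_apply.2 hy
    obtain ⟨a, b, -, ha, -⟩ := (SimpleGraph.map_adj _ _ _ _).1 this
    exact ⟨a, ha⟩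
  have h2 : ∀ z, ∃ x, φ x = ψ z := by
    intro x
    obtain ⟨y, hy⟩ := hH' x
    have : (H.map φ).Adj (ψ x) (ψ y) := by
      rw [h]; exact SimpleGraph.map_adj_apply.2 hy
    obtain ⟨a, b, -, ha, -⟩ := (SimpleGraph.map_adj _ _ _ _).1 this
    exact ⟨a, ha⟩
  choose f hf using h1
  choose g hg using h2
  refine ⟨⟨⟨f, g, fun x => φ.injective (by rw [hg, hf]), fun z => ψ.injective (by rw [hf, hg])⟩,
    fun {a b} => ?_⟩, hf⟩
  change H'.Adj (f a) (f b) ↔ H.Adj a b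
  rw [← SimpleGraph.map_adj_apply (f := ψ), hf, hf, ← h, SimpleGraph.map_adj_apply]

theorem SimpleGraph.map_iso {α β γ : Type*} {H : SimpleGraph α} {H' : SimpleGraph β} (f : H ≃g H')
    (φ : β ↪ γ) : H.map (f.toEquiv.toEmbedding.trans φ) = H'.map φ := by
  ext a b
  simp only [SimpleGraph.map_adj]
  constructor
  · rintro ⟨x, y, hxy, rfl, rfl⟩
    exact ⟨f x, f y, f.map_adj_iff.2 hxy, rfl, rfl⟩
  · rintro ⟨x, y, hxy, rfl, rfl⟩
    exact ⟨f.symm x, f.symm y, f.symm.map_adj_iff.2 hxy, by simp, by simp⟩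

/-- Precomposition with automorphisms acts freely and transitively on the embeddings with a given
image graph. Without isolated vertices the image graph determines the image of the vertex set, which
gives transitivity. -/
theorem card_map_eq_map {v n : ℕ} {H : SimpleGraph (Fin v)} (hH : ∀ x, ∃ y, H.Adj x y)
    (φ : Fin v ↪ Fin n) : Nat.card {ψ : Fin v ↪ Fin n // H.map φ = H.map ψ} =
      Nat.card (H ≃g H) := by
  symm
  refine Nat.card_congr (Equiv.ofBijective
    (fun f => ⟨f.toEquiv.toEmbedding.trans φ, (SimpleGraph.map_iso f φ).symm⟩) ⟨?_, ?_⟩)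
  · intro f g hfg
    have := Subtype.mk.inj hfg
    ext x
    have h := DFunLike.congr_fun this x
    exact congrArg Fin.val (φ.injective h)
  · rintro ⟨ψ, hψ⟩
    obtain ⟨f, hf⟩ := SimpleGraph.exists_iso_of_map_eq ψ φ hH hH hψ.symm
    refine ⟨f, Subtype.ext ?_⟩
    ext x
    exact congrArg Fin.val (hf x)

namespace Motif

theorem IsBounded.exists_adj {N d : ℕ} {M : Motif} (hM : M.IsBounded N d) (hN : N ≠ 0)
    (x : Fin M.1) : ∃ y, M.graph.Adj x y := by
  have : Nontrivial (Fin M.1) := by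
    by_contra hc
    rw [not_nontrivial_iff_subsingleton] at hc
    have h : M.numEdges = N := hM.2.1
    unfold numEdges at h
    have : M.graph.edgeSet = ∅ := by
      ext e
      induction e with | _ a b =>
      simp [Subsingleton.elim a b]
    rw [this, Set.ncard_empty] at h
    exact hN h.symm
  exact hM.1.preconnected.exists_adj_of_nontrivial x

theorem eq_of_iso {M M' : Motif} (f : M.graph ≃g M'.graph) : M = M' := by
  obtain ⟨v, q⟩ := M
  obtain ⟨v', q'⟩ := M'
  have hv : v = v' := by simpa using Fintype.card_congr f.toEquiv
  subst hv
  have : q = q' := by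
    rw [← Quotient.out_eq q, ← Quotient.out_eq q']
    exact Quotient.sound ⟨f⟩
  rw [this]

theorem aut_pos (M : Motif) : 0 < M.aut :=
  Nat.card_pos_iff.2 ⟨⟨SimpleGraph.Iso.refl⟩,
    Finite.of_injective (fun f : M.graph ≃g M.graph => (f : Fin M.1 → Fin M.1))
      DFunLike.coe_injective⟩

theorem card_edgesOf_map {n : ℕ} {M : Motif} (φ : Fin M.1 ↪ Fin n) :
    (edgesOf (M.graph.map φ)).card = M.numEdges := by
  rw [edgesOf_map, Finset.card_map, card_edgesOf]
  rfl

end Motif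

theorem motifFamily_vertices_le {N d : ℕ} {M : Motif} (hM : M ∈ motifFamily N d) : M.1 ≤ N + 1 := by
  classical
  have := (Finset.mem_sigma.1 (Finset.mem_filter.1 hM).1).1
  rw [Finset.mem_range] at this
  omega

open Classical in
/-- The number of pairs of a copy of `M` and a copy of `M'` that coincide. -/
theorem sum_map_eq_map {N d n : ℕ} (hN : N ≠ 0) {M M' : Motif} (hM : M ∈ motifFamily N d)
    (hM' : M' ∈ motifFamily N d) :
    (∑ φ : Fin M.1 ↪ Fin n, ∑ ψ : Fin M'.1 ↪ Fin n,
      if edgesOf (M.graph.map φ) = edgesOf (M'.graph.map ψ) then (1 : ℝ) else 0) =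
      if M = M' then (n.descFactorial M.1 : ℝ) * M.aut else 0 := by
  rw [mem_motifFamily] at hM hM'
  simp_rw [edgesOf_injective.eq_iff]
  split_ifs with h
  · subst h
    have : ∀ φ : Fin M.1 ↪ Fin n, (∑ ψ : Fin M.1 ↪ Fin n,
        if M.graph.map φ = M.graph.map ψ then (1 : ℝ) else 0) = M.aut := by
      intro φ
      rw [Finset.sum_boole, Motif.aut, ← card_map_eq_map (hM.exists_adj hN) φ,
        Nat.card_eq_fintype_card, Fintype.card_subtype]
    simp_rw [this]
    rw [Finset.sum_const, Finset.card_univ, Fintype.card_embedding_eq, nsmul_eq_mul,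
      Fintype.card_fin, Fintype.card_fin]
  · refine Finset.sum_eq_zero fun φ _ => Finset.sum_eq_zero fun ψ _ => if_neg fun he => h ?_
    obtain ⟨f, -⟩ := SimpleGraph.exists_iso_of_map_eq φ ψ (hM.exists_adj hN) (hM'.exists_adj hN) he
    exact Motif.eq_of_iso f

/-- The weight is normalised by the number of coinciding pairs of copies (`sum_map_eq_map`), so that
the result is the same for all motifs of the family. -/
theorem motifWeight_mul {n N d : ℕ} (hn : N + 1 ≤ n) (p ρ : ℝ) {M : Motif}
    (hM : M ∈ motifFamily N d) :
    motifWeight n p ρ M * ((n.descFactorial M.1 : ℝ) * M.aut) = (ρ / (p * (1 - p))) ^ N := by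
  have hv := motifFamily_vertices_le hM
  have h := Nat.factorial_mul_descFactorial (hv.trans hn)
  have hd : (n.descFactorial M.1 : ℝ) ≠ 0 := by
    rw [Nat.cast_ne_zero]
    exact (Nat.descFactorial_pos.2 (hv.trans hn)).ne'
  have ha : (M.aut : ℝ) ≠ 0 := by exact_mod_cast M.aut_pos.ne'
  have hf : ((n - M.1).factorial : ℝ) ≠ 0 := by positivity
  rw [mem_motifFamily] at hM
  have hE : M.numEdges = N := hM.2.1
  rw [motifWeight, ← h, hE, div_pow]
  push_cast
  -- For degenerate p both sides are quotients by zero, hence 0.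
  by_cases hs : (p * (1 - p)) ^ N = 0
  · rw [hs]; simp
  · field_simp

/-! ### The statistic as a sum over pairs of copies -/

/-- Pairs of labelled copies of a motif of the family. -/
abbrev CopyPair (n N d : ℕ) : Type :=
  Σ M : motifFamily N d, (Fin M.1.1 ↪ Fin n) × (Fin M.1.1 ↪ Fin n)

namespace CopyPair

variable {n N d : ℕ}

/-- The first copy. -/
noncomputable def fst (i : CopyPair n N d) : Finset (Sym2 (Fin n)) :=
  edgesOf (i.1.1.graph.map i.2.1)

/-- The second copy. -/
noncomputable def snd (i : CopyPair n N d) : Finset (Sym2 (Fin n)) :=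
  edgesOf (i.1.1.graph.map i.2.2)

/-- The weight of the motif. -/
noncomputable def weight (p ρ : ℝ) (i : CopyPair n N d) : ℝ := motifWeight n p ρ i.1.1

theorem card_fst (i : CopyPair n N d) : i.fst.card = N :=
  (Motif.card_edgesOf_map _).trans (mem_motifFamily.1 i.1.2).2.1

theorem fst_subset (i : CopyPair n N d) : i.fst ⊆ vertexPairs n := edgesOf_subset _

theorem snd_subset (i : CopyPair n N d) : i.snd ⊆ vertexPairs n := edgesOf_subset _

theorem weight_nonneg {p ρ : ℝ} (hp : 0 ≤ p) (hp1 : p ≤ 1) (hρ : 0 ≤ ρ) (i : CopyPair n N d) :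
    0 ≤ i.weight p ρ := by
  have : 0 ≤ 1 - p := by linarith
  unfold weight motifWeight
  positivity

theorem sum_eq (f : (M : motifFamily N d) → (Fin M.1.1 ↪ Fin n) → (Fin M.1.1 ↪ Fin n) → ℝ) :
    ∑ i : CopyPair n N d, f i.1 i.2.1 i.2.2 = ∑ M, ∑ φ, ∑ ψ, f M φ ψ := by
  rw [Fintype.sum_sigma]
  simp_rw [Fintype.sum_prod_type]

end CopyPair

theorem motifStat_eq {n N d : ℕ} (p ρ : ℝ) (x : GraphPair n) :
    motifStat p ρ N d x = ∑ i : CopyPair n N d,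
      i.weight p ρ * (weightProd p i.fst x.1 * weightProd p i.snd x.2) := by
  unfold CopyPair.weight CopyPair.fst CopyPair.snd
  rw [CopyPair.sum_eq fun M φ ψ => motifWeight n p ρ M.1 *
    (weightProd p (edgesOf (M.1.graph.map φ)) x.1 * weightProd p (edgesOf (M.1.graph.map ψ)) x.2)]
  rw [motifStat, ← Finset.sum_coe_sort]
  refine Finset.sum_congr rfl fun M _ => ?_
  simp_rw [← Finset.mul_sum]
  rw [← Finset.sum_mul, injCount_eq, injCount_eq, mul_assoc]

theorem motifStat_relabelEquiv {n N d : ℕ} (p ρ : ℝ) (x : GraphPair n) (π : Equiv.Perm (Fin n)) :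
    motifStat p ρ N d (x.1, relabelEquiv π x.2) = motifStat p ρ N d x := by
  simp only [motifStat, injCount_relabelEquiv]

/-! ### First and second moments of the statistic. -/

open Classical in
/-- The expectation of `X_S(G₁) X_T(G₁) X_{S'}(G₂) X_{T'}(G₂)` in the aligned model. -/
noncomputable def fourMoment {n : ℕ} (p ρ : ℝ) (S S' T T' : Finset (Sym2 (Fin n))) : ℝ :=
  ∏ e ∈ vertexPairs n, pairMoment p ρ ((if e ∈ S then 1 else 0) + (if e ∈ T then 1 else 0))
    ((if e ∈ S' then 1 else 0) + (if e ∈ T' then 1 else 0))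

theorem massExp_sum {n : ℕ} {ι : Type*} (s : Finset ι) (μ : GraphPair n → ℝ) (c : ι → ℝ)
    (f : ι → GraphPair n → ℝ) :
    massExp μ (fun x => ∑ i ∈ s, c i * f i x) = ∑ i ∈ s, c i * massExp μ (f i) := by
  unfold massExp
  simp_rw [Finset.mul_sum]
  rw [Finset.sum_comm]
  refine Finset.sum_congr rfl fun i _ => Finset.sum_congr rfl fun x _ => by ring

theorem massExp_four {n : ℕ} (p ρ : ℝ) {S S' T T' : Finset (Sym2 (Fin n))}
    (hS : S ⊆ vertexPairs n) (hS' : S' ⊆ vertexPairs n) (hT : T ⊆ vertexPairs n)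
    (hT' : T' ⊆ vertexPairs n) :
    massExp (alignedMass p ρ) (fun x => (weightProd p S x.1 * weightProd p S' x.2) *
      (weightProd p T x.1 * weightProd p T' x.2)) = fourMoment p ρ S S' T T' := by
  classical
  rw [fourMoment, ← massExp_alignedMass_prod]
  refine congrArg _ (funext fun x => ?_)
  unfold weightProd
  simp_rw [pow_add, Finset.prod_mul_distrib]
  rw [← prod_eq_prod_vertexPairs_pow hS, ← prod_eq_prod_vertexPairs_pow hS',
    ← prod_eq_prod_vertexPairs_pow hT, ← prod_eq_prod_vertexPairs_pow hT']
  ring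

/-- The correlation r of the law is kept apart from the parameter ρ in the weights, because the null
hypothesis has r = 0 while the statistic still uses ρ. -/
theorem massExp_motifStat_sq {n N d : ℕ} (p ρ r : ℝ) :
    massExp (n := n) (alignedMass p r) (fun x => motifStat p ρ N d x ^ 2) =
      ∑ ij : CopyPair n N d × CopyPair n N d, (ij.1.weight p ρ * ij.2.weight p ρ) *
        fourMoment p r ij.1.fst ij.1.snd ij.2.fst ij.2.snd := by
  have : ∀ x : GraphPair n, motifStat p ρ N d x ^ 2 =
      ∑ ij : CopyPair n N d × CopyPair n N d, (ij.1.weight p ρ * ij.2.weight p ρ) *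
        ((weightProd p ij.1.fst x.1 * weightProd p ij.1.snd x.2) *
        (weightProd p ij.2.fst x.1 * weightProd p ij.2.snd x.2)) := by
    intro x
    rw [motifStat_eq, sq, Finset.sum_mul_sum, ← Finset.univ_product_univ, Finset.sum_product]
    refine Finset.sum_congr rfl fun i _ => Finset.sum_congr rfl fun j _ => by ring
  simp_rw [this]
  rw [massExp_sum]
  refine Finset.sum_congr rfl fun ij _ => ?_
  rw [massExp_four p r ij.1.fst_subset ij.1.snd_subset ij.2.fst_subset ij.2.snd_subset]

open Classical in
-- If S ≠ S', some vertex pair occurs in only one of the two products, and its centered weight has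
-- mean zero.
theorem fourMoment_empty {n : ℕ} (p ρ : ℝ) {S S' : Finset (Sym2 (Fin n))}
    (hS : S ⊆ vertexPairs n) (hS' : S' ⊆ vertexPairs n) :
    fourMoment p ρ S S' ∅ ∅ = if S = S' then (ρ * (p * (1 - p))) ^ S.card else 0 := by
  unfold fourMoment
  simp only [Finset.notMem_empty, if_false, add_zero]
  split_ifs with h
  · subst h
    rw [← Finset.prod_const, prod_eq_prod_vertexPairs_pow hS]
    refine Finset.prod_congr rfl fun e _ => ?_
    split_ifs
    · rw [pairMoment_one_one, pow_one]
    · rw [pairMoment_zero_zero, pow_zero]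
  · obtain ⟨e, he⟩ : ∃ e, ¬ (e ∈ S ↔ e ∈ S') := by
      by_contra hc
      push Not at hc
      exact h (Finset.ext hc)
    refine Finset.prod_eq_zero (i := e) ?_ ?_
    · by_cases h1 : e ∈ S
      · exact hS h1
      · by_cases h2 : e ∈ S'
        · exact hS' h2
        · exact absurd (iff_of_false h1 h2) he
    · by_cases h1 : e ∈ S <;> by_cases h2 : e ∈ S'
      · simp [h1, h2] at he
      · rw [if_pos h1, if_neg h2, pairMoment_one_zero]
      · rw [if_neg h1, if_pos h2, pairMoment_zero_one]
      · simp [h1, h2] at he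

theorem pow_mul_pow_div {a b : ℝ} (hb : b ≠ 0) (N : ℕ) : (a / b) ^ N * (a * b) ^ N = a ^ (2 * N) := by
  rw [← mul_pow, pow_mul]
  congr 1
  field_simp

open Classical in
theorem sum_weight_fst_eq_snd {n N d : ℕ} (hN : N ≠ 0) (hn : N + 1 ≤ n) (p ρ : ℝ) :
    ∑ i : CopyPair n N d, i.weight p ρ * (if i.fst = i.snd then 1 else 0) =
      (ρ / (p * (1 - p))) ^ N * (motifFamily N d).card := by
  unfold CopyPair.weight CopyPair.fst CopyPair.snd
  rw [CopyPair.sum_eq fun M φ ψ => motifWeight n p ρ M.1 *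
    (if edgesOf (M.1.graph.map φ) = edgesOf (M.1.graph.map ψ) then 1 else 0)]
  simp_rw [← Finset.mul_sum]
  rw [Finset.sum_congr rfl fun M _ => by
    rw [sum_map_eq_map hN M.2 M.2, if_pos rfl, motifWeight_mul hn p ρ M.2]]
  rw [Finset.sum_const, nsmul_eq_mul, mul_comm, Finset.card_univ, Fintype.card_coe]

/-- The mean of the statistic under the alternative. -/
theorem massExp_altMass_motifStat {n N d : ℕ} (hN : N ≠ 0) (hn : N + 1 ≤ n) {p : ℝ} (hp : 0 < p)
    (hp1 : p < 1) (ρ : ℝ) :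
    massExp (n := n) (altMass p ρ) (motifStat p ρ N d) =
      ρ ^ (2 * N) * (motifFamily N d).card := by
  classical
  rw [massExp_altMass p ρ _ fun x π => motifStat_relabelEquiv p ρ x π]
  -- Two empty copies are inserted so that the first moment is a case of the fourth moment.
  rw [show motifStat (n := n) p ρ N d = fun x => ∑ i : CopyPair n N d, i.weight p ρ *
    ((weightProd p i.fst x.1 * weightProd p i.snd x.2) *
      (weightProd p ∅ x.1 * weightProd p ∅ x.2)) from funext fun x => by
        rw [motifStat_eq]; simp [weightProd]]
  rw [massExp_sum]
  have : ∀ i : CopyPair n N d, i.weight p ρ * massExp (alignedMass p ρ) (fun x : GraphPair n =>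
      (weightProd p i.fst x.1 * weightProd p i.snd x.2) *
      (weightProd p ∅ x.1 * weightProd p ∅ x.2)) =
      i.weight p ρ * (if i.fst = i.snd then 1 else 0) * (ρ * (p * (1 - p))) ^ N := by
    intro i
    rw [massExp_four p ρ i.fst_subset i.snd_subset (Finset.empty_subset _)
      (Finset.empty_subset _), fourMoment_empty p ρ i.fst_subset i.snd_subset, mul_assoc, i.card_fst]
    split_ifs <;> simp
  simp_rw [this]
  have hs : p * (1 - p) ≠ 0 := (mul_pos hp (by linarith)).ne'
  rw [← Finset.sum_mul, sum_weight_fst_eq_snd hN hn, mul_right_comm, pow_mul_pow_div hs]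

open Classical in
-- Coincidence of the first copies and coincidence of the second copies factor; each sum is zero
-- unless the motifs agree. Only one factor |F| survives, in contrast to the pairing inside each
-- pair, which gives |F|².
theorem sum_weight_sq_eq {n N d : ℕ} (hN : N ≠ 0) (hn : N + 1 ≤ n) (p ρ : ℝ) :
    ∑ ij : CopyPair n N d × CopyPair n N d, (ij.1.weight p ρ * ij.2.weight p ρ) *
      (if ij.1.fst = ij.2.fst ∧ ij.1.snd = ij.2.snd then 1 else 0) =
      (ρ / (p * (1 - p))) ^ N * (ρ / (p * (1 - p))) ^ N * (motifFamily N d).card := by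
  rw [Fintype.sum_prod_type]
  unfold CopyPair.weight CopyPair.fst CopyPair.snd
  have h1 : ∀ i : CopyPair n N d, ∑ j : CopyPair n N d,
      motifWeight n p ρ i.1.1 * motifWeight n p ρ j.1.1 *
      (if edgesOf (i.1.1.graph.map i.2.1) = edgesOf (j.1.1.graph.map j.2.1) ∧
        edgesOf (i.1.1.graph.map i.2.2) = edgesOf (j.1.1.graph.map j.2.2) then 1 else 0) =
      ∑ M : motifFamily N d, ∑ φ : Fin M.1.1 ↪ Fin n, ∑ ψ : Fin M.1.1 ↪ Fin n,
        motifWeight n p ρ i.1.1 * motifWeight n p ρ M.1 *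
        ((if edgesOf (i.1.1.graph.map i.2.1) = edgesOf (M.1.graph.map φ) then 1 else 0) *
        (if edgesOf (i.1.1.graph.map i.2.2) = edgesOf (M.1.graph.map ψ) then 1 else 0)) := by
    intro i
    rw [← CopyPair.sum_eq]
    refine Finset.sum_congr rfl fun j _ => ?_
    rw [ite_and]
    split_ifs <;> simp
  simp_rw [h1]
  rw [CopyPair.sum_eq fun M φ ψ => ∑ M' : motifFamily N d, ∑ φ' : Fin M'.1.1 ↪ Fin n,
    ∑ ψ' : Fin M'.1.1 ↪ Fin n, motifWeight n p ρ M.1 * motifWeight n p ρ M'.1 *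
        ((if edgesOf (M.1.graph.map φ) = edgesOf (M'.1.graph.map φ') then 1 else 0) *
        (if edgesOf (M.1.graph.map ψ) = edgesOf (M'.1.graph.map ψ') then 1 else 0))]
  have h2 : ∀ M : motifFamily N d, ∑ φ : Fin M.1.1 ↪ Fin n, ∑ ψ : Fin M.1.1 ↪ Fin n,
      ∑ M' : motifFamily N d, ∑ φ' : Fin M'.1.1 ↪ Fin n, ∑ ψ' : Fin M'.1.1 ↪ Fin n,
        motifWeight n p ρ M.1 * motifWeight n p ρ M'.1 *
        ((if edgesOf (M.1.graph.map φ) = edgesOf (M'.1.graph.map φ') then 1 else 0) *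
        (if edgesOf (M.1.graph.map ψ) = edgesOf (M'.1.graph.map ψ') then 1 else 0)) =
      (ρ / (p * (1 - p))) ^ N * (ρ / (p * (1 - p))) ^ N := by
    intro M
    have h3 : ∀ M' : motifFamily N d, ∑ φ : Fin M.1.1 ↪ Fin n, ∑ ψ : Fin M.1.1 ↪ Fin n,
        ∑ φ' : Fin M'.1.1 ↪ Fin n, ∑ ψ' : Fin M'.1.1 ↪ Fin n,
        motifWeight n p ρ M.1 * motifWeight n p ρ M'.1 *
        ((if edgesOf (M.1.graph.map φ) = edgesOf (M'.1.graph.map φ') then 1 else 0) *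
        (if edgesOf (M.1.graph.map ψ) = edgesOf (M'.1.graph.map ψ') then 1 else 0)) =
        if M = M' then (ρ / (p * (1 - p))) ^ N * (ρ / (p * (1 - p))) ^ N else 0 := by
      intro M'
      have h4 := sum_map_eq_map (n := n) hN M.2 M'.2
      simp_rw [← Finset.mul_sum, ← Finset.sum_mul, ← Finset.mul_sum, ← Finset.sum_mul, h4,
        Subtype.val_inj]
      split_ifs with h
      · subst h
        rw [← motifWeight_mul hn p ρ M.2]
        ring
      · ring
    rw [← Fintype.sum_ite_eq M fun _ => (ρ / (p * (1 - p))) ^ N * (ρ / (p * (1 - p))) ^ N]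
    simp_rw [← h3]
    exact (Finset.sum_congr rfl fun φ _ => Finset.sum_comm).trans Finset.sum_comm
  simp_rw [h2]
  rw [Finset.sum_const, nsmul_eq_mul, mul_comm, Finset.card_univ, Fintype.card_coe]

/-! ### Overlaps of four copies -/

/-- `S` is the edge set and `V` the vertex set of a connected graph with `N` edges, all degrees at
most `d` and no isolated vertex. -/
structure IsConnectedCopy {n : ℕ} (N d : ℕ) (S : Finset (Sym2 (Fin n))) (V : Finset (Fin n)) :
    Prop where
  subset : S ⊆ vertexPairs n
  mem_of_mem : ∀ e ∈ S, ∀ a ∈ e, a ∈ V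
  exists_edge : ∀ a ∈ V, ∃ e ∈ S, a ∈ e
  connected : ∀ A : Set (Fin n), (∃ a ∈ V, a ∈ A) →
    (∀ e ∈ S, (∃ a ∈ e, a ∈ A) → ∀ b ∈ e, b ∈ A) → ∀ b ∈ V, b ∈ A
  degree_le : ∀ a, (S.filter fun e => a ∈ e).card ≤ d
  card_eq : S.card = N
  nonempty : V.Nonempty

/-- The number of copies containing the vertex pair `e`. -/
def edgeMult {n : ℕ} (S : Fin 4 → Finset (Sym2 (Fin n))) (e : Sym2 (Fin n)) : ℕ :=
  ∑ k, if e ∈ S k then 1 else 0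

/-- The number of copies containing the vertex `a`. -/
def vertexMult {n : ℕ} (V : Fin 4 → Finset (Fin n)) (a : Fin n) : ℕ :=
  ∑ k, if a ∈ V k then 1 else 0

section Overlap

variable {n N d : ℕ} {S : Fin 4 → Finset (Sym2 (Fin n))} {V : Fin 4 → Finset (Fin n)}

theorem edgeMult_pos {e : Sym2 (Fin n)} {k : Fin 4} (h : e ∈ S k) : 0 < edgeMult S e := by
  unfold edgeMult
  refine Finset.sum_pos' (fun _ _ => by positivity) ⟨k, Finset.mem_univ _, ?_⟩
  simp [h]

theorem edgeMult_eq_zero {e : Sym2 (Fin n)} : edgeMult S e = 0 ↔ ∀ k, e ∉ S k := by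
  simp [edgeMult]

theorem vertexMult_eq_card (a : Fin n) :
    vertexMult V a = (Finset.univ.filter fun k => a ∈ V k).card := by
  simp [vertexMult]

theorem edgeMult_eq_card (e : Sym2 (Fin n)) :
    edgeMult S e = (Finset.univ.filter fun k => e ∈ S k).card := by
  simp [edgeMult]

theorem edgeMult_le_vertexMult (h : ∀ k, IsConnectedCopy N d (S k) (V k)) {e : Sym2 (Fin n)}
    {a : Fin n} (ha : a ∈ e) : edgeMult S e ≤ vertexMult V a := by
  rw [edgeMult_eq_card, vertexMult_eq_card]
  refine Finset.card_le_card fun k hk => ?_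
  rw [Finset.mem_filter] at hk ⊢
  exact ⟨hk.1, (h k).mem_of_mem e hk.2 a ha⟩

/-- The assumption that no edge has multiplicity one is what a nonzero fourth moment provides
(`fourMoment_eq_zero`). -/
theorem exists_ne_mem (hS : ∀ e, edgeMult S e ≠ 1) {e : Sym2 (Fin n)} {k : Fin 4} (he : e ∈ S k) :
    ∃ l, l ≠ k ∧ e ∈ S l := by
  have h1 := edgeMult_pos he
  have h2 := hS e
  rw [edgeMult_eq_card] at h1 h2
  obtain ⟨l, hl, hlk⟩ := Finset.exists_mem_ne (by omega : 1 < (Finset.univ.filter fun k => e ∈ S k).card) k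
  exact ⟨l, hlk, (Finset.mem_filter.1 hl).2⟩

theorem two_le_vertexMult (h : ∀ k, IsConnectedCopy N d (S k) (V k)) (hS : ∀ e, edgeMult S e ≠ 1)
    {a : Fin n} {k : Fin 4} (ha : a ∈ V k) : 2 ≤ vertexMult V a := by
  obtain ⟨e, he, hae⟩ := (h k).exists_edge a ha
  have h1 := edgeMult_pos he
  have h2 := hS e
  have := edgeMult_le_vertexMult h hae
  omega

theorem sum_edgeMult (hS : ∀ k, (S k).card = N) :
    ∑ e ∈ Finset.univ.biUnion S, edgeMult S e = 4 * N := by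
  unfold edgeMult
  rw [Finset.sum_comm]
  have : ∀ k, (∑ e ∈ Finset.univ.biUnion S, if e ∈ S k then 1 else 0) = N := by
    intro k
    rw [← hS k, Finset.sum_ite_mem, Finset.inter_eq_right.2
      (Finset.subset_biUnion_of_mem S (Finset.mem_univ k)), Finset.card_eq_sum_ones]
  simp [this]

theorem sum_vertexMult : ∑ a ∈ Finset.univ.biUnion V, vertexMult V a = ∑ k, (V k).card := by
  unfold vertexMult
  rw [Finset.sum_comm]
  refine Finset.sum_congr rfl fun k _ => ?_
  rw [Finset.sum_ite_mem, Finset.inter_eq_right.2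
      (Finset.subset_biUnion_of_mem V (Finset.mem_univ k)), Finset.card_eq_sum_ones]

theorem sum_edgeMult_filter_le (h : ∀ k, IsConnectedCopy N d (S k) (V k)) (a : Fin n) :
    ∑ e ∈ (Finset.univ.biUnion S).filter (fun e => a ∈ e), edgeMult S e ≤ d * vertexMult V a := by
  unfold edgeMult vertexMult
  rw [Finset.sum_comm, Finset.mul_sum]
  refine Finset.sum_le_sum fun k _ => ?_
  rw [Finset.sum_ite_mem, ← Finset.card_eq_sum_ones]
  split_ifs with ha
  · rw [mul_one]
    refine le_trans (Finset.card_le_card fun e he => ?_) ((h k).degree_le a)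
    rw [Finset.mem_inter, Finset.mem_filter] at he
    exact Finset.mem_filter.2 ⟨he.2, he.1.2⟩
  · rw [mul_zero, Nat.le_zero, Finset.card_eq_zero]
    ext e
    simp only [Finset.mem_inter, Finset.mem_filter, Finset.notMem_empty, iff_false]
    rintro ⟨⟨-, h1⟩, h2⟩
    exact ha ((h k).mem_of_mem e h2 a h1)

/-- Let m be the multiplicity of a. An edge at a has multiplicity m_e ≤ m, so m_e - 2 ≤ (1 - 2/m)
m_e, where m ≥ 2. The m_e sum to at most dm by the degree bound, so the excesses sum to at most d(m
- 2). Multiplying by m keeps everything in the integers. -/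
theorem sum_excess_filter_le (h : ∀ k, IsConnectedCopy N d (S k) (V k))
    (hS : ∀ e, edgeMult S e ≠ 1) {a : Fin n} (ha : a ∈ Finset.univ.biUnion V) :
    ∑ e ∈ (Finset.univ.biUnion S).filter (fun e => a ∈ e), ((edgeMult S e : ℤ) - 2) ≤
      d * ((vertexMult V a : ℤ) - 2) := by
  obtain ⟨k, -, hk⟩ := Finset.mem_biUnion.1 ha
  have h2 : (2 : ℤ) ≤ vertexMult V a := by exact_mod_cast two_le_vertexMult h hS hk
  have h3 : (vertexMult V a : ℤ) *
      ∑ e ∈ (Finset.univ.biUnion S).filter (fun e => a ∈ e), ((edgeMult S e : ℤ) - 2) ≤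
      ((vertexMult V a : ℤ) - 2) *
      ∑ e ∈ (Finset.univ.biUnion S).filter (fun e => a ∈ e), (edgeMult S e : ℤ) := by
    rw [Finset.mul_sum, Finset.mul_sum]
    refine Finset.sum_le_sum fun e he => ?_
    have : (edgeMult S e : ℤ) ≤ vertexMult V a := by
      exact_mod_cast edgeMult_le_vertexMult h (Finset.mem_filter.1 he).2
    linarith
  have h4 : ∑ e ∈ (Finset.univ.biUnion S).filter (fun e => a ∈ e), (edgeMult S e : ℤ) ≤
      d * vertexMult V a := by exact_mod_cast sum_edgeMult_filter_le h a
  have h5 := h3.trans (mul_le_mul_of_nonneg_left h4 (by linarith))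
  refine le_of_mul_le_mul_left (h5.trans_eq ?_) (by linarith : (0 : ℤ) < vertexMult V a)
  ring

theorem card_filter_mem_eq_two (h : ∀ k, IsConnectedCopy N d (S k) (V k)) {e : Sym2 (Fin n)}
    (he : e ∈ Finset.univ.biUnion S) :
    ((Finset.univ.biUnion V).filter fun a => a ∈ e).card = 2 := by
  obtain ⟨k, -, hk⟩ := Finset.mem_biUnion.1 he
  rw [← Sym2.card_toFinset_of_not_isDiag e (mem_vertexPairs.1 ((h k).subset hk))]
  congr 1
  ext a
  rw [Finset.mem_filter, Sym2.mem_toFinset]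
  exact ⟨fun h' => h'.2, fun h' => ⟨Finset.mem_biUnion.2 ⟨k, Finset.mem_univ _,
    (h k).mem_of_mem e hk a h'⟩, h'⟩⟩

/-- The excess of edges is at most `d / 2` times the excess of vertices. -/
theorem excess_edges_le (h : ∀ k, IsConnectedCopy N d (S k) (V k)) (hS : ∀ e, edgeMult S e ≠ 1) :
    2 * (4 * (N : ℤ) - 2 * (Finset.univ.biUnion S).card) ≤
      d * ((∑ k, ((V k).card : ℤ)) - 2 * (Finset.univ.biUnion V).card) := by
  have h1 : ∑ e ∈ Finset.univ.biUnion S, ((edgeMult S e : ℤ) - 2) =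
      4 * (N : ℤ) - 2 * (Finset.univ.biUnion S).card := by
    rw [Finset.sum_sub_distrib, Finset.sum_const, nsmul_eq_mul, mul_comm _ (2 : ℤ)]
    congr 1
    exact_mod_cast sum_edgeMult fun k => (h k).card_eq
  have h2 : ∑ a ∈ Finset.univ.biUnion V, ((vertexMult V a : ℤ) - 2) =
      (∑ k, ((V k).card : ℤ)) - 2 * (Finset.univ.biUnion V).card := by
    rw [Finset.sum_sub_distrib, Finset.sum_const, nsmul_eq_mul, mul_comm _ (2 : ℤ)]
    congr 1
    exact_mod_cast sum_vertexMult
  rw [← h1, ← h2, Finset.mul_sum, Finset.mul_sum]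
  -- Double counting: each edge has exactly two endpoints, whence the factor 2.
  have h3 : ∑ e ∈ Finset.univ.biUnion S, 2 * ((edgeMult S e : ℤ) - 2) =
      ∑ a ∈ Finset.univ.biUnion V,
        ∑ e ∈ (Finset.univ.biUnion S).filter (fun e => a ∈ e), ((edgeMult S e : ℤ) - 2) := by
    simp_rw [Finset.sum_filter]
    rw [Finset.sum_comm]
    refine Finset.sum_congr rfl fun e he => ?_
    rw [← Finset.sum_filter, Finset.sum_const, card_filter_mem_eq_two h he, nsmul_eq_mul]
    rfl
  rw [h3]
  exact Finset.sum_le_sum fun a ha => sum_excess_filter_le h hS ha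

theorem two_mul_card_lt_of_vertexMult (h : ∀ k, IsConnectedCopy N d (S k) (V k))
    (hS : ∀ e, edgeMult S e ≠ 1) {a : Fin n} (ha : 3 ≤ vertexMult V a) :
    2 * (Finset.univ.biUnion V).card + 1 ≤ ∑ k, (V k).card := by
  rw [← sum_vertexMult, Nat.succ_le_iff, mul_comm, ← smul_eq_mul, ← Finset.sum_const]
  refine Finset.sum_lt_sum (fun b hb => ?_) ⟨a, ?_, ha⟩
  · obtain ⟨k, -, hk⟩ := Finset.mem_biUnion.1 hb
    exact two_le_vertexMult h hS hk
  · by_contra hc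
    have : vertexMult V a = 0 := by
      simp only [Finset.mem_biUnion, Finset.mem_univ, true_and, not_exists] at hc
      simp [vertexMult, hc]
    omega

theorem eq_or_eq_of_vertexMult_le {a : Fin n} (ha : vertexMult V a ≤ 2) {k l m : Fin 4}
    (hk : a ∈ V k) (hl : a ∈ V l) (hm : a ∈ V m) (hlk : l ≠ k) (hmk : m ≠ k) : m = l := by
  by_contra hml
  have : ({k, l, m} : Finset (Fin 4)) ⊆ Finset.univ.filter fun k => a ∈ V k := by
    intro x hx
    simp only [Finset.mem_insert, Finset.mem_singleton] at hx
    rcases hx with rfl | rfl | rfl <;> simpa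
  have h3 := Finset.card_le_card this
  rw [← vertexMult_eq_card, Finset.card_eq_three.2 ⟨k, l, m, hlk.symm, hmk.symm, Ne.symm hml, rfl⟩]
    at h3
  omega

/-- Some edge of copy k is shared with another copy l. At a vertex common to k and l no third copy
is present, so every edge of k at this vertex must also be shared with l. By connectivity this
spreads over all of k, and equal numbers of edges turn the inclusion into equality. -/
theorem exists_ne_eq (h : ∀ k, IsConnectedCopy N d (S k) (V k)) (hS : ∀ e, edgeMult S e ≠ 1)
    (hV : ∀ a, vertexMult V a ≤ 2) (k : Fin 4) : ∃ l, l ≠ k ∧ S k = S l := by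
  obtain ⟨a, ha⟩ := (h k).nonempty
  obtain ⟨e, he, hae⟩ := (h k).exists_edge a ha
  obtain ⟨l, hlk, hel⟩ := exists_ne_mem hS he
  have key : ∀ e ∈ S k, ∀ b ∈ e, b ∈ V l → e ∈ S l := by
    intro e he b hb hbl
    obtain ⟨m, hmk, hem⟩ := exists_ne_mem hS he
    have := eq_or_eq_of_vertexMult_le (hV b) ((h k).mem_of_mem e he b hb) hbl
      ((h m).mem_of_mem e hem b hb) hlk hmk
    rwa [this] at hem
  have hsub : ∀ b ∈ V k, b ∈ (V l : Set (Fin n)) := by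
    refine (h k).connected _ ⟨a, ha, (h l).mem_of_mem e hel a hae⟩ ?_
    rintro e he ⟨b, hb, hbl⟩ c hc
    exact (h l).mem_of_mem e (key e he b hb hbl) c hc
  refine ⟨l, hlk, Finset.eq_of_subset_of_card_le (fun e he => ?_) ?_⟩
  · obtain ⟨b, hb⟩ : ∃ b, b ∈ e := ⟨_, Sym2.out_fst_mem e⟩
    exact key e he b hb (hsub b ((h k).mem_of_mem e he b hb))
  · rw [(h k).card_eq, (h l).card_eq]

/-- Each copy equals another one by `exists_ne_eq`, and three equal copies would give an edge of
multiplicity three. So the equalities form a perfect matching of the four copies, and the two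
classes are disjoint. -/
theorem paired_of_vertexMult_le (h : ∀ k, IsConnectedCopy N d (S k) (V k))
    (hS : ∀ e, edgeMult S e ≠ 1) (hV : ∀ a, vertexMult V a ≤ 2) :
    (S 0 = S 1 ∧ S 2 = S 3 ∧ Disjoint (S 0) (S 2)) ∨
    (S 0 = S 2 ∧ S 1 = S 3 ∧ Disjoint (S 0) (S 1)) ∨
    (S 0 = S 3 ∧ S 1 = S 2 ∧ Disjoint (S 0) (S 1)) := by
  have hE : ∀ e, edgeMult S e ≤ 2 := fun e =>
    (edgeMult_le_vertexMult h (Sym2.out_fst_mem e)).trans (hV _)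
  have hne : ∀ k, ∃ e, e ∈ S k := by
    intro k
    obtain ⟨a, ha⟩ := (h k).nonempty
    obtain ⟨e, he, -⟩ := (h k).exists_edge a ha
    exact ⟨e, he⟩
  have hd : ∀ k l m o : Fin 4, S k = S l → S m = S o → k ≠ l → m ≠ o → k ≠ m → l ≠ m →
      Disjoint (S k) (S m) := by
    intro k l m o hkl hmo hkl' hmo' hkm hlm
    rw [Finset.disjoint_left]
    intro e hek hem
    have : ({k, l, m} : Finset (Fin 4)) ⊆ Finset.univ.filter fun k => e ∈ S k := by
      intro x hx
      simp only [Finset.mem_insert, Finset.mem_singleton] at hx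
      rcases hx with rfl | rfl | rfl
      · simpa
      · simpa [← hkl]
      · simpa
    have h3 := Finset.card_le_card this
    rw [← edgeMult_eq_card, Finset.card_eq_three.2 ⟨k, l, m, hkl', hkm, hlm, rfl⟩] at h3
    have := hE e
    omega
  have hno : ∀ k l m : Fin 4, k ≠ l → k ≠ m → l ≠ m → S k = S l → S k ≠ S m := by
    intro k l m hkl hkm hlm h1 h2
    obtain ⟨e, he⟩ := hne k
    exact Finset.disjoint_left.1 (hd k l m k h1 h2.symm hkl hkm.symm hkm hlm) he (h2 ▸ he)
  obtain ⟨l, hl, h0⟩ := exists_ne_eq h hS hV 0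
  fin_cases l
  · exact absurd rfl hl
  · left
    have h0 : S 0 = S 1 := h0
    obtain ⟨m, hm, h2⟩ := exists_ne_eq h hS hV 2
    have h23 : S 2 = S 3 := by
      fin_cases m
      · exact absurd h2.symm (hno 0 1 2 (by decide) (by decide) (by decide) h0)
      · exact absurd h2.symm (hno 1 0 2 (by decide) (by decide) (by decide) h0.symm)
      · exact absurd rfl hm
      · exact h2
    exact ⟨h0, h23, hd 0 1 2 3 h0 h23 (by decide) (by decide) (by decide) (by decide)⟩
  · right; left
    have h0 : S 0 = S 2 := h0
    obtain ⟨m, hm, h1⟩ := exists_ne_eq h hS hV 1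
    have h13 : S 1 = S 3 := by
      fin_cases m
      · exact absurd h1.symm (hno 0 2 1 (by decide) (by decide) (by decide) h0)
      · exact absurd rfl hm
      · exact absurd h1.symm (hno 2 0 1 (by decide) (by decide) (by decide) h0.symm)
      · exact h1
    exact ⟨h0, h13, hd 0 2 1 3 h0 h13 (by decide) (by decide) (by decide) (by decide)⟩
  · right; right
    have h0 : S 0 = S 3 := h0
    obtain ⟨m, hm, h1⟩ := exists_ne_eq h hS hV 1
    have h12 : S 1 = S 2 := by
      fin_cases m
      · exact absurd h1.symm (hno 0 3 1 (by decide) (by decide) (by decide) h0)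
      · exact absurd rfl hm
      · exact h1
      · exact absurd h1.symm (hno 3 0 1 (by decide) (by decide) (by decide) h0.symm)
    exact ⟨h0, h12, hd 0 3 1 2 h0 h12 (by decide) (by decide) (by decide) (by decide)⟩

/-! ### Bounds for the fourth moments -/

theorem edgeMult_four (S S' T T' : Finset (Sym2 (Fin n))) (e : Sym2 (Fin n)) :
    edgeMult ![S, S', T, T'] e = ((if e ∈ S then 1 else 0) + (if e ∈ T then 1 else 0)) +
      ((if e ∈ S' then 1 else 0) + (if e ∈ T' then 1 else 0)) := by
  unfold edgeMult
  rw [Fin.sum_univ_four]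
  change (if e ∈ S then 1 else 0) + (if e ∈ S' then 1 else 0) + (if e ∈ T then 1 else 0) +
    (if e ∈ T' then 1 else 0) = _
  ring

theorem fourMoment_eq_zero {p ρ : ℝ} {S S' T T' : Finset (Sym2 (Fin n))} {e : Sym2 (Fin n)}
    (he : e ∈ vertexPairs n) (h : edgeMult ![S, S', T, T'] e = 1) :
    fourMoment p ρ S S' T T' = 0 := by
  classical
  rw [edgeMult_four] at h
  refine Finset.prod_eq_zero he ?_
  obtain ⟨h1, h2⟩ | ⟨h1, h2⟩ := Nat.add_eq_one_iff.1 h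
  · convert pairMoment_zero_one p ρ
  · convert pairMoment_one_zero p ρ

/-- One factor p(1-p) per edge of the union; vertex pairs outside the union contribute 1. -/
theorem abs_fourMoment_le {p ρ : ℝ} (hp : 0 ≤ p) (hp1 : p ≤ 1) (hρ : 0 ≤ ρ) (hρ1 : ρ ≤ 1)
    {S : Fin 4 → Finset (Sym2 (Fin n))} (hS : ∀ k, S k ⊆ vertexPairs n) :
    |fourMoment p ρ (S 0) (S 1) (S 2) (S 3)| ≤
      (p * (1 - p)) ^ (Finset.univ.biUnion S).card := by
  classical
  have hS4 : S = ![S 0, S 1, S 2, S 3] := by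
    funext k; fin_cases k <;> rfl
  have hU : Finset.univ.biUnion S ⊆ vertexPairs n := by
    intro e he
    obtain ⟨k, -, hk⟩ := Finset.mem_biUnion.1 he
    exact hS k hk
  rw [← Finset.prod_const, prod_eq_prod_vertexPairs_pow hU, fourMoment, Finset.abs_prod]
  refine Finset.prod_le_prod (fun _ _ => abs_nonneg _) fun e _ => ?_
  have hm := edgeMult_four (S 0) (S 1) (S 2) (S 3) e
  rw [← hS4] at hm
  by_cases he : e ∈ Finset.univ.biUnion S
  · rw [if_pos he]
    obtain ⟨k, -, hk⟩ := Finset.mem_biUnion.1 he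
    have := edgeMult_pos hk
    rw [pow_one]
    refine abs_pairMoment_le hp hp1 hρ hρ1 ?_ ?_ ?_
    · split_ifs <;> omega
    · split_ifs <;> omega
    · convert this using 1
      rw [hm]
  · rw [if_neg he]
    have hk : ∀ k, e ∉ S k := fun k hk => he (Finset.mem_biUnion.2 ⟨k, Finset.mem_univ _, hk⟩)
    simp [hk, pairMoment_zero_zero]

theorem fourMoment_first_pairing {p ρ : ℝ} {S T : Finset (Sym2 (Fin n))} (hS : S ⊆ vertexPairs n)
    (hT : T ⊆ vertexPairs n) (h : Disjoint S T) :
    fourMoment p ρ S S T T = (ρ * (p * (1 - p))) ^ (S.card + T.card) := by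
  classical
  rw [pow_add, ← Finset.prod_const, ← Finset.prod_const, prod_eq_prod_vertexPairs_pow hS,
    prod_eq_prod_vertexPairs_pow hT, ← Finset.prod_mul_distrib, fourMoment]
  refine Finset.prod_congr rfl fun e _ => ?_
  by_cases h1 : e ∈ S
  · have h2 := Finset.disjoint_left.1 h h1
    simp [h1, h2, pairMoment_one_one]
  · by_cases h2 : e ∈ T <;> simp [h1, h2, pairMoment_one_one, pairMoment_zero_zero]

/-- Here the equal copies lie in the same graph, so variances appear and the correlation does not;
this pairing is present under the null hypothesis as well. -/
theorem fourMoment_second_pairing {p ρ : ℝ} {S T : Finset (Sym2 (Fin n))} (hS : S ⊆ vertexPairs n)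
    (hT : T ⊆ vertexPairs n) (h : Disjoint S T) :
    fourMoment p ρ S T S T = (p * (1 - p)) ^ (S.card + T.card) := by
  classical
  rw [pow_add, ← Finset.prod_const, ← Finset.prod_const, prod_eq_prod_vertexPairs_pow hS,
    prod_eq_prod_vertexPairs_pow hT, ← Finset.prod_mul_distrib, fourMoment]
  refine Finset.prod_congr rfl fun e _ => ?_
  by_cases h1 : e ∈ S
  · have h2 := Finset.disjoint_left.1 h h1
    simp [h1, h2, pairMoment_two_zero]
  · by_cases h2 : e ∈ T <;> simp [h1, h2, pairMoment_zero_two, pairMoment_zero_zero]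

theorem fourMoment_third_pairing {p ρ : ℝ} {S T : Finset (Sym2 (Fin n))} (hS : S ⊆ vertexPairs n)
    (hT : T ⊆ vertexPairs n) (h : Disjoint S T) :
    fourMoment p ρ S T T S = (ρ * (p * (1 - p))) ^ (S.card + T.card) := by
  rw [← fourMoment_first_pairing hS hT h]
  classical
  refine Finset.prod_congr rfl fun e _ => ?_
  by_cases h1 : e ∈ S
  · have h2 := Finset.disjoint_left.1 h h1
    simp [h1, h2]
  · by_cases h2 : e ∈ T <;> simp [h1, h2]

open Classical in
/-- The fourth moment is at most its three pairings plus the contribution of the overlaps with a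
vertex of multiplicity at least three. -/
theorem fourMoment_le {p ρ : ℝ} (hp : 0 ≤ p) (hp1 : p ≤ 1) (hρ : 0 ≤ ρ) (hρ1 : ρ ≤ 1)
    (h : ∀ k, IsConnectedCopy N d (S k) (V k)) :
    fourMoment p ρ (S 0) (S 1) (S 2) (S 3) ≤
      (ρ * (p * (1 - p))) ^ (2 * N) * (if S 0 = S 1 ∧ S 2 = S 3 then 1 else 0) +
      (p * (1 - p)) ^ (2 * N) * (if S 0 = S 2 ∧ S 1 = S 3 then 1 else 0) +
      (ρ * (p * (1 - p))) ^ (2 * N) * (if S 0 = S 3 ∧ S 1 = S 2 then 1 else 0) +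
      (if (∀ e, edgeMult S e ≠ 1) ∧ ∃ a, 3 ≤ vertexMult V a then
        (p * (1 - p)) ^ (Finset.univ.biUnion S).card else 0) := by
  have hs : 0 ≤ p * (1 - p) := mul_nonneg hp (by linarith)
  have hA : ∀ (P : Prop) [Decidable P], 0 ≤ (ρ * (p * (1 - p))) ^ (2 * N) * (if P then (1 : ℝ) else 0) := by
    intro P _; positivity
  have hB : ∀ (P : Prop) [Decidable P], 0 ≤ (p * (1 - p)) ^ (2 * N) * (if P then (1 : ℝ) else 0) := by
    intro P _; positivity
  have hC : ∀ (P : Prop) [Decidable P], 0 ≤ (if P then (p * (1 - p)) ^ (Finset.univ.biUnion S).card else 0) := by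
    intro P _; positivity
  have hA1 := hA (S 0 = S 1 ∧ S 2 = S 3)
  have hA2 := hA (S 0 = S 3 ∧ S 1 = S 2)
  have hB1 := hB (S 0 = S 2 ∧ S 1 = S 3)
  have hC1 := hC ((∀ e, edgeMult S e ≠ 1) ∧ ∃ a, 3 ≤ vertexMult V a)
  by_cases hS : ∀ e, edgeMult S e ≠ 1
  · by_cases hV : ∃ a, 3 ≤ vertexMult V a
    · have := (le_abs_self _).trans (abs_fourMoment_le hp hp1 hρ hρ1 fun k => (h k).subset)
      rw [if_pos (⟨hS, hV⟩ : (∀ e, edgeMult S e ≠ 1) ∧ ∃ a, 3 ≤ vertexMult V a)]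
      linarith
    · push Not at hV
      obtain ⟨h1, h2, h3⟩ | ⟨h1, h2, h3⟩ | ⟨h1, h2, h3⟩ :=
        paired_of_vertexMult_le h hS fun a => Nat.le_of_lt_succ (hV a)
      · have := fourMoment_first_pairing (p := p) (ρ := ρ) (h 0).subset (h 2).subset h3
        rw [(h 0).card_eq, (h 2).card_eq, ← two_mul] at this
        rw [if_pos (⟨h1, h2⟩ : S 0 = S 1 ∧ S 2 = S 3), ← h1, ← h2, this]
        rw [← h1, ← h2] at hA2 hB1
        linarith
      · have := fourMoment_second_pairing (p := p) (ρ := ρ) (h 0).subset (h 1).subset h3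
        rw [(h 0).card_eq, (h 1).card_eq, ← two_mul] at this
        rw [if_pos (⟨h1, h2⟩ : S 0 = S 2 ∧ S 1 = S 3), ← h1, ← h2, this]
        rw [← h1, ← h2] at hA2 hA1
        linarith
      · have := fourMoment_third_pairing (p := p) (ρ := ρ) (h 0).subset (h 1).subset h3
        rw [(h 0).card_eq, (h 1).card_eq, ← two_mul] at this
        rw [if_pos (⟨h1, h2⟩ : S 0 = S 3 ∧ S 1 = S 2), ← h1, ← h2, this]
        rw [← h1, ← h2] at hA1 hB1
        linarith
  · push Not at hS
    obtain ⟨e, he⟩ := hS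
    have hS4 : S = ![S 0, S 1, S 2, S 3] := by
      funext k; fin_cases k <;> rfl
    have hev : e ∈ vertexPairs n := by
      by_contra hc
      have : edgeMult S e = 0 := edgeMult_eq_zero.2 fun k hk => hc ((h k).subset hk)
      omega
    rw [fourMoment_eq_zero (e := e) hev (by rw [← hS4]; exact he)]
    linarith

end Overlap

/-- The condition N ≠ 0 excludes the single vertex, so no vertex is isolated. For connectivity, a
set closed under the edges is followed along a walk of the motif. -/
theorem isConnectedCopy_map {n N d : ℕ} (hN : N ≠ 0) {M : Motif} (hM : M ∈ motifFamily N d)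
    (φ : Fin M.1 ↪ Fin n) :
    IsConnectedCopy N d (edgesOf (M.graph.map φ)) (Finset.univ.map φ) where
  subset := edgesOf_subset _
  mem_of_mem e he a ha := by
    rw [edgesOf_map, Finset.mem_map] at he
    obtain ⟨e', -, rfl⟩ := he
    obtain ⟨b, -, rfl⟩ := Sym2.mem_map.1 ha
    simp
  exists_edge a ha := by
    obtain ⟨x, -, rfl⟩ := Finset.mem_map.1 ha
    obtain ⟨y, hy⟩ := (mem_motifFamily.1 hM).exists_adj hN x
    refine ⟨s(φ x, φ y), mem_edgesOf.2 ?_, Sym2.mem_mk_left _ _⟩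
    exact SimpleGraph.map_adj_apply.2 hy
  connected A := by
    rintro ⟨a, ha, haA⟩ hA b hb
    obtain ⟨x, -, rfl⟩ := Finset.mem_map.1 ha
    obtain ⟨y, -, rfl⟩ := Finset.mem_map.1 hb
    obtain ⟨w⟩ := (mem_motifFamily.1 hM).1.preconnected x y
    clear ha hb
    induction w with
    | nil => exact haA
    | cons hadj w ih =>
      refine ih (hA s(_, _) (mem_edgesOf.2 ?_) ⟨_, Sym2.mem_mk_left _ _, haA⟩ _
        (Sym2.mem_mk_right _ _))
      exact SimpleGraph.map_adj_apply.2 hadj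
  degree_le a := by
    by_cases ha : ∃ x, φ x = a
    · obtain ⟨x, rfl⟩ := ha
      refine le_trans ?_ ((mem_motifFamily.1 hM).2.2 x)
      rw [Set.ncard_eq_toFinset_card _ (Set.toFinite _)]
      refine le_trans (Finset.card_le_card (t := Finset.image (fun y => s(φ x, φ y)) _) ?_)
        Finset.card_image_le
      intro e he
      rw [Finset.mem_filter, mem_edgesOf] at he
      obtain ⟨he, hx⟩ := he
      obtain ⟨b, rfl⟩ := Sym2.mem_iff_exists.1 hx
      obtain ⟨x', y, hxy, hx', rfl⟩ := (SimpleGraph.map_adj _ _ _ _).1 he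
      rw [φ.injective hx'] at hxy
      exact Finset.mem_image.2 ⟨y, by simpa using hxy, rfl⟩
    · refine le_trans (Nat.le_of_eq ?_) (Nat.zero_le d)
      rw [Finset.card_eq_zero]
      ext e
      simp only [Finset.mem_filter, Finset.notMem_empty, iff_false, not_and]
      intro he hae
      rw [edgesOf_map, Finset.mem_map] at he
      obtain ⟨e', -, rfl⟩ := he
      obtain ⟨b, -, hb⟩ := Sym2.mem_map.1 hae
      exact ha ⟨b, hb⟩
  card_eq := (Motif.card_edgesOf_map _).trans (mem_motifFamily.1 hM).2.1
  nonempty := by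
    obtain ⟨x⟩ := (mem_motifFamily.1 hM).1.nonempty
    exact ⟨φ x, by simp⟩

/-! ### The second moment of the statistic -/

/-- Let m be the number of points. The maps with image of size k number at most n^k m^m, which
cancels the weight n^(-k); there are m + 1 possible sizes. -/
theorem sum_inv_pow_card_image_le {ι : Type*} [Fintype ι] [DecidableEq ι] {n : ℕ} (hn : 1 ≤ n) :
    ∑ Φ : ι → Fin n, ((n : ℝ)⁻¹) ^ (Finset.univ.image Φ).card ≤
      ((Fintype.card ι + 1 : ℕ) : ℝ) * (Fintype.card ι : ℝ) ^ Fintype.card ι := by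
  classical
  set m := Fintype.card ι with hm
  have hcard : ∀ Φ : ι → Fin n, (Finset.univ.image Φ).card ∈ Finset.range (m + 1) := by
    intro Φ
    rw [Finset.mem_range]
    exact Nat.lt_succ_of_le Finset.card_image_le
  have hn0 : (n : ℝ) ≠ 0 := by exact_mod_cast (by omega : n ≠ 0)
  rw [← Finset.sum_fiberwise_of_maps_to (fun Φ _ => hcard Φ), ← nsmul_eq_mul]
  refine (Finset.sum_le_card_nsmul _ _ ((m : ℝ) ^ m) fun k hk => ?_).trans_eq
    (by rw [Finset.card_range])
  rw [Finset.sum_congr rfl (g := fun _ => ((n : ℝ)⁻¹) ^ k)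
    fun Φ hΦ => by rw [(Finset.mem_filter.1 hΦ).2]]
  rw [Finset.sum_const, nsmul_eq_mul]
  have hk' : k ≤ m := Nat.lt_succ_iff.1 (Finset.mem_range.1 hk)
  -- First the image, one of at most n^k sets, then a map into it, one of k^m ≤ m^m.
  have h1 : (Finset.univ.filter fun Φ : ι → Fin n => (Finset.univ.image Φ).card = k).card ≤
      n ^ k * m ^ m := by
    have hsub : (Finset.univ.filter fun Φ : ι → Fin n => (Finset.univ.image Φ).card = k) ⊆
        (Finset.powersetCard k Finset.univ).biUnion fun R : Finset (Fin n) =>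
          Fintype.piFinset fun _ : ι => R := by
      intro Φ hΦ
      rw [Finset.mem_biUnion]
      refine ⟨Finset.univ.image Φ, Finset.mem_powersetCard.2 ⟨Finset.subset_univ _,
        (Finset.mem_filter.1 hΦ).2⟩, ?_⟩
      simp
    refine (Finset.card_le_card hsub).trans ((Finset.card_biUnion_le_card_mul _ _ (m ^ m)
      fun R hR => ?_).trans ?_)
    · rw [Fintype.card_piFinset, Finset.prod_const, Finset.card_univ, (Finset.mem_powersetCard.1 hR).2]
      exact Nat.pow_le_pow_left hk' _
    · rw [Finset.card_powersetCard, Finset.card_univ, Fintype.card_fin]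
      exact Nat.mul_le_mul_right _ (Nat.choose_le_pow n k)
  calc _ ≤ ((n ^ k * m ^ m : ℕ) : ℝ) * ((n : ℝ)⁻¹) ^ k := by
        exact mul_le_mul_of_nonneg_right (by exact_mod_cast h1) (by positivity)
    _ = (m : ℝ) ^ m := by
        push_cast
        rw [inv_pow]
        field_simp

/-- Automorphisms are dropped, and the falling factorial is at least (n/2)^v because 2v ≤ n. -/
theorem motifWeight_le {n N d : ℕ} (hn : 2 * (N + 1) ≤ n) {p ρ : ℝ} (hp : 0 < p) (hp1 : p < 1)
    (hρ : 0 ≤ ρ) {M : Motif} (hM : M ∈ motifFamily N d) :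
    motifWeight n p ρ M ≤ (ρ / (p * (1 - p))) ^ N * (2 * (n : ℝ)⁻¹) ^ M.1 := by
  have hs : 0 < p * (1 - p) := mul_pos hp (by linarith)
  have hv := motifFamily_vertices_le hM
  have hn0 : (0 : ℝ) < n := by exact_mod_cast (by omega : 0 < n)
  rw [← motifWeight_mul (by omega : N + 1 ≤ n) p ρ hM, mul_assoc]
  have hw : 0 ≤ motifWeight n p ρ M := by
    have : 0 ≤ 1 - p := by linarith
    unfold motifWeight
    positivity
  refine le_mul_of_one_le_right hw ?_
  have h1 : ((n : ℝ) / 2) ^ M.1 ≤ (n.descFactorial M.1 : ℝ) := by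
    have h2 : (((n + 1 - M.1) ^ M.1 : ℕ) : ℝ) ≤ (n.descFactorial M.1 : ℝ) := by
      exact_mod_cast Nat.pow_sub_le_descFactorial n M.1
    refine le_trans ?_ h2
    rw [Nat.cast_pow]
    refine pow_le_pow_left₀ (by positivity) ?_ _
    have : (n : ℝ) ≤ 2 * ((n + 1 - M.1 : ℕ) : ℝ) := by
      exact_mod_cast (by omega : n ≤ 2 * (n + 1 - M.1))
    linarith
  have h3 : (1 : ℝ) ≤ M.aut := by exact_mod_cast M.aut_pos
  calc (1 : ℝ) = ((n : ℝ) / 2) ^ M.1 * 1 * (2 * (n : ℝ)⁻¹) ^ M.1 := by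
        rw [mul_one, ← mul_pow]
        have : (n : ℝ) / 2 * (2 * (n : ℝ)⁻¹) = 1 := by field_simp
        rw [this, one_pow]
    _ ≤ _ := by gcongr

/-- The exponent count behind the bound for the overlaps. -/
theorem overlap_exponent_le {n d U N v w : ℕ} {s δ : ℝ} (hn : 1 ≤ n) (hd : 0 < d) (hs : 0 < s)
    (hδ : 0 ≤ δ) (hδ1 : δ ≤ 1) (h : (n : ℝ) ^ (-(2 / (d : ℝ) * (1 - δ))) ≤ s) (hU : U ≤ 2 * N)
    (hUw : 2 * (4 * (N : ℤ) - 2 * U) ≤ d * (2 * (v : ℤ) - 2 * w)) (hw : 2 * w + 1 ≤ 2 * v) :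
    ((n : ℝ)⁻¹) ^ v * (s ^ U / s ^ (2 * N)) ≤ (n : ℝ) ^ (-δ / 2) * ((n : ℝ)⁻¹) ^ w := by
  have hn0 : (0 : ℝ) < n := by exact_mod_cast hn
  have hx : 0 ≤ Real.log n := Real.log_nonneg (by exact_mod_cast hn)
  have hd0 : (0 : ℝ) < d := by exact_mod_cast hd
  have hy : -(2 / (d : ℝ) * (1 - δ)) * Real.log n ≤ Real.log s := by
    rw [← Real.log_rpow hn0]
    exact Real.log_le_log (by positivity) h
  rw [← Real.log_le_log_iff (by positivity) (by positivity), Real.log_mul (by positivity)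
    (by positivity), Real.log_mul (by positivity) (by positivity), Real.log_div (by positivity)
    (by positivity), Real.log_rpow hn0]
  simp only [Real.log_pow, Real.log_inv]
  have hU' : (U : ℝ) ≤ 2 * N := by exact_mod_cast hU
  have hUw' : 2 * (4 * (N : ℝ) - 2 * U) ≤ d * (2 * (v : ℝ) - 2 * w) := by exact_mod_cast hUw
  have hw' : 2 * (w : ℝ) + 1 ≤ 2 * v := by exact_mod_cast hw
  -- The 2N - U lost edges cost at most n^(2(1-δ)/d) each; by the excess inequality 2/d lost edges
  -- are paid for by one lost vertex.
  have h1 : (2 * N - U : ℝ) * (-Real.log s) ≤ (2 * N - U : ℝ) * (2 / d * (1 - δ) * Real.log n) :=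
    mul_le_mul_of_nonneg_left (by linarith) (by linarith)
  have h2 : (2 * N - U : ℝ) * (2 / d) ≤ v - w := by
    rw [mul_div_assoc', div_le_iff₀ hd0]
    nlinarith
  have h3 : (2 * N - U : ℝ) * (2 / d) * ((1 - δ) * Real.log n) ≤
      (v - w) * ((1 - δ) * Real.log n) :=
    mul_le_mul_of_nonneg_right h2 (mul_nonneg (by linarith) hx)
  -- The share δ of the gain from vertices is not spent on edges. Since v - w ≥ 1/2 it leaves
  -- n^(-δ/2).
  have h4 : 0 ≤ (2 * (v : ℝ) - 2 * w - 1) * (δ * Real.log n) :=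
    mul_nonneg (by linarith) (mul_nonneg hδ hx)
  push_cast
  nlinarith

namespace CopyPair

variable {n N d : ℕ}

/-- The edge sets of the four copies of two pairs. -/
noncomputable def edgeSets (ij : CopyPair n N d × CopyPair n N d) :
    Fin 4 → Finset (Sym2 (Fin n)) := ![ij.1.fst, ij.1.snd, ij.2.fst, ij.2.snd]

/-- The vertex sets of the four copies of two pairs. -/
def vertexSets (ij : CopyPair n N d × CopyPair n N d) : Fin 4 → Finset (Fin n) :=
  ![Finset.univ.map ij.1.2.1, Finset.univ.map ij.1.2.2, Finset.univ.map ij.2.2.1,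
    Finset.univ.map ij.2.2.2]

theorem isConnectedCopy (hN : N ≠ 0) (ij : CopyPair n N d × CopyPair n N d) (k : Fin 4) :
    IsConnectedCopy N d (edgeSets ij k) (vertexSets ij k) := by
  fin_cases k <;> exact isConnectedCopy_map hN (Subtype.prop _) _

theorem sum_card_vertexSets (ij : CopyPair n N d × CopyPair n N d) :
    ∑ k, (vertexSets ij k).card = 2 * (ij.1.1.1.1 + ij.2.1.1.1) := by
  simp only [vertexSets, Fin.sum_univ_four, Matrix.cons_val, Finset.card_map, Finset.card_univ,
    Fintype.card_fin]
  ring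

/-- The swap of the two copies. -/
def swapEquiv : CopyPair n N d ≃ CopyPair n N d :=
  Equiv.sigmaCongrRight fun _ => Equiv.prodComm _ _

/-- The four embeddings of two pairs as a single map. -/
def joint {M M' : Motif} (f : ((Fin M.1 ↪ Fin n) × (Fin M.1 ↪ Fin n)) ×
    ((Fin M'.1 ↪ Fin n) × (Fin M'.1 ↪ Fin n))) :
    (Fin M.1 ⊕ Fin M.1) ⊕ (Fin M'.1 ⊕ Fin M'.1) → Fin n :=
  Sum.elim (Sum.elim f.1.1 f.1.2) (Sum.elim f.2.1 f.2.2)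

theorem joint_injective {M M' : Motif} : Function.Injective (joint (n := n) (M := M) (M' := M')) := by
  rintro ⟨⟨a, b⟩, c, e⟩ ⟨⟨a', b'⟩, c', e'⟩ h
  have h1 : a = a' := by
    ext x
    exact congrArg Fin.val (congrFun h (Sum.inl (Sum.inl x)))
  have h2 : b = b' := by
    ext x
    exact congrArg Fin.val (congrFun h (Sum.inl (Sum.inr x)))
  have h3 : c = c' := by
    ext x
    exact congrArg Fin.val (congrFun h (Sum.inr (Sum.inl x)))
  have h4 : e = e' := by
    ext x
    exact congrArg Fin.val (congrFun h (Sum.inr (Sum.inr x)))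
  rw [h1, h2, h3, h4]

theorem biUnion_vertexSets (M M' : motifFamily N d) (f : ((Fin M.1.1 ↪ Fin n) ×
    (Fin M.1.1 ↪ Fin n)) × ((Fin M'.1.1 ↪ Fin n) × (Fin M'.1.1 ↪ Fin n))) :
    Finset.univ.biUnion (vertexSets ((⟨M, f.1⟩, ⟨M', f.2⟩) : CopyPair n N d × CopyPair n N d)) =
      Finset.univ.image (joint f) := by
  ext a
  simp only [Finset.mem_biUnion, Finset.mem_univ, true_and, Finset.mem_image, vertexSets,
    Fin.exists_fin_succ, Sum.exists, joint, Sum.elim_inl, Sum.elim_inr]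
  simp [or_assoc]

/-- The four embeddings form one map from at most 4N + 4 points. Forgetting injectivity only
enlarges the sum, and `sum_inv_pow_card_image_le` applies for each of the |F|² pairs of motifs. -/
theorem sum_inv_pow_le {δ : ℝ} (hn : 1 ≤ n) :
    ∑ ij : CopyPair n N d × CopyPair n N d,
      4 ^ (N + 1) * ((n : ℝ) ^ (-δ / 2) *
        ((n : ℝ)⁻¹) ^ (Finset.univ.biUnion (vertexSets ij)).card) ≤
      (motifFamily N d).card ^ 2 *
        (4 ^ (N + 1) * (4 * N + 5 : ℝ) ^ (4 * N + 5) * (n : ℝ) ^ (-δ / 2)) := by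
  simp_rw [← Finset.mul_sum]
  have h : ∀ M M' : motifFamily N d, ∑ f : ((Fin M.1.1 ↪ Fin n) × (Fin M.1.1 ↪ Fin n)) ×
      ((Fin M'.1.1 ↪ Fin n) × (Fin M'.1.1 ↪ Fin n)), ((n : ℝ)⁻¹) ^ (Finset.univ.biUnion
      (vertexSets ((⟨M, f.1⟩, ⟨M', f.2⟩) : CopyPair n N d × CopyPair n N d))).card ≤
      (4 * N + 5 : ℝ) ^ (4 * N + 5) := by
    intro M M'
    simp_rw [biUnion_vertexSets]
    have h1 : ∑ f : ((Fin M.1.1 ↪ Fin n) × (Fin M.1.1 ↪ Fin n)) ×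
      ((Fin M'.1.1 ↪ Fin n) × (Fin M'.1.1 ↪ Fin n)),
        ((n : ℝ)⁻¹) ^ (Finset.univ.image (joint f)).card ≤
        ∑ Φ : (Fin M.1.1 ⊕ Fin M.1.1) ⊕ (Fin M'.1.1 ⊕ Fin M'.1.1) → Fin n,
          ((n : ℝ)⁻¹) ^ (Finset.univ.image Φ).card := by
      rw [← Finset.sum_image (f := fun Φ => ((n : ℝ)⁻¹) ^ (Finset.univ.image Φ).card)
        (joint_injective.injOn)]
      exact Finset.sum_le_sum_of_subset_of_nonneg (Finset.subset_univ _)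
        fun _ _ _ => by positivity
    refine h1.trans ((sum_inv_pow_card_image_le hn).trans ?_)
    have hM := motifFamily_vertices_le M.2
    have hM' := motifFamily_vertices_le M'.2
    have hm : Fintype.card ((Fin M.1.1 ⊕ Fin M.1.1) ⊕ (Fin M'.1.1 ⊕ Fin M'.1.1)) ≤ 4 * N + 4 := by
      simp only [Fintype.card_sum, Fintype.card_fin]
      omega
    generalize Fintype.card ((Fin M.1.1 ⊕ Fin M.1.1) ⊕ (Fin M'.1.1 ⊕ Fin M'.1.1)) = m at hm
    have : (m + 1) * m ^ m ≤ (4 * N + 5) ^ (4 * N + 5) :=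
      calc (m + 1) * m ^ m ≤ (4 * N + 5) * (4 * N + 5) ^ (4 * N + 4) := by
            refine Nat.mul_le_mul (by omega) ?_
            exact (Nat.pow_le_pow_left (by omega) _).trans (Nat.pow_le_pow_right (by omega) hm)
        _ = (4 * N + 5) ^ (4 * N + 5) := by rw [← pow_succ']
    exact_mod_cast this
  have h2 : ∑ ij : CopyPair n N d × CopyPair n N d,
      ((n : ℝ)⁻¹) ^ (Finset.univ.biUnion (vertexSets ij)).card ≤
      (motifFamily N d).card ^ 2 * (4 * N + 5 : ℝ) ^ (4 * N + 5) := by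
    rw [Fintype.sum_prod_type, Fintype.sum_sigma]
    have h3 : ∀ M : motifFamily N d, ∑ φ : (Fin M.1.1 ↪ Fin n) × (Fin M.1.1 ↪ Fin n),
        ∑ j : CopyPair n N d, ((n : ℝ)⁻¹) ^ (Finset.univ.biUnion (vertexSets (⟨M, φ⟩, j))).card ≤
        (motifFamily N d).card * (4 * N + 5 : ℝ) ^ (4 * N + 5) := by
      intro M
      simp_rw [Fintype.sum_sigma]
      rw [Finset.sum_comm]
      refine (Finset.sum_le_card_nsmul _ _ ((4 * N + 5 : ℝ) ^ (4 * N + 5)) fun M' _ => ?_).trans_eq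
        (by rw [nsmul_eq_mul, Finset.card_univ, Fintype.card_coe])
      rw [← Fintype.sum_prod_type']
      exact h M M'
    refine (Finset.sum_le_card_nsmul _ _ _ fun M _ => h3 M).trans_eq ?_
    rw [nsmul_eq_mul, Finset.card_univ, Fintype.card_coe]
    ring
  calc _ ≤ 4 ^ (N + 1) * ((n : ℝ) ^ (-δ / 2) *
        ((motifFamily N d).card ^ 2 * (4 * N + 5 : ℝ) ^ (4 * N + 5))) := by gcongr
    _ = _ := by ring

end CopyPair

theorem pow_div_mul_mul {s : ℝ} (hs : s ≠ 0) (ρ x : ℝ) (N a b U : ℕ) :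
    ((ρ / s) ^ N * (2 * x) ^ a) * ((ρ / s) ^ N * (2 * x) ^ b) * s ^ U =
      ρ ^ (2 * N) * (2 ^ (a + b) * (x ^ (a + b) * (s ^ U / s ^ (2 * N)))) := by
  rw [div_pow, mul_pow, mul_pow, two_mul N, pow_add, pow_add, pow_add, pow_add]
  field_simp

open Classical in
/-- The contribution of the overlaps with a vertex of multiplicity at least three. -/
theorem sum_overlap_le {n N d : ℕ} {p ρ δ : ℝ} (hN : N ≠ 0) (hn : 2 * (N + 1) ≤ n) (hd : 0 < d)
    (hp : 0 < p) (hp1 : p < 1) (hρ : 0 ≤ ρ) (hδ : 0 ≤ δ) (hδ1 : δ ≤ 1)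
    (h : (n : ℝ) ^ (-(2 / (d : ℝ) * (1 - δ))) ≤ p * (1 - p)) :
    ∑ ij : CopyPair n N d × CopyPair n N d, (ij.1.weight p ρ * ij.2.weight p ρ) *
      (if (∀ e, edgeMult (CopyPair.edgeSets ij) e ≠ 1) ∧
        ∃ a, 3 ≤ vertexMult (CopyPair.vertexSets ij) a then
        (p * (1 - p)) ^ (Finset.univ.biUnion (CopyPair.edgeSets ij)).card else 0) ≤
      ρ ^ (2 * N) * ((motifFamily N d).card ^ 2 *
        (4 ^ (N + 1) * (4 * N + 5 : ℝ) ^ (4 * N + 5) * (n : ℝ) ^ (-δ / 2))) := by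
  have hs : 0 < p * (1 - p) := mul_pos hp (by linarith)
  refine le_trans ?_ (mul_le_mul_of_nonneg_left
    (CopyPair.sum_inv_pow_le (δ := δ) (by omega : 1 ≤ n)) (by positivity))
  rw [Finset.mul_sum]
  refine Finset.sum_le_sum fun ij _ => ?_
  split_ifs with hbad
  · obtain ⟨hS, a, ha⟩ := hbad
    have hc := CopyPair.isConnectedCopy hN ij
    have hcard := CopyPair.sum_card_vertexSets ij
    have hw := two_mul_card_lt_of_vertexMult hc hS ha
    have hex := excess_edges_le hc hS
    have hcard' : ∑ k, ((CopyPair.vertexSets ij k).card : ℤ) =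
      2 * ((ij.1.1.1.1 + ij.2.1.1.1 : ℕ) : ℤ) := by exact_mod_cast hcard
    rw [hcard'] at hex
    rw [hcard] at hw
    -- Every edge of the union is counted at least twice among the 4N edges.
    have hU : (Finset.univ.biUnion (CopyPair.edgeSets ij)).card ≤ 2 * N := by
      have h1 := sum_edgeMult fun k => (hc k).card_eq
      have h2 : (Finset.univ.biUnion (CopyPair.edgeSets ij)).card * 2 ≤ 4 * N := by
        rw [← h1, ← smul_eq_mul, ← Finset.sum_const]
        refine Finset.sum_le_sum fun e he => ?_
        obtain ⟨k, -, hk⟩ := Finset.mem_biUnion.1 he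
        have h3 := edgeMult_pos hk
        have h4 := hS e
        omega
      omega
    have hexp := overlap_exponent_le (by omega : 1 ≤ n) hd hs hδ hδ1 h hU hex hw
    have hv : ij.1.1.1.1 + ij.2.1.1.1 ≤ 2 * (N + 1) := by
      have h1 := motifFamily_vertices_le ij.1.1.2
      have h2 := motifFamily_vertices_le ij.2.1.2
      omega
    have hw1 := motifWeight_le hn hp hp1 hρ ij.1.1.2
    have hw2 := motifWeight_le hn hp hp1 hρ ij.2.1.2
    have hw0 := ij.1.weight_nonneg (p := p) hp.le hp1.le hρ
    have hw0' := ij.2.weight_nonneg (p := p) hp.le hp1.le hρ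
    generalize Finset.card (Finset.univ.biUnion (CopyPair.edgeSets ij)) = U at *
    generalize Finset.card (Finset.univ.biUnion (CopyPair.vertexSets ij)) = w at *
    calc ij.1.weight p ρ * ij.2.weight p ρ * (p * (1 - p)) ^ U ≤
        ((ρ / (p * (1 - p))) ^ N * (2 * (n : ℝ)⁻¹) ^ ij.1.1.1.1) *
        ((ρ / (p * (1 - p))) ^ N * (2 * (n : ℝ)⁻¹) ^ ij.2.1.1.1) * (p * (1 - p)) ^ U := by
          refine mul_le_mul_of_nonneg_right ?_ (by positivity)
          exact mul_le_mul hw1 hw2 hw0' (hw0.trans hw1)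
      _ = ρ ^ (2 * N) * (2 ^ (ij.1.1.1.1 + ij.2.1.1.1) * (((n : ℝ)⁻¹) ^ (ij.1.1.1.1 + ij.2.1.1.1) *
          ((p * (1 - p)) ^ U / (p * (1 - p)) ^ (2 * N)))) := by
          exact pow_div_mul_mul hs.ne' _ _ _ _ _ _
      _ ≤ ρ ^ (2 * N) * (2 ^ (2 * (N + 1)) * ((n : ℝ) ^ (-δ / 2) * ((n : ℝ)⁻¹) ^ w)) := by
          gcongr
          norm_num
      _ = _ := by rw [show (2 : ℝ) ^ (2 * (N + 1)) = 4 ^ (N + 1) by rw [pow_mul]; norm_num]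
  · rw [mul_zero]
    positivity

theorem pow_mul_pow_div_mul {s : ℝ} (hs : s ≠ 0) (r ρ F : ℝ) (N : ℕ) :
    (r * s) ^ (2 * N) * ((ρ / s) ^ N * (ρ / s) ^ N * F) = (r * ρ) ^ (2 * N) * F := by
  rw [← pow_add, ← two_mul, ← mul_assoc, ← mul_pow]
  congr 2
  field_simp

/-- The four summands come from the three pairings and from the overlaps with a vertex of
multiplicity at least three, in the order of `fourMoment_le`. -/
theorem massExp_motifStat_sq_le {n N d : ℕ} {p ρ r δ : ℝ} (hN : N ≠ 0) (hn : 2 * (N + 1) ≤ n)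
    (hd : 0 < d) (hp : 0 < p) (hp1 : p < 1) (hρ : 0 ≤ ρ) (hr : 0 ≤ r) (hr1 : r ≤ 1)
    (hδ : 0 ≤ δ) (hδ1 : δ ≤ 1) (h : (n : ℝ) ^ (-(2 / (d : ℝ) * (1 - δ))) ≤ p * (1 - p)) :
    massExp (n := n) (alignedMass p r) (fun x => motifStat p ρ N d x ^ 2) ≤
      (r * ρ) ^ (2 * N) * (motifFamily N d).card ^ 2 + ρ ^ (2 * N) * (motifFamily N d).card +
      (r * ρ) ^ (2 * N) * (motifFamily N d).card +
      ρ ^ (2 * N) * ((motifFamily N d).card ^ 2 *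
        (4 ^ (N + 1) * (4 * N + 5 : ℝ) ^ (4 * N + 5) * (n : ℝ) ^ (-δ / 2))) := by
  classical
  have hs : 0 < p * (1 - p) := mul_pos hp (by linarith)
  rw [massExp_motifStat_sq]
  have key : ∀ ij : CopyPair n N d × CopyPair n N d, (ij.1.weight p ρ * ij.2.weight p ρ) *
      fourMoment p r ij.1.fst ij.1.snd ij.2.fst ij.2.snd ≤
      (r * (p * (1 - p))) ^ (2 * N) * ((ij.1.weight p ρ * (if ij.1.fst = ij.1.snd then 1 else 0)) *
        (ij.2.weight p ρ * (if ij.2.fst = ij.2.snd then 1 else 0))) +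
      (p * (1 - p)) ^ (2 * N) * ((ij.1.weight p ρ * ij.2.weight p ρ) *
        (if ij.1.fst = ij.2.fst ∧ ij.1.snd = ij.2.snd then 1 else 0)) +
      (r * (p * (1 - p))) ^ (2 * N) * ((ij.1.weight p ρ * ij.2.weight p ρ) *
        (if ij.1.fst = ij.2.snd ∧ ij.1.snd = ij.2.fst then 1 else 0)) +
      (ij.1.weight p ρ * ij.2.weight p ρ) *
      (if (∀ e, edgeMult (CopyPair.edgeSets ij) e ≠ 1) ∧
        ∃ a, 3 ≤ vertexMult (CopyPair.vertexSets ij) a then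
        (p * (1 - p)) ^ (Finset.univ.biUnion (CopyPair.edgeSets ij)).card else 0) := by
    intro ij
    have hw : 0 ≤ ij.1.weight p ρ * ij.2.weight p ρ := mul_nonneg
      (ij.1.weight_nonneg (p := p) hp.le hp1.le hρ) (ij.2.weight_nonneg (p := p) hp.le hp1.le hρ)
    have h1 := fourMoment_le hp.le hp1.le hr hr1 (CopyPair.isConnectedCopy hN ij)
    refine (mul_le_mul_of_nonneg_left h1 hw).trans_eq ?_
    rw [mul_add, mul_add, mul_add]
    congr 1
    congr 1
    · congr 1
      · rw [ite_and]
        change _ * (_ * (if ij.1.fst = ij.1.snd then if ij.2.fst = ij.2.snd then 1 else 0 else 0)) = _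
        split_ifs <;> ring
      · change _ * (_ * (if ij.1.fst = ij.2.fst ∧ ij.1.snd = ij.2.snd then 1 else 0)) = _
        ring
    · change _ * (_ * (if ij.1.fst = ij.2.snd ∧ ij.1.snd = ij.2.fst then 1 else 0)) = _
      ring
  refine (Finset.sum_le_sum fun ij _ => key ij).trans ?_
  rw [Finset.sum_add_distrib, Finset.sum_add_distrib, Finset.sum_add_distrib]
  refine add_le_add (add_le_add (add_le_add ?_ ?_) ?_)
    (sum_overlap_le hN hn hd hp hp1 hρ hδ hδ1 h)
  · have e := Finset.sum_mul_sum Finset.univ Finset.univ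
      (fun i : CopyPair n N d => i.weight p ρ * (if i.fst = i.snd then 1 else 0))
      (fun i : CopyPair n N d => i.weight p ρ * (if i.fst = i.snd then 1 else 0))
    rw [sum_weight_fst_eq_snd hN (by omega), ← Fintype.sum_prod_type'] at e
    rw [← Finset.mul_sum, ← e, mul_mul_mul_comm, pow_mul_pow_div_mul hs.ne', sq]
  · have := pow_mul_pow_div_mul hs.ne' 1 ρ (motifFamily N d).card N
    rw [one_mul, one_mul] at this
    rw [← Finset.mul_sum, sum_weight_sq_eq hN (by omega), this]
  · rw [← Finset.mul_sum]
    -- Swapping the copies of the second pair turns the third pairing into the second one.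
    have : ∑ ij : CopyPair n N d × CopyPair n N d, (ij.1.weight p ρ * ij.2.weight p ρ) *
        (if ij.1.fst = ij.2.snd ∧ ij.1.snd = ij.2.fst then 1 else 0) =
        ∑ ij : CopyPair n N d × CopyPair n N d, (ij.1.weight p ρ * ij.2.weight p ρ) *
        (if ij.1.fst = ij.2.fst ∧ ij.1.snd = ij.2.snd then 1 else 0) :=
      Fintype.sum_equiv ((Equiv.refl _).prodCongr CopyPair.swapEquiv) _ _ fun ij => rfl
    rw [this, sum_weight_sq_eq hN (by omega), pow_mul_pow_div_mul hs.ne']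

/-! ### Chebyshev's inequality -/

theorem massProb_le_massExp_div {n : ℕ} {μ : GraphPair n → ℝ} (hμ : ∀ x, 0 ≤ μ x)
    {A : Set (GraphPair n)} {f : GraphPair n → ℝ} {c : ℝ} (hc : 0 < c) (hf : ∀ x, 0 ≤ f x)
    (hA : ∀ x ∈ A, c ≤ f x) : massProb μ A ≤ massExp μ f / c := by
  classical
  rw [le_div_iff₀ hc]
  unfold massProb massExp
  rw [Finset.sum_mul, Finset.sum_filter]
  refine Finset.sum_le_sum fun x _ => ?_
  split_ifs with hx
  · exact mul_le_mul_of_nonneg_left (hA x hx) (hμ x)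
  · exact mul_nonneg (hμ x) (hf x)

/-- The error bound of the motif counting test. -/
theorem totalError_le {n N d : ℕ} {p ρ δ : ℝ} (hN : N ≠ 0) (hn : 2 * (N + 1) ≤ n)
    (hd : 0 < d) (hp : 0 < p) (hp1 : p < 1) (hρ : 0 < ρ) (hρ1 : ρ ≤ 1)
    (hδ : 0 ≤ δ) (hδ1 : δ ≤ 1) (h : (n : ℝ) ^ (-(2 / (d : ℝ) * (1 - δ))) ≤ p * (1 - p))
    (hF : 0 < (motifFamily N d).card) :
    totalError n p ρ N d ≤ 12 / (ρ ^ (2 * N) * (motifFamily N d).card) +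
      8 * (4 ^ (N + 1) * (4 * N + 5 : ℝ) ^ (4 * N + 5) * (n : ℝ) ^ (-δ / 2)) / ρ ^ (2 * N) := by
  have hET := massExp_altMass_motifStat (n := n) (d := d) hN (by omega) hp hp1 ρ
  have h0 := massExp_motifStat_sq_le (r := 0) hN hn hd hp hp1 hρ.le le_rfl zero_le_one hδ hδ1 h
  have h1 := massExp_motifStat_sq_le (r := ρ) hN hn hd hp hp1 hρ.le hρ.le hρ1 hδ hδ1 h
  -- At r = 0 the two pairings that use the correlation vanish, in particular the term with |F|².
  rw [zero_mul, zero_pow (by omega : 2 * N ≠ 0)] at h0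
  rw [← nullMass_eq_alignedMass] at h0
  rw [← massExp_altMass p ρ _ fun x π => by rw [motifStat_relabelEquiv]] at h1
  have hmass : massExp (n := n) (altMass p ρ) (fun _ => 1) = 1 := by
    rw [massExp_altMass p ρ _ fun _ _ => rfl, massExp_alignedMass_one]
  set E := 4 ^ (N + 1) * (4 * N + 5 : ℝ) ^ (4 * N + 5) * (n : ℝ) ^ (-δ / 2) with hE
  have hE0 : 0 ≤ E := by positivity
  set F : ℝ := ((motifFamily N d).card : ℝ) with hFdef
  have hF0 : 0 < F := by rw [hFdef]; exact_mod_cast hF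
  set R := ρ ^ (2 * N) with hR
  have hR0 : 0 < R := by positivity
  have hR1 : R ≤ 1 := pow_le_one₀ hρ.le hρ1
  have hτ : testThreshold n p ρ N d = R * F / 2 := by rw [testThreshold, hET]
  have hτ0 : 0 < R * F / 2 := by positivity
  unfold totalError
  rw [hτ]
  have hnull : massProb (n := n) (nullMass p) {x | R * F / 2 ≤ motifStat p ρ N d x} ≤
      (R * F + R * (F ^ 2 * E)) / (R * F / 2) ^ 2 := by
    refine (massProb_le_massExp_div (f := fun x => motifStat p ρ N d x ^ 2) (fun x => ?_)
      (by positivity : 0 < (R * F / 2) ^ 2) (fun x => sq_nonneg _) fun x hx => ?_).trans ?_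
    · rw [nullMass_eq_alignedMass]
      exact alignedMass_nonneg hp.le hp1.le le_rfl zero_le_one x
    · exact pow_le_pow_left₀ hτ0.le hx 2
    · gcongr
      linarith
  have halt : massProb (n := n) (altMass p ρ) {x | motifStat p ρ N d x < R * F / 2} ≤
      (2 * (R * F) + R * (F ^ 2 * E)) / (R * F / 2) ^ 2 := by
    refine (massProb_le_massExp_div (f := fun x => (motifStat p ρ N d x - R * F) ^ 2)
      (fun x => altMass_nonneg hp.le hp1.le hρ.le hρ1 x)
      (by positivity : 0 < (R * F / 2) ^ 2) (fun x => sq_nonneg _) fun x hx => ?_).trans ?_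
    · have hx' : motifStat p ρ N d x < R * F / 2 := hx
      rw [← neg_sq (motifStat p ρ N d x - R * F)]
      exact pow_le_pow_left₀ hτ0.le (by linarith) 2
    · gcongr
      have hexp : massExp (n := n) (altMass p ρ) (fun x => (motifStat p ρ N d x - R * F) ^ 2) =
          massExp (n := n) (altMass p ρ) (fun x => motifStat p ρ N d x ^ 2) -
          2 * (R * F) * massExp (n := n) (altMass p ρ) (motifStat p ρ N d) +
          (R * F) ^ 2 * massExp (n := n) (altMass p ρ) (fun _ => 1) := by
        unfold massExp
        rw [Finset.mul_sum, Finset.mul_sum, ← Finset.sum_sub_distrib, ← Finset.sum_add_distrib]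
        refine Finset.sum_congr rfl fun x _ => by ring
      rw [hexp, hET, hmass]
      -- The first term of the second moment is now exactly the squared mean and cancels in the
      -- variance.
      have hRR : (ρ * ρ) ^ (2 * N) = R * R := by rw [mul_pow]
      rw [hRR] at h1
      have : R * R * F ≤ R * F := by
        have := mul_le_mul_of_nonneg_right hR1 (by positivity : 0 ≤ R * F)
        linarith
      linarith
  refine (add_le_add hnull halt).trans_eq ?_
  field_simp
  ring

/-! ### A lower bound for the number of motifs -/

theorem block_eq_iff {m a a' i i' : ℕ} (hi : i ≤ m) (hi' : i' ≤ m) :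
    a * (m + 1) + i = a' * (m + 1) + i' ↔ a = a' ∧ i = i' := by
  constructor
  · intro h
    have h1 : (a * (m + 1) + i) / (m + 1) = a := by
      rw [mul_comm, Nat.mul_add_div (by omega), Nat.div_eq_of_lt (by omega), add_zero]
    have h2 : (a' * (m + 1) + i') / (m + 1) = a' := by
      rw [mul_comm, Nat.mul_add_div (by omega), Nat.div_eq_of_lt (by omega), add_zero]
    have : a = a' := by rw [← h1, h, h2]
    subst this
    exact ⟨rfl, by omega⟩
  · rintro ⟨rfl, rfl⟩; rfl

theorem block_lt {m a i A : ℕ} (ha : a < A) (hi : i < m) : a * (m + 1) + i + 1 < A * (m + 1) := by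
  have : (a + 1) * (m + 1) ≤ A * (m + 1) := Nat.mul_le_mul_right _ ha
  rw [Nat.succ_mul] at this
  omega

section Construction

variable {D m V : ℕ}

/-- The pairs matched by the permutations `σ a b`: position `i` of block `a` with position
`σ a b i` of block `D + b`. -/
def BlockMatched (σ : Fin D → Fin D → Equiv.Perm (Fin m)) (x y : ℕ) : Prop :=
  ∃ (a b : Fin D) (i : Fin m), x = a * (m + 1) + i ∧ y = (D + b) * (m + 1) + σ a b i

/-- Blocks have length m + 1 but only m matched positions. The spare last vertex separates the two
halves, so a matched pair is never an edge of the path. -/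
theorem BlockMatched.lt_le {σ : Fin D → Fin D → Equiv.Perm (Fin m)} {x y : ℕ}
    (h : BlockMatched σ x y) : x + 1 < D * (m + 1) ∧ D * (m + 1) ≤ y := by
  obtain ⟨a, b, i, rfl, rfl⟩ := h
  refine ⟨block_lt a.2 i.2, ?_⟩
  rw [add_mul]
  omega

/-- A path with matched blocks. -/
def blockGraph (V : ℕ) (σ : Fin D → Fin D → Equiv.Perm (Fin m)) : SimpleGraph (Fin V) where
  Adj x y := (x : ℕ) + 1 = y ∨ (y : ℕ) + 1 = x ∨ BlockMatched σ x y ∨ BlockMatched σ y x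
  symm := ⟨fun x y h => by
    rcases h with h | h | h | h
    · exact Or.inr (Or.inl h)
    · exact Or.inl h
    · exact Or.inr (Or.inr (Or.inr h))
    · exact Or.inr (Or.inr (Or.inl h))⟩
  loopless := ⟨fun x h => by
    rcases h with h | h | h | h
    · omega
    · omega
    · have := h.lt_le; omega
    · have := h.lt_le; omega⟩

theorem blockGraph_connected (hV : 0 < V) (σ : Fin D → Fin D → Equiv.Perm (Fin m)) :
    (blockGraph V σ).Connected := by
  have h : ∀ k (hk : k < V), (blockGraph V σ).Reachable ⟨0, hV⟩ ⟨k, hk⟩ := by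
    intro k
    induction k with
    | zero => exact fun hk => SimpleGraph.Reachable.refl _
    | succ k ih =>
      intro hk
      refine (ih (by omega)).trans (SimpleGraph.Adj.reachable ?_)
      exact Or.inl rfl
  have : Nonempty (Fin V) := ⟨⟨0, hV⟩⟩
  exact ⟨fun x y => (h x x.2).symm.trans (h y y.2)⟩

/-- Two neighbours come from the path. The matched partners of x all lie in the opposite half, with
at most one in each of its D blocks. -/
theorem blockGraph_degree_le (σ : Fin D → Fin D → Equiv.Perm (Fin m)) (x : Fin V) :
    ((blockGraph V σ).neighborSet x).ncard ≤ D + 2 := by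
  classical
  set A : Finset (Fin V) := Finset.univ.filter fun y => BlockMatched σ x y with hA
  set B : Finset (Fin V) := Finset.univ.filter fun y => BlockMatched σ y x with hB
  set P : Finset (Fin V) := Finset.univ.filter fun y => (x : ℕ) + 1 = y with hP
  set Q : Finset (Fin V) := Finset.univ.filter fun y => (y : ℕ) + 1 = x with hQ
  have hP1 : P.card ≤ 1 := Finset.card_le_one.2 fun y hy z hz => by
    have h1 := (Finset.mem_filter.1 hy).2
    have h2 := (Finset.mem_filter.1 hz).2
    exact Fin.ext (by omega)
  have hQ1 : Q.card ≤ 1 := Finset.card_le_one.2 fun y hy z hz => by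
    have h1 := (Finset.mem_filter.1 hy).2
    have h2 := (Finset.mem_filter.1 hz).2
    exact Fin.ext (by omega)
  have hdiv : ∀ (a : ℕ) (i : Fin m), (a * (m + 1) + i) / (m + 1) = a := by
    intro a i
    rw [mul_comm, Nat.mul_add_div (by omega), Nat.div_eq_of_lt (by omega), add_zero]
  have hA1 : A.card ≤ D := by
    have : A.card ≤ (Finset.Ico D (2 * D)).card := by
      refine Finset.card_le_card_of_injOn (fun y => (y : ℕ) / (m + 1)) ?_ ?_
      · intro y hy
        obtain ⟨a, b, i, -, hy⟩ := (Finset.mem_filter.1 hy).2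
        simp only [Finset.coe_Ico, Set.mem_Ico]
        rw [hy, hdiv]
        omega
      · intro y hy z hz hyz
        obtain ⟨a, b, i, hx, hy⟩ := (Finset.mem_filter.1 hy).2
        obtain ⟨a', b', i', hx', hz⟩ := (Finset.mem_filter.1 hz).2
        simp only at hyz
        rw [hy, hz, hdiv, hdiv] at hyz
        have hb : b = b' := Fin.ext (by omega)
        obtain ⟨h1, h2⟩ := (block_eq_iff (by omega) (by omega)).1 (hx.symm.trans hx')
        have ha : a = a' := Fin.ext h1
        have hi : i = i' := Fin.ext h2
        subst ha hi hb
        exact Fin.ext (hy.trans hz.symm)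
    rw [Nat.card_Ico] at this
    omega
  have hB1 : B.card ≤ D := by
    have : B.card ≤ (Finset.range D).card := by
      refine Finset.card_le_card_of_injOn (fun y => (y : ℕ) / (m + 1)) ?_ ?_
      · intro y hy
        obtain ⟨a, b, i, hy, -⟩ := (Finset.mem_filter.1 hy).2
        simp only [Finset.coe_range, Set.mem_Iio]
        rw [hy, hdiv]
        omega
      · intro y hy z hz hyz
        obtain ⟨a, b, i, hy, hx⟩ := (Finset.mem_filter.1 hy).2
        obtain ⟨a', b', i', hz, hx'⟩ := (Finset.mem_filter.1 hz).2
        simp only at hyz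
        rw [hy, hz, hdiv, hdiv] at hyz
        have ha : a = a' := Fin.ext hyz
        obtain ⟨h1, h2⟩ := (block_eq_iff (by omega) (by omega)).1 (hx.symm.trans hx')
        have hb : b = b' := Fin.ext (by omega)
        subst ha hb
        have hi : i = i' := (σ a b).injective (Fin.ext h2)
        subst hi
        exact Fin.ext (hy.trans hz.symm)
    rwa [Finset.card_range] at this
  -- A vertex has partners above it or below it, never both, depending on its half; this gives D
  -- rather than 2D.
  have hAB : (A ∪ B).card ≤ D := by
    by_cases hx : (x : ℕ) < D * (m + 1)
    · have : B = ∅ := Finset.filter_eq_empty_iff.2 fun y _ h => by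
        have := h.lt_le; omega
      rw [this, Finset.union_empty]
      exact hA1
    · have : A = ∅ := Finset.filter_eq_empty_iff.2 fun y _ h => by
        have := h.lt_le; omega
      rw [this, Finset.empty_union]
      exact hB1
  have hsub : (blockGraph V σ).neighborSet x ⊆ ((P ∪ Q) ∪ (A ∪ B) : Finset (Fin V)) := by
    intro y hy
    have hy' : (x : ℕ) + 1 = y ∨ (y : ℕ) + 1 = x ∨ BlockMatched σ x y ∨ BlockMatched σ y x := hy
    simp only [Finset.coe_union, Set.mem_union, Finset.mem_coe, hA, hB, hP, hQ, Finset.mem_filter,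
      Finset.mem_univ, true_and]
    tauto
  refine (Set.ncard_le_ncard hsub (Finset.finite_toSet _)).trans ?_
  rw [Set.ncard_coe_finset]
  have h1 := Finset.card_union_le P Q
  have h2 := Finset.card_union_le (P ∪ Q) (A ∪ B)
  omega

theorem blockGraph_numEdges (hV : 2 * D * (m + 1) ≤ V) (hV0 : 0 < V)
    (σ : Fin D → Fin D → Equiv.Perm (Fin m)) :
    (blockGraph V σ).edgeSet.ncard = V - 1 + D * D * m := by
  have hb : ∀ (b : Fin D) (i : Fin m), (D + b : ℕ) * (m + 1) + i < V := by
    intro b i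
    have := block_lt (A := 2 * D) (a := D + b) (by omega) i.2
    omega
  have ha : ∀ (a : Fin D) (i : Fin m), (a : ℕ) * (m + 1) + i < D * (m + 1) := by
    intro a i
    have := block_lt a.2 i.2
    omega
  have hD : D * (m + 1) ≤ V := by
    rw [two_mul, add_mul] at hV
    omega
  let f : Fin (V - 1) ⊕ (Fin D × Fin D × Fin m) → Sym2 (Fin V) :=
    Sum.elim (fun k => s(⟨k, by omega⟩, ⟨k + 1, by omega⟩))
      (fun t => s(⟨t.1 * (m + 1) + t.2.2, (ha t.1 t.2.2).trans_le hD⟩,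
        ⟨(D + t.2.1) * (m + 1) + σ t.1 t.2.1 t.2.2, hb _ _⟩))
  have hf : Function.Injective f := by
    have h12 : ∀ (k : Fin (V - 1)) (t : Fin D × Fin D × Fin m), f (Sum.inl k) ≠ f (Sum.inr t) := by
      rintro k ⟨a, b, i⟩ h
      have hm : BlockMatched σ (a * (m + 1) + i) ((D + b) * (m + 1) + σ a b i) := ⟨a, b, i, rfl, rfl⟩
      have := hm.lt_le
      simp only [f, Sum.elim_inl, Sum.elim_inr, Sym2.eq_iff, Fin.mk.injEq] at h
      omega
    rintro (k | ⟨a, b, i⟩) (k' | ⟨a', b', i'⟩) h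
    · simp only [f, Sum.elim_inl, Sym2.eq_iff, Fin.mk.injEq] at h
      have : k = k' := Fin.ext (by omega)
      rw [this]
    · exact absurd h (h12 _ _)
    · exact absurd h.symm (h12 _ _)
    · have hm : BlockMatched σ (a * (m + 1) + i) ((D + b) * (m + 1) + σ a b i) := ⟨a, b, i, rfl, rfl⟩
      have hm' : BlockMatched σ (a' * (m + 1) + i') ((D + b') * (m + 1) + σ a' b' i') :=
        ⟨a', b', i', rfl, rfl⟩
      have h1 := hm.lt_le
      have h1' := hm'.lt_le
      simp only [f, Sum.elim_inr, Sym2.eq_iff, Fin.mk.injEq] at h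
      obtain ⟨h2, h3⟩ | ⟨h2, h3⟩ := h
      · obtain ⟨h4, h5⟩ := (block_eq_iff (by omega) (by omega)).1 h2
        obtain ⟨h6, -⟩ := (block_eq_iff (by omega) (by omega)).1 h3
        have ha : a = a' := Fin.ext h4
        have hi : i = i' := Fin.ext h5
        have hb : b = b' := Fin.ext (by omega)
        rw [ha, hi, hb]
      · omega
  have hrange : (blockGraph V σ).edgeSet = f '' Set.univ := by
    ext e
    rw [Set.image_univ, Set.mem_range]
    constructor
    · induction e with | _ x y =>
      intro h
      have h' : (x : ℕ) + 1 = y ∨ (y : ℕ) + 1 = x ∨ BlockMatched σ x y ∨ BlockMatched σ y x := h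
      rcases h' with h | h | ⟨a, b, i, hx, hy⟩ | ⟨a, b, i, hx, hy⟩
      · exact ⟨Sum.inl ⟨x, by omega⟩, Sym2.eq_iff.2 (Or.inl ⟨rfl, Fin.ext h⟩)⟩
      · exact ⟨Sum.inl ⟨y, by omega⟩, Sym2.eq_iff.2 (Or.inr ⟨rfl, Fin.ext h⟩)⟩
      · exact ⟨Sum.inr (a, b, i), Sym2.eq_iff.2 (Or.inl ⟨Fin.ext hx.symm, Fin.ext hy.symm⟩)⟩
      · exact ⟨Sum.inr (a, b, i), Sym2.eq_iff.2 (Or.inr ⟨Fin.ext hx.symm, Fin.ext hy.symm⟩)⟩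
    · rintro ⟨k | ⟨a, b, i⟩, rfl⟩
      · exact Or.inl rfl
      · exact Or.inr (Or.inr (Or.inl ⟨a, b, i, rfl, rfl⟩))
  rw [hrange, Set.ncard_image_of_injective _ hf, Set.ncard_univ, Nat.card_sum, Nat.card_prod,
    Nat.card_prod]
  simp only [Nat.card_eq_fintype_card, Fintype.card_fin]
  ring

/-- The edge from position i of block a into block D + b reveals σ a b i, as matched edges and path
edges cannot be confused. -/
theorem blockGraph_injective (hV : 2 * D * (m + 1) ≤ V) :
    Function.Injective (blockGraph (D := D) (m := m) V) := by
  intro σ σ' h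
  funext a b
  ext i
  have hm : BlockMatched σ (a * (m + 1) + i) ((D + b) * (m + 1) + σ a b i) := ⟨a, b, i, rfl, rfl⟩
  have h1 := hm.lt_le
  have hy := block_lt (A := 2 * D) (a := D + b) (by omega) (σ a b i).2
  have hadj : (blockGraph V σ).Adj ⟨a * (m + 1) + i, by omega⟩
    ⟨(D + b) * (m + 1) + σ a b i, by omega⟩ := Or.inr (Or.inr (Or.inl hm))
  rw [h] at hadj
  rcases hadj with h2 | h2 | ⟨a', b', i', h2, h3⟩ | h2
  · simp only at h2; omega
  · simp only at h2; omega
  · simp only at h2 h3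
    obtain ⟨h4, h5⟩ := (block_eq_iff (by omega) (by omega)).1 h2
    obtain ⟨h6, h7⟩ := (block_eq_iff (by omega) (by omega)).1 h3
    have ha : a = a' := Fin.ext h4
    have hi : i = i' := Fin.ext h5
    have hb : b = b' := Fin.ext (by omega)
    subst ha hi hb
    exact h7
  · have := h2.lt_le
    simp only at this; omega

end Construction

/-! ### Counting isomorphism classes through walks. -/

open Classical in
-- A walk is a starting vertex and one of at most d neighbours at each of the k steps.
theorem card_walks_le {α : Type*} [Fintype α] (H : SimpleGraph α) (d : ℕ)
    (hd : ∀ x, (H.neighborSet x).ncard ≤ d) (k : ℕ) :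
    (Finset.univ.filter fun h : Fin (k + 1) → α =>
      ∀ i : Fin k, H.Adj (h i.castSucc) (h i.succ)).card ≤ Fintype.card α * d ^ k := by
  induction k with
  | zero =>
    refine (Finset.card_filter_le _ _).trans ?_
    simp
  | succ k ih =>
    set s := Finset.univ.filter fun h : Fin (k + 2) → α =>
      ∀ i : Fin (k + 1), H.Adj (h i.castSucc) (h i.succ) with hs
    have himg : (s.image fun h => (Fin.init h : Fin (k + 1) → α)) ⊆
        Finset.univ.filter fun h : Fin (k + 1) → α =>
          ∀ i : Fin k, H.Adj (h i.castSucc) (h i.succ) := by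
      intro g hg
      obtain ⟨h, hh, rfl⟩ := Finset.mem_image.1 hg
      refine Finset.mem_filter.2 ⟨Finset.mem_univ _, fun i => ?_⟩
      exact (Finset.mem_filter.1 hh).2 i.castSucc
    have h1 := Finset.card_le_mul_card_image (f := fun h => (Fin.init h : Fin (k + 1) → α)) s d
      fun g hg => by
        refine le_trans ?_ (hd (g (Fin.last k)))
        rw [Set.ncard_eq_toFinset_card _ (Set.toFinite _)]
        refine Finset.card_le_card_of_injOn (fun h => h (Fin.last (k + 1))) ?_ ?_
        · intro h hh
          obtain ⟨hs', rfl⟩ := Finset.mem_filter.1 hh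
          simp only [Set.Finite.coe_toFinset, SimpleGraph.mem_neighborSet]
          exact (Finset.mem_filter.1 hs').2 (Fin.last k)
        · intro h hh h' hh' heq
          have e1 := (Finset.mem_filter.1 hh).2
          have e2 := (Finset.mem_filter.1 hh').2
          rw [← Fin.snoc_init_self h, ← Fin.snoc_init_self h', e1, e2]
          have heq' : h (Fin.last (k + 1)) = h' (Fin.last (k + 1)) := heq
          rw [heq']
    calc s.card ≤ d * _ := h1
      _ ≤ d * (Fintype.card α * d ^ k) := Nat.mul_le_mul_left _
          ((Finset.card_le_card himg).trans ih)
      _ = _ := by rw [pow_succ]; ring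

/-- The left side counts the block graphs, and V (D + 2)^(V-1) bounds how many of them share an
isomorphism class: an isomorphism onto a fixed representative is determined by the walk along which
it sends the path 0, 1, …, V - 1. -/
theorem card_motifFamily_ge {D m V N : ℕ} (hV : 2 * D * (m + 1) ≤ V) (hV0 : 0 < V)
    (hN : V + D * D * m = N + 1) :
    m.factorial ^ (D * D) ≤ V * (D + 2) ^ (V - 1) * (motifFamily N (D + 2)).card := by
  classical
  let mot : (Fin D → Fin D → Equiv.Perm (Fin m)) → Motif :=
    fun σ => ⟨V, Quotient.mk (graphIsoSetoid V) (blockGraph V σ)⟩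
  have hiso : ∀ σ, Nonempty ((mot σ).graph ≃g blockGraph V σ) := fun σ =>
    Quotient.mk_out (s := graphIsoSetoid V) (blockGraph V σ)
  have hmem : ∀ σ, mot σ ∈ motifFamily N (D + 2) := by
    intro σ
    obtain ⟨f⟩ := hiso σ
    rw [mem_motifFamily]
    refine ⟨f.connected_iff.2 (blockGraph_connected hV0 σ), ?_, fun x => ?_⟩
    · have : (mot σ).numEdges = (blockGraph V σ).edgeSet.ncard := by
        rw [Motif.numEdges, ← Nat.card_coe_set_eq, ← Nat.card_coe_set_eq]
        exact Nat.card_congr f.mapEdgeSet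
      rw [this, blockGraph_numEdges hV hV0]
      omega
    · have h1 := blockGraph_degree_le σ (f x)
      rw [← Nat.card_coe_set_eq] at h1 ⊢
      rwa [Nat.card_congr (f.mapNeighborSet x)]
  have h1 := Finset.card_le_mul_card_image (f := mot) Finset.univ (V * (D + 2) ^ (V - 1))
    fun M hM => by
      obtain ⟨σ₀, -, rfl⟩ := Finset.mem_image.1 hM
      obtain ⟨k, rfl⟩ : ∃ k, V = k + 1 := ⟨V - 1, by omega⟩
      have hw := card_walks_le (mot σ₀).graph (D + 2) (mem_motifFamily.1 (hmem σ₀)).2.2 k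
      rw [Fintype.card_fin] at hw
      refine le_trans ?_ hw
      have hσ : ∀ σ, mot σ = mot σ₀ → Nonempty (blockGraph (k + 1) σ ≃g (mot σ₀).graph) := by
        intro σ h
        obtain ⟨f⟩ := hiso σ
        rw [h] at f
        exact ⟨f.symm⟩
      -- The walk of a chosen isomorphism; the value off the fibre is irrelevant. Equal walks mean
      -- equal vertex maps, which pull the representative back to equal block graphs.
      let g : (Fin D → Fin D → Equiv.Perm (Fin m)) → Fin (k + 1) → Fin (k + 1) := fun σ =>
        if h : mot σ = mot σ₀ then (hσ σ h).some else id
      refine Finset.card_le_card_of_injOn g ?_ ?_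
      · intro σ h
        have h := (Finset.mem_filter.1 h).2
        refine Finset.mem_filter.2 ⟨Finset.mem_univ _, fun i => ?_⟩
        simp only [g, dif_pos h]
        exact (hσ σ h).some.map_adj_iff.2 (Or.inl rfl)
      · intro σ h σ' h' heq
        have h := (Finset.mem_filter.1 h).2
        have h' := (Finset.mem_filter.1 h').2
        simp only [g, dif_pos h, dif_pos h'] at heq
        refine blockGraph_injective hV ?_
        ext x y
        rw [← (hσ σ h).some.map_adj_iff, ← (hσ σ' h').some.map_adj_iff, heq]
  rw [Finset.card_univ] at h1
  simp only [Fintype.card_pi, Finset.prod_const, Finset.card_univ, Fintype.card_perm,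
    Fintype.card_fin, ← pow_mul] at h1
  refine h1.trans (Nat.mul_le_mul_left _ (Finset.card_le_card fun M hM => ?_))
  obtain ⟨σ, -, rfl⟩ := Finset.mem_image.1 hM
  exact hmem σ

/-! ### The signal strength -/

/-- From k^k / k! ≤ e^k ≤ 3^k. -/
theorem pow_le_factorial_of_le {x : ℝ} {k : ℕ} (hx : 0 ≤ x) (hk : 3 * x ≤ k) :
    x ^ k ≤ k.factorial := by
  have h1 := Real.pow_div_factorial_le_exp (k : ℝ) (Nat.cast_nonneg k) k
  have h2 : Real.exp k ≤ 3 ^ k := by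
    rw [← Real.exp_one_pow]
    exact pow_le_pow_left₀ (Real.exp_nonneg 1) (by have := Real.exp_one_lt_d9; linarith) k
  rw [div_le_iff₀ (by positivity)] at h1
  have h3 : (3 * x) ^ k ≤ (k : ℝ) ^ k := pow_le_pow_left₀ (by positivity) hk k
  rw [mul_pow] at h3
  have h4 : (3 : ℝ) ^ k * x ^ k ≤ 3 ^ k * k.factorial :=
    h3.trans (h1.trans (mul_le_mul_of_nonneg_right h2 (by positivity)))
  exact le_of_mul_le_mul_left h4 (by positivity)

/-- With L = D(D+2) and m about N/L, the count m!^(D²) is of order (N/(3L))^(N D²/L), and D²/L =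
D/(D+2). All exponential losses are collected in the constant to the power N. -/
theorem rpow_le_card_motifFamily {D N : ℕ} (hD : 0 < D) (hN : 3 * (D * (D + 2)) ≤ N) :
    (((N : ℝ) / (3 * (D * (D + 2) : ℕ))) ^ ((D : ℝ) / ((D + 2 : ℕ) : ℝ))) ^ N ≤
      ((2 : ℝ) ^ (2 * (D * D) + 1) * (D + 2 : ℕ)) ^ N * (motifFamily N (D + 2)).card := by
  set L := D * (D + 2) with hL
  have hL0 : 0 < L := by positivity
  -- One less than the quotient, which leaves room for the spare vertex of each block. The shift
  -- from m! to (m+2)! later costs at most 4^N.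
  obtain ⟨m, hm⟩ : ∃ m, N / L = m + 1 := by
    have : 1 ≤ N / L := (Nat.one_le_div_iff hL0).2 (by omega)
    exact ⟨N / L - 1, by omega⟩
  have hLm : L * (m + 1) ≤ N := by
    rw [← hm]; exact Nat.mul_div_le N L
  have hDm : D * D * m + 2 * D * (m + 1) ≤ N := by
    have : D * D * m + 2 * D * (m + 1) ≤ L * (m + 1) := by
      rw [hL]
      have : D * (D + 2) * (m + 1) = D * D * m + 2 * D * (m + 1) + D * D := by ring
      omega
    omega
  have hcard := card_motifFamily_ge (D := D) (m := m) (V := N + 1 - D * D * m) (N := N)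
    (by omega) (by omega) (by omega)
  have hcard' : (m.factorial : ℝ) ^ (D * D) ≤
      2 ^ N * ((D + 2 : ℕ) : ℝ) ^ N * (motifFamily N (D + 2)).card := by
    have h1 : m.factorial ^ (D * D) ≤ 2 ^ N * (D + 2) ^ N * (motifFamily N (D + 2)).card := by
      refine hcard.trans (Nat.mul_le_mul_right _ (Nat.mul_le_mul ?_ ?_))
      · have := Nat.lt_two_pow_self (n := N)
        omega
      · exact Nat.pow_le_pow_right (by omega) (by omega)
    exact_mod_cast h1
  set x : ℝ := (N : ℝ) / (3 * (L : ℕ)) with hx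
  have hL0' : (0 : ℝ) < L := by exact_mod_cast hL0
  have hx1 : 1 ≤ x := by
    rw [hx, one_le_div (by positivity)]
    exact_mod_cast hN
  have hNL : (N : ℝ) / L ≤ (m + 2 : ℕ) := by
    rw [div_le_iff₀ hL0']
    have : N < L * (m + 2) := by
      have := Nat.lt_mul_div_succ N hL0
      rwa [hm] at this
    have h2 : N ≤ (m + 2) * L := by rw [mul_comm]; exact this.le
    exact_mod_cast h2
  have hfac : x ^ ((N : ℝ) / L) ≤ (m + 2).factorial := by
    refine le_trans ?_ (pow_le_factorial_of_le (by linarith : 0 ≤ x) (k := m + 2) ?_)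
    · rw [← Real.rpow_natCast]
      exact Real.rpow_le_rpow_of_exponent_le hx1 hNL
    · refine le_trans (le_of_eq ?_) hNL
      rw [hx]
      field_simp
  have hfac2 : ((m + 2).factorial : ℝ) ≤ m.factorial * (2 ^ N * 2 ^ N) := by
    have : (m + 2).factorial ≤ m.factorial * (2 ^ N * 2 ^ N) := by
      rw [Nat.factorial_succ, Nat.factorial_succ]
      have h2N := Nat.lt_two_pow_self (n := N)
      have hmN : m + 1 ≤ N := le_trans (Nat.le_mul_of_pos_left _ hL0) hLm
      calc (m + 1 + 1) * ((m + 1) * m.factorial) = m.factorial * ((m + 2) * (m + 1)) := by ring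
        _ ≤ _ := Nat.mul_le_mul_left _ (Nat.mul_le_mul (by omega) (by omega))
    exact_mod_cast this
  have hexp : (N : ℝ) / L * (D * D : ℕ) = (D : ℝ) / ((D + 2 : ℕ) : ℝ) * N := by
    have : (D : ℝ) ≠ 0 := by exact_mod_cast hD.ne'
    rw [hL]
    push_cast
    have h2 : (D : ℝ) + 2 ≠ 0 := by positivity
    field_simp
  calc (x ^ ((D : ℝ) / ((D + 2 : ℕ) : ℝ))) ^ N = (x ^ ((N : ℝ) / L)) ^ (D * D) := by
        rw [← Real.rpow_natCast, ← Real.rpow_natCast, ← Real.rpow_mul (by linarith),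
          ← Real.rpow_mul (by linarith), hexp]
    _ ≤ (m.factorial * (2 ^ N * 2 ^ N)) ^ (D * D) := by
        refine pow_le_pow_left₀ (by positivity) (hfac.trans hfac2) _
    _ = (m.factorial : ℝ) ^ (D * D) * (2 ^ (2 * (D * D))) ^ N := by
        rw [mul_pow, ← pow_add, ← two_mul, ← pow_mul, ← pow_mul]
        congr 2
        ring
    _ ≤ (2 ^ N * ((D + 2 : ℕ) : ℝ) ^ N * (motifFamily N (D + 2)).card) *
          (2 ^ (2 * (D * D))) ^ N := by gcongr
    _ = _ := by rw [pow_succ, mul_pow, mul_pow]; ring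

/-- The condition on the number of edges makes the signal as strong as needed. -/
theorem exists_signal_constant (d : ℕ) (hd : 3 ≤ d) : ∃ C : ℝ, 0 < C ∧ ∀ (N : ℕ) (ρ : ℝ),
    0 < ρ → ρ ≤ 1 → C / ρ ^ (2 * (d : ℝ) / ((d : ℝ) - 2)) ≤ N →
    N ≠ 0 ∧ 480 ≤ ρ ^ (2 * N) * (motifFamily N d).card := by
  obtain ⟨D, rfl⟩ : ∃ D, d = D + 2 := ⟨d - 2, by omega⟩
  have hD : 0 < D := by omega
  have hD0 : (0 : ℝ) < D := by exact_mod_cast hD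
  set A : ℝ := (2 : ℝ) ^ (2 * (D * D) + 1) * (D + 2 : ℕ) with hA
  have hA1 : 1 ≤ A := by
    have h1 : (1 : ℝ) ≤ 2 ^ (2 * (D * D) + 1) := one_le_pow₀ (by norm_num)
    have h2 : (1 : ℝ) ≤ ((D + 2 : ℕ) : ℝ) := by exact_mod_cast (by omega)
    exact one_le_mul_of_one_le_of_one_le h1 h2
  set L : ℝ := 3 * (D * (D + 2) : ℕ) with hL
  have hL1 : 1 ≤ L := by
    have : 1 ≤ D * (D + 2) := Nat.mul_pos hD (by omega)
    have : (1 : ℝ) ≤ (D * (D + 2) : ℕ) := by exact_mod_cast this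
    linarith
  set t : ℝ := (D : ℝ) / ((D + 2 : ℕ) : ℝ) with ht
  have ht0 : 0 < t := by positivity
  have hB1 : 1 ≤ (480 * A) ^ (1 / t) := Real.one_le_rpow (by linarith) (by positivity)
  -- This solves ρ² (N/L)^t ≥ 480 A for N, where 1/t = d/(d-2). The number 480 is 12/0.025, with 12
  -- from `totalError_le`.
  refine ⟨L * (480 * A) ^ (1 / t), by positivity, fun N ρ hρ hρ1 h => ?_⟩
  have hexp : 2 * ((D + 2 : ℕ) : ℝ) / (((D + 2 : ℕ) : ℝ) - 2) = 2 * (1 / t) := by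
    rw [ht]
    push_cast
    have : (D : ℝ) + 2 ≠ 0 := by positivity
    rw [add_sub_cancel_right]
    field_simp
  rw [hexp] at h
  have hρt : ρ ^ (2 * (1 / t)) ≤ 1 := Real.rpow_le_one hρ.le hρ1 (by positivity)
  have hρt0 : 0 < ρ ^ (2 * (1 / t)) := by positivity
  have hLN : L ≤ N := by
    refine le_trans ?_ h
    rw [le_div_iff₀ hρt0]
    calc L * ρ ^ (2 * (1 / t)) ≤ L * 1 := by gcongr
      _ ≤ _ := by gcongr
  have hN3 : 3 * (D * (D + 2)) ≤ N := by
    rw [hL] at hLN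
    exact_mod_cast hLN
  have hN0 : N ≠ 0 := by
    have : 0 < D * (D + 2) := by positivity
    omega
  have hNpos : (0 : ℝ) < N := by exact_mod_cast Nat.pos_of_ne_zero hN0
  refine ⟨hN0, ?_⟩
  have hF := rpow_le_card_motifFamily hD hN3
  rw [← hL, ← ht, ← hA] at hF
  have hbase : 480 * A ≤ ρ ^ 2 * ((N : ℝ) / L) ^ t := by
    have h1 : (480 * A) ^ (1 / t) ≤ ρ ^ (2 * (1 / t)) * ((N : ℝ) / L) := by
      rw [div_le_iff₀ hρt0] at h
      rw [mul_div_assoc', le_div_iff₀ (by linarith)]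
      linarith
    have h2 := Real.rpow_le_rpow (by positivity) h1 ht0.le
    rw [← Real.rpow_mul (by positivity), one_div_mul_cancel ht0.ne', Real.rpow_one,
      Real.mul_rpow hρt0.le (by positivity), ← Real.rpow_mul hρ.le, mul_assoc,
      one_div_mul_cancel ht0.ne', mul_one, Real.rpow_two] at h2
    exact h2
  have h480 : (480 : ℝ) ≤ 480 ^ N := le_self_pow₀ (by norm_num) hN0
  have hAN : 0 < A ^ N := by positivity
  have : A ^ N * 480 ≤ A ^ N * (ρ ^ (2 * N) * (motifFamily N (D + 2)).card) :=
    calc A ^ N * 480 ≤ A ^ N * 480 ^ N := by gcongr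
      _ = (480 * A) ^ N := by rw [← mul_pow, mul_comm]
      _ ≤ (ρ ^ 2 * ((N : ℝ) / L) ^ t) ^ N := pow_le_pow_left₀ (by positivity) hbase N
      _ = ρ ^ (2 * N) * (((N : ℝ) / L) ^ t) ^ N := by rw [mul_pow, pow_mul]
      _ ≤ ρ ^ (2 * N) * (A ^ N * (motifFamily N (D + 2)).card) := by gcongr
      _ = _ := by ring
  exact le_of_mul_le_mul_left this hAN

/-! ### Asymptotics -/

theorem tendsto_log_natCast : Tendsto (fun n : ℕ => Real.log n) atTop atTop :=
  Real.tendsto_log_atTop.comp tendsto_natCast_atTop_atTop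

theorem tendsto_log_log_natCast : Tendsto (fun n : ℕ => Real.log (Real.log n)) atTop atTop :=
  Real.tendsto_log_atTop.comp tendsto_log_natCast

/-- The form in which smallness is used: N^O(N) and ρ^(-N) are both n^o(1). Half of c pays for
replacing N by N + 1. -/
theorem SmallMotifs.eventually {N : ℕ → ℕ} {ρ : ℕ → ℝ} (h : SmallMotifs N ρ) {c : ℝ} (hc : 0 < c) :
    ∀ᶠ n : ℕ in atTop, ((N n : ℝ) + 1) * Real.log (Real.log n) ≤ c * Real.log n ∧
      (N n : ℝ) * (-Real.log (ρ n)) ≤ c * Real.log n := by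
  have h1 := h.bound (half_pos hc)
  have h2 : ∀ᶠ n : ℕ in atTop, Real.log (Real.log n) ≤ c / 2 * Real.log n := by
    have := (Real.isLittleO_log_id_atTop.comp_tendsto tendsto_log_natCast).bound (half_pos hc)
    filter_upwards [this, tendsto_log_natCast.eventually_ge_atTop 0] with n hn hn0
    simp only [Function.comp, id, Real.norm_eq_abs, abs_of_nonneg hn0] at hn
    exact (le_abs_self _).trans hn
  filter_upwards [h1, h2, tendsto_log_natCast.eventually_ge_atTop 0,
    tendsto_log_log_natCast.eventually_gt_atTop 0] with n h1 h2 h3 h4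
  have hm : 0 < max (Real.log (Real.log n)) (-Real.log (ρ n)) := lt_max_of_lt_left h4
  rw [Real.norm_eq_abs, Real.norm_eq_abs, abs_of_nonneg (Nat.cast_nonneg _),
    abs_of_nonneg (div_nonneg h3 hm.le), mul_div_assoc', le_div_iff₀ hm] at h1
  have h5 := mul_le_mul_of_nonneg_left (le_max_left (Real.log (Real.log n)) (-Real.log (ρ n)))
    (Nat.cast_nonneg (α := ℝ) (N n))
  have h6 := mul_le_mul_of_nonneg_left (le_max_right (Real.log (Real.log n)) (-Real.log (ρ n)))
    (Nat.cast_nonneg (α := ℝ) (N n))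
  have h7 : 0 ≤ c * Real.log n := by positivity
  constructor <;> linarith

/-- The error probability vanishes up to the signal strength. -/
theorem eventually_totalError_le {d : ℕ} (hd : 3 ≤ d) {a : ℝ} (had : a * d < 2) {p ρ : ℕ → ℝ}
    {N : ℕ → ℕ} (hp : ∀ᶠ n in atTop, 0 < p n ∧ p n < 1) (hρ : ∀ n, 0 < ρ n ∧ ρ n ≤ 1)
    (hlp : Tendsto (fun n : ℕ => Real.log (p n) / Real.log n) atTop (nhds (-a)))
    (hlq : Tendsto (fun n : ℕ => Real.log (1 - p n) / Real.log n) atTop (nhds 0))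
    (ha : 0 ≤ a) (hN : SmallMotifs N ρ)
    (hsignal : ∀ᶠ n in atTop, N n ≠ 0 ∧ 480 ≤ ρ n ^ (2 * N n) * (motifFamily (N n) d).card) :
    ∀ᶠ n in atTop, totalError n (p n) (ρ n) (N n) d ≤ 0.05 := by
  have hd0 : (0 : ℝ) < d := by exact_mod_cast (by omega : 0 < d)
  -- This choice puts 2(1-δ)/d halfway between a and 2/d, while p(1-p) = n^(-a+o(1)).
  set δ : ℝ := (1 - a * d / 2) / 2 with hδ
  have hδ0 : 0 < δ := by rw [hδ]; linarith
  have hδ1 : δ ≤ 1 := by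
    have : 0 ≤ a * d := by positivity
    rw [hδ]; linarith
  have hslack : -(2 / (d : ℝ) * (1 - δ)) < -a + 0 := by
    have : 2 / (d : ℝ) * (1 - δ) = 1 / d + a / 2 := by
      rw [hδ]; field_simp; ring
    rw [this]
    have : a < 2 / d := by rw [lt_div_iff₀ hd0]; exact had
    have h2 : 2 / (d : ℝ) = 2 * (1 / d) := by ring
    linarith
  have hvar : ∀ᶠ n : ℕ in atTop, (n : ℝ) ^ (-(2 / (d : ℝ) * (1 - δ))) ≤ p n * (1 - p n) := by
    filter_upwards [(hlp.add hlq).eventually_const_lt hslack, hp,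
      tendsto_log_natCast.eventually_gt_atTop 0, eventually_gt_atTop 0] with n h1 h2 h3 h4
    have hq : 0 < 1 - p n := by linarith [h2.2]
    rw [← add_div, lt_div_iff₀ h3, ← Real.log_mul h2.1.ne' hq.ne', ← Real.log_rpow
      (by exact_mod_cast h4)] at h1
    exact ((Real.log_lt_log_iff (by positivity) (mul_pos h2.1 hq)).1 h1).le
  -- In the logarithm of the second error term the number of patterns and ρ^(-2N) use at most 14 c
  -- log n, well below the available (δ/2) log n.
  set c : ℝ := δ / 68 with hc
  have hc0 : 0 < c := by positivity
  have hn2 : ∀ᶠ n : ℕ in atTop, Real.log n ≤ (1 / 2) * n := by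
    have := (Real.isLittleO_log_id_atTop.comp_tendsto tendsto_natCast_atTop_atTop).bound
      (by norm_num : (0 : ℝ) < 1 / 2)
    filter_upwards [this] with n hn
    simp only [Function.comp, id, Real.norm_eq_abs, Nat.abs_cast] at hn
    exact (le_abs_self _).trans hn
  filter_upwards [hvar, hp, hN.eventually hc0, hsignal, hn2,
    tendsto_log_log_natCast.eventually_ge_atTop 2, tendsto_log_natCast.eventually_ge_atTop 1,
    tendsto_log_natCast.eventually_ge_atTop (16 / δ)] with n hv hpn hNn hs hn2 hΛ hlog hlog2
  obtain ⟨hN1, hN2⟩ := hNn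
  obtain ⟨hN0, hsig⟩ := hs
  obtain ⟨hρ0, hρ1⟩ := hρ n
  have hNc : (0 : ℝ) ≤ N n := Nat.cast_nonneg _
  have hNle : (N n : ℝ) + 1 ≤ c * Real.log n := by nlinarith
  have hc1 : c ≤ 1 := by rw [hc]; linarith
  have hNlog : (N n : ℝ) + 1 ≤ Real.log n := hNle.trans (mul_le_of_le_one_left (by linarith) hc1)
  have hnN : 2 * (N n + 1) ≤ n := by
    have : 2 * ((N n : ℝ) + 1) ≤ n := by linarith
    exact_mod_cast this
  have hn0 : 0 < n := by omega
  have hn0' : (0 : ℝ) < n := by exact_mod_cast hn0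
  have hF : 0 < (motifFamily (N n) d).card := by
    rw [Nat.pos_iff_ne_zero]
    intro h0
    rw [h0] at hsig
    norm_num at hsig
  refine (totalError_le hN0 hnN (by omega) hpn.1 hpn.2 hρ0 hρ1 hδ0.le hδ1 hv hF).trans ?_
  have h1 : 12 / (ρ n ^ (2 * N n) * (motifFamily (N n) d).card) ≤ 0.025 := by
    rw [div_le_iff₀ (by linarith)]
    linarith
  have hlog45 : Real.log (4 * N n + 5) ≤ 2 * Real.log (Real.log n) := by
    have h5 : Real.log 5 ≤ 2 := by
      rw [Real.log_le_iff_le_exp (by norm_num)]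
      have := Real.add_one_le_exp (1 : ℝ)
      have h2 : Real.exp 2 = Real.exp 1 * Real.exp 1 := by rw [← Real.exp_add]; norm_num
      have h3 := Real.exp_one_gt_d9
      rw [h2]
      nlinarith
    have : Real.log (4 * N n + 5) ≤ Real.log (5 * Real.log n) :=
      Real.log_le_log (by positivity) (by linarith)
    rw [Real.log_mul (by norm_num) (by linarith)] at this
    linarith
  have h2 : 8 * (4 ^ (N n + 1) * (4 * N n + 5 : ℝ) ^ (4 * N n + 5) * (n : ℝ) ^ (-δ / 2)) /
      ρ n ^ (2 * N n) ≤ Real.exp (-4) := by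
    rw [← Real.log_le_log_iff (by positivity) (by positivity), Real.log_exp, Real.log_div
      (by positivity) (by positivity), Real.log_mul (by norm_num) (by positivity),
      Real.log_mul (by positivity) (by positivity), Real.log_mul (by positivity) (by positivity),
      Real.log_rpow hn0']
    simp only [Real.log_pow]
    push_cast
    have hl2 := Real.log_two_lt_d9
    have hl8 : Real.log 8 = 3 * Real.log 2 := by
      rw [show (8 : ℝ) = 2 ^ 3 by norm_num, Real.log_pow]; norm_num
    have hl4 : Real.log 4 = 2 * Real.log 2 := by
      rw [show (4 : ℝ) = 2 ^ 2 by norm_num, Real.log_pow]; norm_num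
    have e1 : (4 * (N n : ℝ) + 5) * Real.log (4 * N n + 5) ≤
        (5 * (N n + 1)) * (2 * Real.log (Real.log n)) := by
      refine mul_le_mul (by linarith) hlog45 (Real.log_nonneg (by linarith)) (by positivity)
    have e2 : ((N n : ℝ) + 1) * Real.log 4 ≤ 2 * (N n + 1) := by
      rw [hl4]; nlinarith
    have e3 : δ * Real.log n ≥ 16 := by
      rw [ge_iff_le, ← div_le_iff₀' hδ0]; exact hlog2
    have e4 : c * Real.log n = δ * Real.log n / 68 := by rw [hc]; ring
    rw [e4] at hN1 hN2 hNle
    rw [hl8]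
    nlinarith
  have h3 : Real.exp (-4) ≤ 0.025 := by
    rw [Real.exp_neg, inv_le_comm₀ (Real.exp_pos _) (by norm_num)]
    have h2 : Real.exp 4 = (Real.exp 1) ^ 4 := by rw [← Real.exp_nat_mul]; norm_num
    have h3 := Real.exp_one_gt_d9
    rw [h2]
    calc ((0.025 : ℝ))⁻¹ ≤ 2.7 ^ 4 := by norm_num
      _ ≤ _ := pow_le_pow_left₀ (by norm_num) (by linarith) 4
  linarith

/-- In the second case a ⌊2/a⌋ ≤ 2, so subtracting 1 from the floor makes the inequality strict, and
2/a ≥ 5 leaves d at least 4. -/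
theorem degreeBound_spec {a : ℝ} (ha : 0 < a) (ha1 : a < 2 / 3) :
    3 ≤ degreeBound a ∧ a * degreeBound a < 2 := by
  unfold degreeBound
  split_ifs with h
  · refine ⟨le_rfl, ?_⟩
    push_cast
    linarith
  · push Not at h
    have h5 : (5 : ℝ) ≤ 2 / a := by rw [le_div_iff₀ ha]; linarith
    have h5' : 5 ≤ ⌊2 / a⌋₊ := Nat.le_floor (by exact_mod_cast h5)
    refine ⟨by omega, ?_⟩
    have h6 := Nat.floor_le (by positivity : 0 ≤ 2 / a)
    rw [Nat.cast_sub (by omega)]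
    rw [le_div_iff₀ ha] at h6
    push_cast
    linarith

/-! ### The two detection statements. -/

open Classical in
/-- The constant in the condition on the number of edges. -/
noncomputable def signalConstant (d : ℕ) : ℝ :=
  if h : 3 ≤ d then (exists_signal_constant d h).choose else 1

theorem signalConstant_pos (d : ℕ) : 0 < signalConstant d := by
  unfold signalConstant
  split_ifs with h
  · exact (exists_signal_constant d h).choose_spec.1
  · exact one_pos

theorem signalConstant_spec {d : ℕ} (hd : 3 ≤ d) {N : ℕ} {ρ : ℝ} (hρ : 0 < ρ) (hρ1 : ρ ≤ 1)
    (h : signalConstant d / ρ ^ (2 * (d : ℝ) / ((d : ℝ) - 2)) ≤ N) :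
    N ≠ 0 ∧ 480 ≤ ρ ^ (2 * N) * (motifFamily N d).card := by
  rw [signalConstant, dif_pos hd] at h
  exact (exists_signal_constant d hd).choose_spec.2 N ρ hρ hρ1 h

theorem polynomial_density_detection : ∃ C₁ : ℕ → ℝ, (∀ d, 0 < C₁ d) ∧
    ∀ a : ℝ, 0 < a → a < 2 / 3 → ∀ d : ℕ, d = degreeBound a →
    ∀ (ρ : ℕ → ℝ) (N : ℕ → ℕ), (∀ n, 0 < ρ n ∧ ρ n ≤ 1) → SmallMotifs N ρ →
      (∀ᶠ n in atTop, C₁ d / ρ n ^ (2 * (d : ℝ) / ((d : ℝ) - 2)) ≤ (N n : ℝ)) →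
      ∀ᶠ n in atTop, totalError n ((n : ℝ) ^ (-a)) (ρ n) (N n) d ≤ 0.05 := by
  refine ⟨signalConstant, signalConstant_pos, ?_⟩
  rintro a ha ha1 d rfl ρ N hρ hN hC
  obtain ⟨hd, had⟩ := degreeBound_spec ha ha1
  have htend : Tendsto (fun n : ℕ => (n : ℝ) ^ (-a)) atTop (nhds 0) :=
    (tendsto_rpow_neg_atTop ha).comp tendsto_natCast_atTop_atTop
  refine eventually_totalError_le hd had (p := fun n => (n : ℝ) ^ (-a)) ?_ hρ ?_ ?_ ha.le hN ?_
  · filter_upwards [htend.eventually_lt_const one_pos, eventually_gt_atTop 0] with n h1 h2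
    exact ⟨Real.rpow_pos_of_pos (by exact_mod_cast h2) _, h1⟩
  · refine tendsto_const_nhds.congr' ?_
    filter_upwards [tendsto_log_natCast.eventually_gt_atTop 0, eventually_gt_atTop 0] with n h1 h2
    rw [Real.log_rpow (by exact_mod_cast h2), mul_div_assoc, div_self h1.ne', mul_one]
  · have h1 : Tendsto (fun n : ℕ => Real.log (1 - (n : ℝ) ^ (-a))) atTop (nhds 0) := by
      have h2 : Tendsto (fun n : ℕ => 1 - (n : ℝ) ^ (-a)) atTop (nhds 1) := by
        simpa using htend.const_sub 1
      simpa using h2.log one_ne_zero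
    exact h1.div_atTop tendsto_log_natCast
  · filter_upwards [hC] with n hn
    exact signalConstant_spec hd (hρ n).1 (hρ n).2 hn

theorem subpolynomial_density_detection : ∃ C₂ : ℝ → ℝ, (∀ ε, 0 < C₂ ε) ∧
    ∀ ε : ℝ, 0 < ε → ∀ d : ℕ, d = ⌊4 / ε⌋₊ + 3 →
    ∀ (p ρ : ℕ → ℝ) (N : ℕ → ℕ), (∀ n, 0 < p n ∧ p n < 1) →
      Tendsto (fun n : ℕ => Real.log (p n) / Real.log n) atTop (nhds 0) →
      Tendsto (fun n : ℕ => Real.log (1 - p n) / Real.log n) atTop (nhds 0) →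
      (∀ n, 0 < ρ n ∧ ρ n ≤ 1) → SmallMotifs N ρ →
      (∀ᶠ n in atTop, C₂ ε / ρ n ^ (2 + ε) ≤ (N n : ℝ)) →
      ∀ᶠ n in atTop, totalError n (p n) (ρ n) (N n) d ≤ 0.05 := by
  refine ⟨fun ε => signalConstant (⌊4 / ε⌋₊ + 3), fun ε => signalConstant_pos _, ?_⟩
  rintro ε hε d hd p ρ N hp hlp hlq hρ hN hC
  dsimp only at hC
  rw [← hd] at hC
  have hd3 : 3 ≤ d := by omega
  refine eventually_totalError_le hd3 (a := 0) (by norm_num) (.of_forall hp) hρ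
    (by simpa using hlp) hlq le_rfl hN ?_
  filter_upwards [hC] with n hn
  refine signalConstant_spec hd3 (hρ n).1 (hρ n).2 (le_trans ?_ hn)
  -- The left side is 2 + 4/(d-2), and d - 2 exceeds 4/ε.
  have hexp : 2 * (d : ℝ) / ((d : ℝ) - 2) ≤ 2 + ε := by
    have h1 : 4 / ε < (d : ℝ) - 2 := by
      rw [hd]
      push_cast
      linarith [Nat.lt_floor_add_one (4 / ε)]
    have h2 : 0 < (d : ℝ) - 2 := lt_trans (by positivity) h1
    rw [div_lt_iff₀ hε] at h1
    rw [div_le_iff₀ h2]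
    linarith
  have hpow := Real.rpow_le_rpow_of_exponent_ge (hρ n).1 (hρ n).2 hexp
  exact div_le_div_of_nonneg_left (signalConstant_pos d).le (Real.rpow_pos_of_pos (hρ n).1 _) hpow

/-! ### A calculus for terminating programs -/

/-- Started in `s`, the program halts after at most `T` steps in a state satisfying `Q`. -/
def Ends {n : ℕ} (x : GraphPair n) (P : Program) (s : MachineState) (T : ℕ)
    (Q : MachineState → Prop) : Prop :=
  ∃ t ≤ T, ∃ s', Runs x P s t s' ∧ Q s'

namespace Ends

variable {n : ℕ} {x : GraphPair n} {P P' : Program} {s : MachineState} {T T' : ℕ}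
  {Q Q' : MachineState → Prop}

theorem mono (h : Ends x P s T Q) (hT : T ≤ T') (hQ : ∀ s', Q s' → Q' s') : Ends x P s T' Q' := by
  obtain ⟨t, ht, s', hr, hs⟩ := h
  exact ⟨t, ht.trans hT, s', hr, hQ s' hs⟩

theorem skip (h : Q s) : Ends x .skip s 0 Q := ⟨0, le_rfl, s, Runs.skip s, h⟩

theorem instr {c : Instr} (h : Q (c.exec x s)) : Ends x (.instr c) s 1 Q :=
  ⟨1, le_rfl, _, Runs.instr c s, h⟩

theorem seq (h : Ends x P s T Q) (h' : ∀ s', Q s' → Ends x P' s' T' Q') :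
    Ends x (.seq P P') s (T + T') Q' := by
  obtain ⟨t, ht, s', hr, hs⟩ := h
  obtain ⟨t', ht', s'', hr', hs'⟩ := h' s' hs
  exact ⟨t + t', by omega, s'', Runs.seq hr hr', hs'⟩

theorem ifLt {i j : ℕ} (h : s.int i < s.int j → Ends x P s T Q)
    (h' : ¬ s.int i < s.int j → Ends x P' s T Q) : Ends x (.ifLt i j P P') s (T + 1) Q := by
  by_cases hc : s.int i < s.int j
  · obtain ⟨t, ht, s', hr, hs⟩ := h hc
    exact ⟨t + 1, by omega, s', Runs.ifTrue hc hr, hs⟩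
  · obtain ⟨t, ht, s', hr, hs⟩ := h' hc
    exact ⟨t + 1, by omega, s', Runs.ifFalse hc hr, hs⟩

/-- The invariant is indexed by the number of completed passes, so termination after m passes and
the step bound come from one induction. -/
theorem whileLt {i j m : ℕ} (J : ℕ → MachineState → Prop)
    (hlt : ∀ k < m, ∀ s, J k s → s.int i < s.int j ∧ Ends x P s T (J (k + 1)))
    (hend : ∀ s, J m s → ¬ s.int i < s.int j) :
    ∀ l k, k + l = m → ∀ s, J k s → Ends x (.whileLt i j P) s (l * (T + 1) + 1) (J m) := by
  intro l
  induction l with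
  | zero =>
    intro k hk s hs
    rw [add_zero] at hk
    subst hk
    exact ⟨1, by omega, s, Runs.whileFalse (hend s hs), hs⟩
  | succ l ih =>
    intro k hk s hs
    obtain ⟨h1, t, ht, s', hr, hs'⟩ := hlt k (by omega) s hs
    obtain ⟨t', ht', s'', hr', hs''⟩ := ih (k + 1) (by omega) s' hs'
    refine ⟨t + t' + 1, ?_, s'', Runs.whileTrue h1 hr hr', hs''⟩
    rw [Nat.succ_mul]
    omega

end Ends

/-- Instructions executed one after the other. -/
def Program.block : List Instr → Program
  | [] => .skip
  | c :: l => .seq (.instr c) (Program.block l)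

/-- The effect of a list of instructions. -/
noncomputable def execAll {n : ℕ} (x : GraphPair n) : List Instr → MachineState → MachineState
  | [], s => s
  | c :: l, s => execAll x l (c.exec x s)

theorem Ends.block {n : ℕ} {x : GraphPair n} {Q : MachineState → Prop} {l : List Instr}
    {s : MachineState} (h : Q (execAll x l s)) : Ends x (.block l) s l.length Q := by
  induction l generalizing s with
  | nil => exact Ends.skip h
  | cons c l ih =>
    rw [List.length_cons, add_comm]
    exact Ends.seq (Ends.instr (Q := fun s' => s' = c.exec x s) rfl) fun s' hs' => by
      subst hs'
      exact ih h

/-- A loop with the counter `i` running below the content of the cell `L`; the cell `3` has to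
contain `1`. -/
def Program.forLoop (i L : ℕ) (P : Program) : Program :=
  .seq (.instr (.const i 0)) (.whileLt i L (.seq P (.instr (.add i i 3))))

/-- The state with the content of an integer cell replaced. -/
def MachineState.setInt (s : MachineState) (i m : ℕ) : MachineState :=
  { s with int := Function.update s.int i m }

theorem MachineState.setInt_int (s : MachineState) (i m a : ℕ) :
    (s.setInt i m).int a = if a = i then m else s.int a := by
  simp [setInt, Function.update_apply]

/-- The invariant must not depend on the counter cell (`hst`). A pass costs T plus test and
increment; the final 2 is the initialisation and the failing test. -/
theorem Ends.forLoop {n : ℕ} {x : GraphPair n} {P : Program} {T i L len : ℕ}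
    (J : ℕ → MachineState → Prop) {s : MachineState} (h0 : J 0 s)
    (hJ : ∀ k s, J k s → s.int 3 = 1 ∧ s.int L = len)
    (hst : ∀ k s m, J k s → J k (s.setInt i m))
    (hbody : ∀ k < len, ∀ s, J k s → s.int i = k →
      Ends x P s T fun s' => J (k + 1) s' ∧ s'.int i = k) :
    Ends x (.forLoop i L P) s (len * (T + 2) + 2) (J len) := by
  have hw := Ends.whileLt (x := x) (i := i) (j := L) (m := len)
    (P := .seq P (.instr (.add i i 3))) (T := T + 1) (fun k s => J k s ∧ s.int i = k)
    (fun k hk s hs => ⟨by rw [hs.2, (hJ k s hs.1).2]; exact hk,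
      Ends.seq (hbody k hk s hs.1 hs.2) fun s' hs' => Ends.instr ?_⟩)
    (fun s hs => by rw [hs.2, (hJ _ s hs.1).2]; exact lt_irrefl _) len 0 (by omega)
    (s.setInt i 0) ⟨hst 0 s 0 h0, by simp [MachineState.setInt_int]⟩
  · refine (Ends.seq (Ends.instr (Q := fun s' => s' = s.setInt i 0) rfl) (T' := len * (T + 2) + 1)
      fun s' hs' => ?_).mono (by omega) fun s' hs' => hs'
    subst hs'
    exact hw.mono (by ring_nf; omega) fun s' hs' => hs'.1
  · have h1 := hst (k + 1) s' (k + 1) hs'.1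
    have : Instr.exec x s' (.add i i 3) = s'.setInt i (k + 1) := by
      simp only [Instr.exec, MachineState.setInt, hs'.2, (hJ _ _ hs'.1).1]
    rw [this]
    exact ⟨h1, by simp [MachineState.setInt_int]⟩

/-! ### Frames -/

/-- Only the integer cells in `W` may have changed, and no real cell has changed. -/
def Frame (W : ℕ → Prop) (s s' : MachineState) : Prop :=
  (∀ a, ¬ W a → s'.int a = s.int a) ∧ s'.real = s.real

theorem Frame.refl (W : ℕ → Prop) (s : MachineState) : Frame W s s := ⟨fun _ _ => rfl, rfl⟩

theorem Frame.trans {W : ℕ → Prop} {s s' s'' : MachineState} (h : Frame W s s')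
    (h' : Frame W s' s'') : Frame W s s'' :=
  ⟨fun a ha => (h'.1 a ha).trans (h.1 a ha), h'.2.trans h.2⟩

theorem Frame.mono {W W' : ℕ → Prop} {s s' : MachineState} (h : Frame W s s')
    (hW : ∀ a, W a → W' a) : Frame W' s s' :=
  ⟨fun a ha => h.1 a fun hw => ha (hW a hw), h.2⟩

theorem Frame.setInt {W : ℕ → Prop} {s s' : MachineState} (h : Frame W s s') {i : ℕ} (hi : W i)
    (m : ℕ) : Frame W s (s'.setInt i m) := by
  refine ⟨fun a ha => ?_, h.2⟩
  rw [MachineState.setInt_int, if_neg (by rintro rfl; exact ha hi), h.1 a ha]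

/-- The contents of the cells holding constants: `1`, `0` and the two array bases. -/
def HasConstants (s : MachineState) : Prop :=
  s.int 3 = 1 ∧ s.int 25 = 0 ∧ s.int 7 = 64 ∧ s.int 26 = 65

/-- The array with base `o` holds the first `len` digits of `c` in base `β`. -/
def DigitsAt (o len β c : ℕ) (s : MachineState) : Prop :=
  ∀ k < len, s.int (2 * k + o) = c / β ^ k % β

/-- The cells changed by the operations on the array with base `o`. -/
def ArrayCells (o carry a : ℕ) : Prop :=
  a = 21 ∨ a = 22 ∨ a = 23 ∨ a = carry ∨ (64 ≤ a ∧ a % 2 = o % 2)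

theorem DigitsAt.frame {o len β c : ℕ} {s s' : MachineState} {W : ℕ → Prop}
    (h : DigitsAt o len β c s) (hf : Frame W s s') (hW : ∀ k < len, ¬ W (2 * k + o)) :
    DigitsAt o len β c s' := fun k hk => by rw [hf.1 _ (hW k hk), h k hk]

/-- Fill an array with zeros. -/
def zeroArray (b L : ℕ) : Program :=
  .forLoop 21 L (.block [.add 22 21 21, .add 22 22 b, .store 22 25])

/-- Increment the number whose digits are stored in an array. -/
def incArray (b L B carry : ℕ) : Program :=
  .seq (.instr (.const carry 1)) (.forLoop 21 L (.seq
    (.block [.add 22 21 21, .add 22 22 b, .load 23 22, .add 23 23 carry])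
    (.ifLt 23 B (.block [.store 22 23, .const carry 0]) (.block [.store 22 25]))))

/-- Run `P` for all digit arrays. -/
def enumerate (b L B carry : ℕ) (P : Program) : Program :=
  .seq (zeroArray b L) (.seq (.instr (.const carry 0))
    (.whileLt carry 3 (.seq P (incArray b L B carry))))

/-- The requirements on the cells used by `enumerate`. -/
structure EnumCells (b L B carry : ℕ) : Prop where
  b_ne : b < 64 ∧ b ≠ 21 ∧ b ≠ 22 ∧ b ≠ 23 ∧ b ≠ carry
  L_ne : L < 64 ∧ L ≠ 21 ∧ L ≠ 22 ∧ L ≠ 23 ∧ L ≠ carry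
  B_ne : B < 64 ∧ B ≠ 21 ∧ B ≠ 22 ∧ B ≠ 23 ∧ B ≠ carry
  carry_ne : carry < 64 ∧ carry ≠ 3 ∧ carry ≠ 25 ∧ carry ≠ 21 ∧ carry ≠ 22 ∧ carry ≠ 23

section Enumerate

variable {n : ℕ} {x : GraphPair n} {b L B carry o len β : ℕ}

theorem zeroArray_ends (hc : EnumCells b L B carry) (ho : 64 ≤ o) {s : MachineState}
    (h3 : s.int 3 = 1) (h25 : s.int 25 = 0) (hb : s.int b = o) (hL : s.int L = len) :
    Ends x (zeroArray b L) s (len * 5 + 2) fun s' =>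
      Frame (ArrayCells o carry) s s' ∧ DigitsAt o len β 0 s' := by
  obtain ⟨hb1, hb2, hb3, hb4, hb5⟩ := hc.b_ne
  obtain ⟨hL1, hL2, hL3, hL4, hL5⟩ := hc.L_ne
  obtain ⟨hc1, hc2, hc3, hc4, hc5, hc6⟩ := hc.carry_ne
  have hW3 : ¬ ArrayCells o carry 3 := by unfold ArrayCells; omega
  have hW25 : ¬ ArrayCells o carry 25 := by unfold ArrayCells; omega
  have hWb : ¬ ArrayCells o carry b := by unfold ArrayCells; omega
  have hWL : ¬ ArrayCells o carry L := by unfold ArrayCells; omega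
  refine (Ends.forLoop (T := 3) (len := len) (fun k s' => Frame (ArrayCells o carry) s s' ∧
    ∀ j < k, s'.int (2 * j + o) = 0) ⟨Frame.refl _ _, fun j hj => absurd hj (by omega)⟩
    ?_ ?_ ?_).mono (by omega) ?_
  · rintro k s' ⟨hf, -⟩
    exact ⟨by rw [hf.1 _ hW3, h3], by rw [hf.1 _ hWL, hL]⟩
  · rintro k s' m ⟨hf, hz⟩
    refine ⟨hf.setInt (by unfold ArrayCells; omega) m, fun j hj => ?_⟩
    rw [MachineState.setInt_int, if_neg (by omega), hz j hj]
  · rintro k hk s' ⟨hf, hz⟩ hi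
    have h25' : s'.int 25 = 0 := by rw [hf.1 _ hW25, h25]
    have hb' : s'.int b = o := by rw [hf.1 _ hWb, hb]
    refine Ends.block ⟨⟨⟨fun a ha => ?_, hf.2⟩, fun j hj => ?_⟩, ?_⟩
    · rw [← hf.1 a ha]
      unfold ArrayCells at ha
      simp only [execAll, Instr.exec, Function.update_apply]
      simp [hi, hb', h25', hb3]
      rw [if_neg (by omega), if_neg (by omega), if_neg (by omega)]
    · simp only [execAll, Instr.exec, Function.update_apply]
      simp [hi, hb', h25', hb3]
      by_cases hjk : j = k
      · intro h
        omega
      · rw [if_neg (by omega)]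
        rintro -
        rw [if_neg (by omega), hz j (by omega)]
    · simp only [execAll, Instr.exec, Function.update_apply]
      simp [hi, hb', hb3]
      omega
  · rintro s' ⟨hf, hz⟩
    refine ⟨hf, fun k hk => ?_⟩
    rw [hz k hk]
    simp

/-- Schoolbook addition of 1. After k digits the carry is the difference of (c+1)/β^k and c/β^k, so
at the end it tells whether the counter has overflowed. -/
theorem incArray_ends (hc : EnumCells b L B carry) (ho : 64 ≤ o) {s : MachineState} {c : ℕ}
    (h3 : s.int 3 = 1) (h25 : s.int 25 = 0) (hb : s.int b = o) (hL : s.int L = len)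
    (hB : s.int B = β) (hβ : 1 ≤ β) (hs : DigitsAt o len β c s) :
    Ends x (incArray b L B carry) s (len * 9 + 3) fun s' =>
      Frame (ArrayCells o carry) s s' ∧ DigitsAt o len β (c + 1) s' ∧
      c / β ^ len + s'.int carry = (c + 1) / β ^ len := by
  obtain ⟨hb1, hb2, hb3, hb4, hb5⟩ := hc.b_ne
  obtain ⟨hL1, hL2, hL3, hL4, hL5⟩ := hc.L_ne
  obtain ⟨hB1, hB2, hB3, hB4, hB5⟩ := hc.B_ne
  obtain ⟨hc1, hc2, hc3, hc4, hc5, hc6⟩ := hc.carry_ne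
  have hW3 : ¬ ArrayCells o carry 3 := by unfold ArrayCells; omega
  have hW25 : ¬ ArrayCells o carry 25 := by unfold ArrayCells; omega
  have hWb : ¬ ArrayCells o carry b := by unfold ArrayCells; omega
  have hWL : ¬ ArrayCells o carry L := by unfold ArrayCells; omega
  have hWB : ¬ ArrayCells o carry B := by unfold ArrayCells; omega
  refine Ends.mono (T := 1 + (len * (7 + 2) + 2)) ?_ (by omega) fun s' hs' => hs'
  refine Ends.seq (Ends.instr (Q := fun s' => s' = s.setInt carry 1) rfl) fun s₁ hs₁ => ?_
  have hf₁ : Frame (ArrayCells o carry) s s₁ := by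
    rw [hs₁]; exact (Frame.refl _ _).setInt (by unfold ArrayCells; omega) 1
  refine (Ends.forLoop (T := 7) (len := len) (fun k s' => Frame (ArrayCells o carry) s s' ∧
    (∀ j < k, s'.int (2 * j + o) = (c + 1) / β ^ j % β) ∧
    (∀ j < len, k ≤ j → s'.int (2 * j + o) = c / β ^ j % β) ∧
    c / β ^ k + s'.int carry = (c + 1) / β ^ k ∧ s'.int carry ≤ 1)
    ⟨hf₁, fun j hj => absurd hj (by omega), fun j hj _ => ?_, ?_, ?_⟩
    ?_ ?_ ?_).mono (by omega) ?_
  · rw [hs₁, MachineState.setInt_int, if_neg (by omega), hs j hj]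
  · rw [hs₁, MachineState.setInt_int, if_pos rfl]; simp
  · rw [hs₁, MachineState.setInt_int, if_pos rfl]
  · rintro k s' ⟨hf, -⟩
    exact ⟨by rw [hf.1 _ hW3, h3], by rw [hf.1 _ hWL, hL]⟩
  · rintro k s' m ⟨hf, h1, h2, h3, h4⟩
    refine ⟨hf.setInt (by unfold ArrayCells; omega) m, fun j hj => ?_, fun j hj hkj => ?_, ?_, ?_⟩
    · rw [MachineState.setInt_int, if_neg (by omega), h1 j hj]
    · rw [MachineState.setInt_int, if_neg (by omega), h2 j hj hkj]
    · rw [MachineState.setInt_int, if_neg (by omega), h3]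
    · rw [MachineState.setInt_int, if_neg (by omega)]; exact h4
  · rintro k hk s' ⟨hf, h1, h2, h3, h4⟩ hi
    have h25' : s'.int 25 = 0 := by rw [hf.1 _ hW25, h25]
    have hb' : s'.int b = o := by rw [hf.1 _ hWb, hb]
    have hB' : s'.int B = β := by rw [hf.1 _ hWB, hB]
    have hk' := h2 k hk le_rfl
    refine Ends.mono (T := 4 + (2 + 1)) ?_ (by omega) fun s' hs' => hs'
    refine Ends.seq (Ends.block (l := [.add 22 21 21, .add 22 22 b, .load 23 22, .add 23 23 carry])
      (Q := fun s₂ => s₂.real = s'.real ∧ (∀ a, a ≠ 22 → a ≠ 23 → s₂.int a = s'.int a) ∧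
        s₂.int 22 = 2 * k + o ∧ s₂.int 23 = c / β ^ k % β + s'.int carry) ?_) ?_
    · refine ⟨rfl, fun a h22 h23 => ?_, ?_, ?_⟩
      · simp [execAll, Instr.exec, Function.update_apply, h22, h23]
      · simp [execAll, Instr.exec, Function.update_apply, hb3, hb', hi]
        omega
      · simp only [execAll, Instr.exec, Function.update_apply]
        simp [hb3, hb', hi, hc5, hc6]
        rw [if_neg (by omega), ← two_mul, hk', if_neg (by omega)]
    · rintro s₂ ⟨hr₂, he₂, h22, h23⟩
      have hq1 : (c / β ^ k) / β = c / β ^ (k + 1) := by rw [pow_succ, Nat.div_div_eq_div_mul]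
      have hq2 : ((c + 1) / β ^ k) / β = (c + 1) / β ^ (k + 1) := by
        rw [pow_succ, Nat.div_div_eq_div_mul]
      have hqlt : c / β ^ k % β < β := Nat.mod_lt _ (by omega)
      have hdm := Nat.div_add_mod (c / β ^ k) β
      set q := c / β ^ k with hq
      have hframe : ∀ s₃ : MachineState, s₃.real = s₂.real →
          (∀ a, a ≠ carry → a ≠ 2 * k + o → s₃.int a = s₂.int a) →
          Frame (ArrayCells o carry) s s₃ := by
        intro s₃ hr₃ he₃
        refine ⟨fun a ha => ?_, by rw [hr₃, hr₂, hf.2]⟩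
        rw [← hf.1 a ha]
        unfold ArrayCells at ha
        rw [he₃ a (by omega) (by omega), he₂ a (by omega) (by omega)]
      have hother : ∀ s₃ : MachineState,
          (∀ a, a ≠ carry → a ≠ 2 * k + o → s₃.int a = s₂.int a) →
          s₃.int (2 * k + o) = (c + 1) / β ^ k % β →
          (∀ j < k + 1, s₃.int (2 * j + o) = (c + 1) / β ^ j % β) ∧
          (∀ j < len, k + 1 ≤ j → s₃.int (2 * j + o) = c / β ^ j % β) ∧ s₃.int 21 = k := by
        intro s₃ he₃ hk₃
        refine ⟨fun j hj => ?_, fun j hj hkj => ?_, ?_⟩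
        · by_cases hjk : j = k
          · rw [hjk, hk₃]
          · rw [he₃ _ (by omega) (by omega), he₂ _ (by omega) (by omega), h1 j (by omega)]
        · rw [he₃ _ (by omega) (by omega), he₂ _ (by omega) (by omega), h2 j hj (by omega)]
        · rw [he₃ _ (by omega) (by omega), he₂ _ (by omega) (by omega), hi]
      refine Ends.ifLt (fun hlt => ?_) (fun hlt => ?_)
      · rw [h23, he₂ B (by omega) (by omega), hB'] at hlt
        have hqq : (c + 1) / β ^ k = q % β + s'.int carry + β * (q / β) := by rw [← h3]; omega
        refine Ends.block (l := [.store 22 23, .const carry 0]) ?_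
        have he₃ : ∀ a, a ≠ carry → a ≠ 2 * k + o →
            (execAll x [.store 22 23, .const carry 0] s₂).int a = s₂.int a := by
          intro a ha1 ha2
          simp [execAll, Instr.exec, ha1, h22, ha2]
        have hk₃ : (execAll x [.store 22 23, .const carry 0] s₂).int (2 * k + o) =
            (c + 1) / β ^ k % β := by
          simp only [execAll, Instr.exec, Function.update_apply]
          rw [if_neg (by omega), if_pos h22.symm, h23, hqq, Nat.add_mul_mod_self_left,
            Nat.mod_eq_of_lt hlt]
        obtain ⟨g1, g2, g3⟩ := hother _ he₃ hk₃
        refine ⟨⟨hframe _ rfl he₃, g1, g2, ?_, ?_⟩, g3⟩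
        · simp only [execAll, Instr.exec, Function.update_apply, if_true]
          rw [← hq1, ← hq2, hqq, Nat.add_mul_div_left _ _ (by omega), Nat.div_eq_of_lt hlt]
          omega
        · simp only [execAll, Instr.exec, Function.update_apply, if_true]
          omega
      · rw [h23, he₂ B (by omega) (by omega), hB'] at hlt
        -- The digit is below β and the carry at most 1, so overflow means digit β - 1 and carry 1;
        -- the digit becomes 0 and the carry stays.
        have hcar : s'.int carry = 1 := by omega
        have hqq : (c + 1) / β ^ k = β * (q / β + 1) := by
          rw [← h3, mul_add]; omega
        refine (Ends.block (l := [.store 22 25]) ?_).mono (by simp) fun _ h => h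
        have he₃ : ∀ a, a ≠ carry → a ≠ 2 * k + o →
            (execAll x [.store 22 25] s₂).int a = s₂.int a := by
          intro a ha1 ha2
          simp [execAll, Instr.exec, h22, ha2]
        have h25₂ : s₂.int 25 = 0 := by rw [he₂ 25 (by omega) (by omega), h25']
        have hk₃ : (execAll x [.store 22 25] s₂).int (2 * k + o) = (c + 1) / β ^ k % β := by
          simp only [execAll, Instr.exec, Function.update_apply]
          rw [if_pos h22.symm, h25₂, hqq, Nat.mul_mod_right]
        have hcar₃ : (execAll x [.store 22 25] s₂).int carry = 1 := by
          simp only [execAll, Instr.exec, Function.update_apply]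
          rw [if_neg (by omega), he₂ carry (by omega) (by omega), hcar]
        obtain ⟨g1, g2, g3⟩ := hother _ he₃ hk₃
        refine ⟨⟨hframe _ rfl he₃, g1, g2, ?_, hcar₃.le⟩, g3⟩
        rw [hcar₃, ← hq1, ← hq2, hqq, Nat.mul_div_cancel_left _ (by omega)]
  · rintro s' ⟨hf, h1, -, h3, -⟩
    exact ⟨hf, h1, h3⟩

/-- An odometer: pass number c sees the digits of c. The body must preserve the array, and `J` must
survive changes of the array and of the counting cells. -/
theorem Ends.enumerate (hc : EnumCells b L B carry) (ho : 64 ≤ o) (hβ : 1 ≤ β) {P : Program}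
    {T : ℕ} (J : ℕ → MachineState → Prop) {s : MachineState} (h0 : J 0 s)
    (hJ : ∀ c s, J c s → HasConstants s ∧ s.int b = o ∧ s.int L = len ∧ s.int B = β)
    (hst : ∀ c s s', J c s → Frame (ArrayCells o carry) s s' → J c s')
    (hbody : ∀ c < β ^ len, ∀ s, J c s → DigitsAt o len β c s →
      Ends x P s T fun s' => J (c + 1) s' ∧ DigitsAt o len β c s') :
    Ends x (enumerate b L B carry P) s (β ^ len * (T + len * 9 + 4) + len * 5 + 4)
      (J (β ^ len)) := by
  have hpos : 0 < β ^ len := by positivity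
  obtain ⟨hc1, hc2, hc3, hc4, hc5, hc6⟩ := hc.carry_ne
  obtain ⟨⟨h3, h25, -⟩, hb, hL, hB⟩ := hJ 0 s h0
  refine Ends.mono (T := (len * 5 + 2) + (1 + (β ^ len * (T + (len * 9 + 3) + 1) + 1))) ?_
    (by ring_nf; omega) fun s' hs' => hs'
  refine Ends.seq (zeroArray_ends (β := β) hc ho h3 h25 hb hL) fun s₁ hs₁ => ?_
  refine Ends.seq (Ends.instr (Q := fun s' => s' = s₁.setInt carry 0) rfl) fun s₂ hs₂ => ?_
  have hf₂ : Frame (ArrayCells o carry) s s₂ := by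
    rw [hs₂]; exact hs₁.1.setInt (by unfold ArrayCells; omega) 0
  -- The carry is 0 up to the last array and becomes 1 by the overflow at c = β^len, which ends the
  -- loop.
  refine (Ends.whileLt (m := β ^ len) (fun c s' => J c s' ∧ (c < β ^ len → DigitsAt o len β c s' ∧
    s'.int carry = 0) ∧ (¬ c < β ^ len → s'.int carry = 1)) ?_ ?_ _ 0 (by omega) s₂
    ⟨hst 0 s s₂ h0 hf₂, fun _ => ⟨?_, ?_⟩, fun h => absurd hpos h⟩).mono le_rfl fun s' hs' => hs'.1
  · rintro c hcl s' ⟨hJc, h1, -⟩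
    obtain ⟨h1, h2⟩ := h1 hcl
    refine ⟨by rw [h2, (hJ c s' hJc).1.1]; exact one_pos, ?_⟩
    refine Ends.seq (hbody c hcl s' hJc h1) fun s₃ hs₃ => ?_
    obtain ⟨⟨h3', h25', -⟩, hb', hL', hB'⟩ := hJ _ _ hs₃.1
    refine (incArray_ends hc ho h3' h25' hb' hL' hB' hβ hs₃.2).mono le_rfl ?_
    rintro s₄ ⟨hf₄, hd₄, hc₄⟩
    rw [Nat.div_eq_of_lt hcl, zero_add] at hc₄
    refine ⟨hst _ _ _ hs₃.1 hf₄, fun hlt => ⟨hd₄, ?_⟩, fun hnl => ?_⟩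
    · rw [hc₄, Nat.div_eq_of_lt hlt]
    · rw [hc₄, show c + 1 = β ^ len by omega, Nat.div_self hpos]
  · rintro s' ⟨hJc, -, h2⟩
    rw [h2 (lt_irrefl _), (hJ _ s' hJc).1.1]
    exact lt_irrefl _
  · intro k hk
    rw [hs₂, MachineState.setInt_int, if_neg (by omega), hs₁.2 k hk]
  · rw [hs₂, MachineState.setInt_int, if_pos rfl]

end Enumerate

/-! ### Programs that test a condition -/

/-- The program `P`, started in a state satisfying `E`, sets the flag `f` to `0` unless `G` holds,
and changes no other cells than those in `W`. -/
def Tests {n : ℕ} (x : GraphPair n) (P : Program) (T : ℕ) (W : ℕ → Prop) (f : ℕ)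
    (E : MachineState → Prop) (G : Prop) : Prop :=
  ∀ s, E s → Ends x P s T fun s' =>
    Frame W s s' ∧ (G → s'.int f = s.int f) ∧ (¬ G → s'.int f = 0)

namespace Tests

variable {n : ℕ} {x : GraphPair n} {P P' : Program} {T T' f : ℕ} {W W' : ℕ → Prop}
  {E E' : MachineState → Prop} {G G' : Prop}

theorem mono (h : Tests x P T W f E G) (hT : T ≤ T') (hW : ∀ a, W a → W' a)
    (hE : ∀ s, E' s → E s) (hG : G' ↔ G) : Tests x P T' W' f E' G' := by
  intro s hs
  refine (h s (hE s hs)).mono hT ?_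
  rintro s' ⟨h1, h2, h3⟩
  exact ⟨h1.mono hW, fun hg => h2 (hG.1 hg), fun hg => h3 fun h => hg (hG.2 h)⟩

theorem skip : Tests x .skip 0 W f E True :=
  fun s _ => Ends.skip ⟨Frame.refl W s, fun _ => rfl, fun h => absurd trivial h⟩

theorem fail (hf : W f) : Tests x (.instr (.const f 0)) 1 W f E False :=
  fun s _ => Ends.instr ⟨(Frame.refl W s).setInt hf 0, fun h => h.elim, fun _ => by
    simp [Instr.exec]⟩

/-- Tests only lower the flag and never raise it again, so running tests in sequence forms the
conjunction; loops of tests form universal quantifiers in the same way. -/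
theorem seq (h : Tests x P T W f E G) (hE : ∀ s s', E s → Frame W s s' → E s')
    (h' : Tests x P' T' W f E G') : Tests x (.seq P P') (T + T') W f E (G ∧ G') := by
  intro s hs
  refine Ends.seq (h s hs) fun s' hs' => (h' s' (hE s s' hs hs'.1)).mono le_rfl ?_
  rintro s'' ⟨h1, h2, h3⟩
  refine ⟨hs'.1.trans h1, fun hg => (h2 hg.2).trans (hs'.2.1 hg.1), fun hg => ?_⟩
  by_cases hg' : G'
  · rw [h2 hg', hs'.2.2 fun hG => hg ⟨hG, hg'⟩]
  · exact h3 hg'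

theorem block_seq {l : List Instr} (hl : ∀ s, E s → Frame W s (execAll x l s) ∧
      (execAll x l s).int f = s.int f ∧ E' (execAll x l s))
    (h : Tests x P T W f E' G) : Tests x (.seq (.block l) P) (l.length + T) W f E G := by
  intro s hs
  obtain ⟨h1, h2, h3⟩ := hl s hs
  refine Ends.seq (Ends.block (Q := fun s' => s' = execAll x l s) rfl) fun s' hs' => ?_
  subst hs'
  refine (h _ h3).mono le_rfl ?_
  rintro s'' ⟨g1, g2, g3⟩
  exact ⟨h1.trans g1, fun hg => (g2 hg).trans h2, g3⟩

theorem ifLt {a b α β : ℕ} (ha : ∀ s, E s → s.int a = α) (hb : ∀ s, E s → s.int b = β)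
    (h : Tests x P T W f E G) (h' : Tests x P' T W f E G') :
    Tests x (.ifLt a b P P') (T + 1) W f E ((α < β → G) ∧ (¬ α < β → G')) := by
  intro s hs
  refine Ends.ifLt (fun hlt => ?_) fun hlt => ?_
  · rw [ha s hs, hb s hs] at hlt
    refine (h s hs).mono le_rfl ?_
    rintro s' ⟨h1, h2, h3⟩
    exact ⟨h1, fun hg => h2 (hg.1 hlt), fun hg => h3 fun hG => hg ⟨fun _ => hG, fun h => absurd hlt h⟩⟩
  · rw [ha s hs, hb s hs] at hlt
    refine (h' s hs).mono le_rfl ?_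
    rintro s' ⟨h1, h2, h3⟩
    exact ⟨h1, fun hg => h2 (hg.2 hlt), fun hg => h3 fun hG => hg ⟨fun h => absurd h hlt, fun _ => hG⟩⟩

theorem forLoop {i L len : ℕ} {G : ℕ → Prop}
    (hE : ∀ s s', E s → Frame W s s' → E s') (hL : ∀ s, E s → s.int 3 = 1 ∧ s.int L = len)
    (hi : W i) (hfi : f ≠ i) (hW : ∀ a, W' a → W a) (hi' : ¬ W' i)
    (h : ∀ k < len, Tests x P T W' f (fun s => E s ∧ s.int i = k) (G k)) :
    Tests x (.forLoop i L P) (len * (T + 2) + 2) W f E (∀ k < len, G k) := by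
  intro s hs
  refine Ends.forLoop (T := T) (len := len) (fun k s' => Frame W s s' ∧
    ((∀ j < k, G j) → s'.int f = s.int f) ∧ ((¬ ∀ j < k, G j) → s'.int f = 0))
    ⟨Frame.refl W s, fun _ => rfl, fun hn => absurd (fun j hj => absurd hj (by omega)) hn⟩
    ?_ ?_ ?_
  · rintro k s' ⟨hf, -⟩
    exact hL s' (hE s s' hs hf)
  · rintro k s' m ⟨hf, h1, h2⟩
    rw [MachineState.setInt_int, if_neg hfi]
    exact ⟨hf.setInt hi m, h1, h2⟩
  · rintro k hk s' ⟨hf, h1, h2⟩ hik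
    refine (h k hk s' ⟨hE s s' hs hf, hik⟩).mono le_rfl ?_
    rintro s'' ⟨g1, g2, g3⟩
    refine ⟨⟨hf.trans (g1.mono hW), fun hg => ?_, fun hg => ?_⟩, by rw [g1.1 i hi', hik]⟩
    · rw [g2 (hg k (by omega)), h1 fun j hj => hg j (by omega)]
    · by_cases hgk : G k
      · rw [g2 hgk, h2 fun hall => hg fun j hj => ?_]
        rcases Nat.lt_succ_iff_lt_or_eq.1 hj with hj | rfl
        · exact hall j hj
        · exact hgk
      · exact g3 hgk

theorem enumerate {b L B carry o len β : ℕ} {G : ℕ → Prop} (hc : EnumCells b L B carry)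
    (ho : 64 ≤ o) (hβ : 1 ≤ β) (hE : ∀ s s', E s → Frame W s s' → E s')
    (hJ : ∀ s, E s → HasConstants s ∧ s.int b = o ∧ s.int L = len ∧ s.int B = β)
    (hA : ∀ a, ArrayCells o carry a → W a) (hf : ¬ ArrayCells o carry f)
    (hW : ∀ a, W' a → W a) (hW' : ∀ k < len, ¬ W' (2 * k + o))
    (h : ∀ c < β ^ len, Tests x P T W' f (fun s => E s ∧ DigitsAt o len β c s) (G c)) :
    Tests x (enumerate b L B carry P) (β ^ len * (T + len * 9 + 4) + len * 5 + 4) W f E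
      (∀ c < β ^ len, G c) := by
  intro s hs
  refine Ends.enumerate (T := T) (o := o) (len := len) (β := β) hc ho hβ
    (fun k s' => Frame W s s' ∧
    ((∀ j < k, G j) → s'.int f = s.int f) ∧ ((¬ ∀ j < k, G j) → s'.int f = 0))
    ⟨Frame.refl W s, fun _ => rfl, fun hn => absurd (fun j hj => absurd hj (by omega)) hn⟩
    ?_ ?_ ?_
  · rintro k s' ⟨hf, -⟩
    exact hJ s' (hE s s' hs hf)
  · rintro k s' s'' ⟨hf', h1, h2⟩ hf''
    rw [hf''.1 f hf]
    exact ⟨hf'.trans (hf''.mono hA), h1, h2⟩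
  · rintro k hk s' ⟨hf, h1, h2⟩ hd
    refine (h k hk s' ⟨hE s s' hs hf, hd⟩).mono le_rfl ?_
    rintro s'' ⟨g1, g2, g3⟩
    refine ⟨⟨hf.trans (g1.mono hW), fun hg => ?_, fun hg => ?_⟩, hd.frame g1 hW'⟩
    · rw [g2 (hg k (by omega)), h1 fun j hj => hg j (by omega)]
    · by_cases hgk : G k
      · rw [g2 hgk, h2 fun hall => hg fun j hj => ?_]
        rcases Nat.lt_succ_iff_lt_or_eq.1 hj with hj | rfl
        · exact hall j hj
        · exact hgk
      · exact g3 hgk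

end Tests

/-- Reset the flag `f` unless the content of `a` is smaller than the content of `b`. -/
def requireLt (a b f : ℕ) : Program := .ifLt a b .skip (.instr (.const f 0))

/-- Reset the flag `f` unless `a` and `b` have the same content. -/
def requireEq (a b f : ℕ) : Program :=
  .ifLt a b (.instr (.const f 0)) (.ifLt b a (.instr (.const f 0)) .skip)

/-- Run `P` if `a` and `b` have the same content. -/
def whenEq (a b : ℕ) (P : Program) : Program := .ifLt a b .skip (.ifLt b a .skip P)

section Require

variable {n : ℕ} {x : GraphPair n} {P : Program} {T f a b α β : ℕ} {W : ℕ → Prop}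
  {E : MachineState → Prop} {G : Prop}

theorem Tests.requireLt (hf : W f) (ha : ∀ s, E s → s.int a = α) (hb : ∀ s, E s → s.int b = β) :
    Tests x (requireLt a b f) 2 W f E (α < β) :=
  (Tests.ifLt (T := 1) ha hb (Tests.skip.mono zero_le_one (fun _ h => h) (fun _ h => h) Iff.rfl)
    (Tests.fail hf)).mono le_rfl (fun _ h => h) (fun _ h => h) (by simp)

theorem Tests.requireEq (hf : W f) (ha : ∀ s, E s → s.int a = α) (hb : ∀ s, E s → s.int b = β) :
    Tests x (requireEq a b f) 3 W f E (α = β) :=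
  (Tests.ifLt (T := 2) ha hb ((Tests.fail hf).mono one_le_two (fun _ h => h) (fun _ h => h) Iff.rfl)
    (Tests.ifLt (T := 1) hb ha (Tests.fail hf)
      (Tests.skip.mono zero_le_one (fun _ h => h) (fun _ h => h) Iff.rfl))).mono le_rfl
    (fun _ h => h) (fun _ h => h) (by
      constructor
      · rintro rfl; simp
      · intro h; simp only [imp_false, not_lt] at h; omega)

theorem Tests.whenEq (ha : ∀ s, E s → s.int a = α) (hb : ∀ s, E s → s.int b = β)
    (h : Tests x P T W f E G) : Tests x (whenEq a b P) (T + 2) W f E (α = β → G) :=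
  (Tests.ifLt (T := T + 1) ha hb
    (Tests.skip.mono (Nat.zero_le _) (fun _ h => h) (fun _ h => h) Iff.rfl)
    (Tests.ifLt (T := T) hb ha
      (Tests.skip.mono (Nat.zero_le _) (fun _ h => h) (fun _ h => h) Iff.rfl) h)).mono le_rfl
    (fun _ h => h) (fun _ h => h) (by
      constructor
      · intro hg
        exact ⟨fun _ => trivial, fun h1 => ⟨fun _ => trivial, fun h2 => hg (by omega)⟩⟩
      · rintro hg rfl
        exact (hg.2 (lt_irrefl _)).2 (lt_irrefl _))

end Require

/-! ### Reading arrays -/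

/-- Load into the cell `a` the entry of the array with base `b` whose index is in the cell `i`. -/
def fetch (a i b : ℕ) : List Instr := [.add a i i, .add a a b, .load a a]

theorem execAll_append {n : ℕ} (x : GraphPair n) (l l' : List Instr) (s : MachineState) :
    execAll x (l ++ l') s = execAll x l' (execAll x l s) := by
  induction l generalizing s with
  | nil => rfl
  | cons c l ih => exact ih _

/-- Cell a holds the address during the computation, so the entry that is read must not be cell a
itself. The stride 2 lets the arrays with bases 64 and 65 occupy even and odd cells, each of
unbounded length. -/
theorem execAll_fetch {n : ℕ} (x : GraphPair n) {a i b : ℕ} (hab : b ≠ a) {s : MachineState}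
    (h : 2 * s.int i + s.int b ≠ a) :
    execAll x (fetch a i b) s = s.setInt a (s.int (2 * s.int i + s.int b)) := by
  simp only [fetch, execAll, Instr.exec, MachineState.setInt, Function.update_self,
    Function.update_idem, Function.update_of_ne hab]
  rw [← two_mul, Function.update_of_ne h]

/-- The array with base `o` starts with the values `u 0, …, u (len - 1)`. -/
def ArrayIs (o len : ℕ) (u : ℕ → ℕ) (s : MachineState) : Prop :=
  ∀ k < len, s.int (2 * k + o) = u k

theorem ArrayIs.frame {o len : ℕ} {u : ℕ → ℕ} {s s' : MachineState} {W : ℕ → Prop}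
    (h : ArrayIs o len u s) (hf : Frame W s s') (hW : ∀ k < len, ¬ W (2 * k + o)) :
    ArrayIs o len u s' := fun k hk => by rw [hf.1 _ (hW k hk), h k hk]

/-- The contents of the cells which hold the parameters, for lists of pairs on `v` vertices. -/
structure Params (n N d v : ℕ) (s : MachineState) : Prop where
  consts : HasConstants s
  n_eq : s.int 0 = n
  N_eq : s.int 1 = N
  d_eq : s.int 2 = d
  two_eq : s.int 4 = 2
  len_eq : s.int 5 = N + N
  bound_eq : s.int 6 = N + 1
  v_eq : s.int 8 = v

theorem Params.frame {n N d v : ℕ} {s s' : MachineState} {W : ℕ → Prop}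
    (h : Params n N d v s) (hf : ∀ a, ¬ W a → s'.int a = s.int a)
    (hW : ∀ a, W a → (9 ≤ a ∧ a ≤ 23) ∨ 27 ≤ a) : Params n N d v s' := by
  have hc : ∀ a, a < 9 ∨ a = 25 ∨ a = 26 → s'.int a = s.int a := fun a ha =>
    hf a fun hw => by have := hW a hw; omega
  obtain ⟨⟨h1, h2, h3, h4⟩, h5, h6, h7, h8, h9, h10, h11⟩ := h
  refine ⟨⟨?_, ?_, ?_, ?_⟩, ?_, ?_, ?_, ?_, ?_, ?_, ?_⟩
  · rw [hc _ (by omega), h1]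
  · rw [hc _ (by omega), h2]
  · rw [hc _ (by omega), h3]
  · rw [hc _ (by omega), h4]
  · rw [hc _ (by omega), h5]
  · rw [hc _ (by omega), h6]
  · rw [hc _ (by omega), h7]
  · rw [hc _ (by omega), h8]
  · rw [hc _ (by omega), h9]
  · rw [hc _ (by omega), h10]
  · rw [hc _ (by omega), h11]

/-- The parameters, together with a list `u` of `N` vertex pairs in the first array. -/
structure PairList (n N d v : ℕ) (u : ℕ → ℕ) (s : MachineState) : Prop
    extends Params n N d v s where
  pairs : ArrayIs 64 (N + N) u s

theorem PairList.frame {n N d v : ℕ} {u : ℕ → ℕ} {s s' : MachineState} {W : ℕ → Prop}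
    (h : PairList n N d v u s) (hf : ∀ a, ¬ W a → s'.int a = s.int a)
    (hW : ∀ a, W a → (9 ≤ a ∧ a ≤ 23) ∨ (64 ≤ a ∧ a % 2 = 1)) : PairList n N d v u s' where
  toParams := h.toParams.frame hf fun a ha => by have := hW a ha; omega
  pairs k hk := by rw [hf _ fun hw => by have := hW _ hw; omega, h.pairs k hk]

/-- The flag `f` together with the scratch cells `m, …, 20`. -/
def Scratch (m f a : ℕ) : Prop := a = f ∨ (m ≤ a ∧ a ≤ 20)

theorem Scratch.mono {m m' f : ℕ} (h : m' ≤ m) (a : ℕ) (ha : Scratch m f a) : Scratch m' f a := by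
  unfold Scratch at *
  omega

theorem PairList.scratch {n N d v m f : ℕ} {u : ℕ → ℕ} {s s' : MachineState}
    (h : PairList n N d v u s) (hf : Frame (Scratch m f) s s') (hm : 9 ≤ m)
    (hm' : 9 ≤ f ∧ f ≤ 20) : PairList n N d v u s' :=
  h.frame hf.1 fun a ha => by unfold Scratch at ha; omega

/-- Load the endpoints of the pair whose index is in the cell `i` into the cells `a` and `b`. -/
def fetchPair (a b i : ℕ) : List Instr := fetch a i 7 ++ (.add b i 1 :: fetch b b 7)

/-- A list of pairs is stored as all first entries followed by all second entries: pair k is at the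
indices k and N + k. -/
theorem PairList.execAll_fetchPair {n N d v i k a b : ℕ} {u : ℕ → ℕ} {s : MachineState}
    (h : PairList n N d v u s) (x : GraphPair n) (hi : s.int i = k) (hk : k < N)
    (ha : 9 ≤ a ∧ a ≤ 23) (hb : 9 ≤ b ∧ b ≤ 23) (hia : i ≠ a) :
    execAll x (fetchPair a b i) s = (s.setInt a (u k)).setInt b (u (N + k)) := by
  obtain ⟨-, -, h7, -⟩ := h.consts
  have h1 : s.int (2 * k + 64) = u k := h.pairs k (by omega)
  have h2 : s.int (2 * (k + N) + 64) = u (N + k) := by rw [h.pairs (k + N) (by omega), add_comm]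
  rw [fetchPair, execAll_append, execAll_fetch x (by omega) (by rw [h7]; omega), h7, hi, h1]
  have h3 : Instr.exec x (s.setInt a (u k)) (.add b i 1) = (s.setInt a (u k)).setInt b (k + N) := by
    have : (s.setInt a (u k)).int i + (s.setInt a (u k)).int 1 = k + N := by
      rw [MachineState.setInt_int, MachineState.setInt_int, if_neg hia, if_neg (by omega), hi, h.N_eq]
    rw [← this]
    rfl
  rw [execAll, h3]
  have h4 : ((s.setInt a (u k)).setInt b (k + N)).int b = k + N := by
    rw [MachineState.setInt_int, if_pos rfl]
  have h5 : ((s.setInt a (u k)).setInt b (k + N)).int 7 = 64 := by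
    rw [MachineState.setInt_int, MachineState.setInt_int, if_neg (by omega), if_neg (by omega), h7]
  rw [execAll_fetch x (by omega) (by rw [h5, h4]; omega), h4, h5, MachineState.setInt_int,
    MachineState.setInt_int, if_neg (by omega), if_neg (by omega), h2]
  simp [MachineState.setInt]

theorem Ends.whenEq {n : ℕ} {x : GraphPair n} {P : Program} {s : MachineState} {T a b : ℕ}
    {Q : MachineState → Prop} (h : s.int a = s.int b → Ends x P s T Q)
    (h' : s.int a ≠ s.int b → Q s) : Ends x (whenEq a b P) s (T + 2) Q :=
  Ends.ifLt (fun hlt => (Ends.skip (h' hlt.ne)).mono (Nat.zero_le _) fun _ h => h) fun hlt =>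
    Ends.ifLt (fun hlt' => (Ends.skip (h' hlt'.ne')).mono (Nat.zero_le _) fun _ h => h)
      fun hlt' => h (by omega)

/-! ### Testing whether a list of vertex pairs is a bounded connected graph -/

/-- Test whether the pairs in the first array are increasing and distinct. -/
def simpleTest : Program :=
  .forLoop 13 1 (.seq (.block (fetchPair 14 15 13)) (.seq (requireLt 14 15 10)
    (.forLoop 16 13 (.seq (.block (fetchPair 17 18 16))
      (whenEq 14 17 (whenEq 15 18 (.instr (.const 10 0))))))))

/-- Test whether no vertex is in more pairs than allowed. -/
def degreeTest : Program :=
  .forLoop 13 8 (.seq (.instr (.const 15 0)) (.seq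
    (.forLoop 14 5 (.seq (.block (fetch 16 14 7)) (whenEq 16 13 (.instr (.add 15 15 3)))))
    (.ifLt 2 15 (.instr (.const 10 0)) .skip)))

/-- Load the endpoints of the images, under the map in the second array, of the pair whose index
is in the cell `13`. -/
def fetchImage : List Instr := fetchPair 14 15 13 ++ (fetch 14 14 26 ++ fetch 15 15 26)

/-- Test whether the colouring in the second array is constant on each of the pairs, and if so,
require it to be constant. -/
def colouringTest : Program :=
  .seq (.block [.const 12 1]) (.seq
    (.forLoop 13 1 (.seq (.block fetchImage)
      (requireEq 14 15 12)))
    (.ifLt 25 12 (.forLoop 13 8 (.seq (.block (fetch 14 13 26 ++ fetch 15 25 26))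
      (requireEq 14 15 10))) .skip))

/-- Test whether the pairs form a connected graph, by checking all colourings with two colours. -/
def connectedTest : Program := enumerate 26 8 4 11 colouringTest

/-- Test whether the pairs are the edges of a connected graph with bounded degrees. -/
def validTest : Program := .seq simpleTest (.seq degreeTest connectedTest)

/-- The pairs `(u i, u (N + i))` are increasing and distinct. -/
def SimplePairs (N : ℕ) (u : ℕ → ℕ) : Prop :=
  ∀ i < N, u i < u (N + i) ∧ ∀ j < i, u i = u j → u (N + i) = u (N + j) → False

/-- Each vertex is in at most `d` of the pairs. -/
def BoundedPairs (N d v : ℕ) (u : ℕ → ℕ) : Prop :=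
  ∀ a < v, ((Finset.range (N + N)).filter fun k => u k = a).card ≤ d

/-- A colouring which is constant on all pairs is constant. -/
def ConnectedPairs (N v : ℕ) (u : ℕ → ℕ) : Prop :=
  ∀ c < 2 ^ v, (∀ i < N, c / 2 ^ u i % 2 = c / 2 ^ u (N + i) % 2) →
    ∀ a < v, c / 2 ^ a % 2 = c / 2 ^ 0 % 2

section

variable {n : ℕ} {x : GraphPair n} {N d v : ℕ} {u : ℕ → ℕ}

theorem simpleTest_tests : Tests x simpleTest (N * (N * 14 + 13) + 2) (Scratch 11 10) 10
    (PairList n N d v u) (SimplePairs N u) := by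
  refine (Tests.forLoop (T := N * 14 + 11) (W' := Scratch 14 10)
    (fun s s' hs hf => hs.scratch hf (by norm_num) (by norm_num)) (fun s hs => ⟨hs.consts.1, hs.N_eq⟩)
    (by unfold Scratch; omega) (by norm_num) (Scratch.mono (by norm_num))
    (by unfold Scratch; omega) fun k hk => ?_)
  refine (Tests.block_seq (E' := fun s => PairList n N d v u s ∧ s.int 13 = k ∧ s.int 14 = u k ∧
    s.int 15 = u (N + k)) (T := 2 + (k * 14 + 2)) ?_ ?_).mono ?_ (fun _ h => h) (fun _ h => h)
    Iff.rfl
  · rintro s ⟨hs, hi⟩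
    rw [hs.execAll_fetchPair x hi hk (by norm_num) (by norm_num) (by norm_num)]
    have hf : Frame (Scratch 14 10) s ((s.setInt 14 (u k)).setInt 15 (u (N + k))) :=
      ((Frame.refl _ s).setInt (by unfold Scratch; omega) _).setInt (by unfold Scratch; omega) _
    exact ⟨hf, by simp [MachineState.setInt_int], hs.scratch hf (by norm_num) (by norm_num),
      by simp [MachineState.setInt_int, hi], by simp [MachineState.setInt_int],
      by simp [MachineState.setInt_int]⟩
  · have hst : ∀ s s' : MachineState, (PairList n N d v u s ∧ s.int 13 = k ∧ s.int 14 = u k ∧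
        s.int 15 = u (N + k)) → Frame (Scratch 16 10) s s' → (PairList n N d v u s' ∧
        s'.int 13 = k ∧ s'.int 14 = u k ∧ s'.int 15 = u (N + k)) := by
      rintro s s' ⟨h1, h2, h3, h4⟩ hf
      exact ⟨h1.scratch hf (by norm_num) (by norm_num),
        by rw [hf.1 _ (by unfold Scratch; omega), h2],
        by rw [hf.1 _ (by unfold Scratch; omega), h3],
        by rw [hf.1 _ (by unfold Scratch; omega), h4]⟩
    refine (Tests.seq (W := Scratch 16 10) (Tests.requireLt (by unfold Scratch; omega)
      (fun s hs => hs.2.2.1) (fun s hs => hs.2.2.2)) hst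
      (Tests.forLoop (T := 12) (len := k) (W' := Scratch 17 10) hst
        (fun s hs => ⟨hs.1.consts.1, hs.2.1⟩) (by unfold Scratch; omega) (by norm_num)
        (Scratch.mono (by norm_num)) (by unfold Scratch; omega) fun j hj => ?_)).mono le_rfl
        (Scratch.mono (by norm_num)) (fun _ h => h) Iff.rfl
    refine Tests.block_seq (E' := fun s => s.int 14 = u k ∧ s.int 15 = u (N + k) ∧ s.int 17 = u j ∧
      s.int 18 = u (N + j)) (T := 5) ?_ (Tests.whenEq (fun s hs => hs.1) (fun s hs => hs.2.2.1)
        (Tests.whenEq (fun s hs => hs.2.1) (fun s hs => hs.2.2.2)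
          (Tests.fail (by unfold Scratch; omega))))
    rintro s ⟨⟨hs, h1, h2, h3⟩, hj'⟩
    rw [hs.execAll_fetchPair x hj' (by omega) (by norm_num) (by norm_num) (by norm_num)]
    have hf : Frame (Scratch 17 10) s ((s.setInt 17 (u j)).setInt 18 (u (N + j))) :=
      ((Frame.refl _ s).setInt (by unfold Scratch; omega) _).setInt (by unfold Scratch; omega) _
    exact ⟨hf, by simp [MachineState.setInt_int], by simp [MachineState.setInt_int, h2],
      by simp [MachineState.setInt_int, h3], by simp [MachineState.setInt_int],
      by simp [MachineState.setInt_int]⟩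
  · simp only [fetchPair, fetch, List.length_append, List.length_cons, List.length_nil]
    omega

/-- Cell 15 counts the occurrences of the vertex among all 2N entries; for a simple list this is its
degree. -/
theorem degreeTest_tests : Tests x degreeTest (v * ((N + N) * 8 + 7) + 2) (Scratch 11 10) 10
    (PairList n N d v u) (BoundedPairs N d v u) := by
  refine (Tests.forLoop (T := (N + N) * 8 + 5) (W' := Scratch 14 10)
    (fun s s' hs hf => hs.scratch hf (by norm_num) (by norm_num)) (fun s hs => ⟨hs.consts.1, hs.v_eq⟩)
    (by unfold Scratch; omega) (by norm_num) (Scratch.mono (by norm_num))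
    (by unfold Scratch; omega) fun a ha => ?_)
  rintro s ⟨hs, h13⟩
  refine Ends.mono (T := 1 + (((N + N) * (6 + 2) + 2) + 2)) ?_ (by omega) fun _ h => h
  refine Ends.seq (Ends.instr (Q := fun s' => s' = s.setInt 15 0) rfl) fun s₁ hs₁ => ?_
  refine Ends.seq (Ends.forLoop (T := 6) (len := N + N) (fun k s' => Frame (Scratch 14 15) s s' ∧
    s'.int 15 = ((Finset.range k).filter fun k => u k = a).card) ?_ ?_ ?_ ?_) ?_
  · rw [hs₁]
    exact ⟨(Frame.refl _ _).setInt (by unfold Scratch; omega) 0, by simp [MachineState.setInt_int]⟩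
  · rintro k s' ⟨hf, -⟩
    have := hs.scratch hf (by norm_num) (by norm_num)
    exact ⟨this.consts.1, this.len_eq⟩
  · rintro k s' m ⟨hf, h15⟩
    exact ⟨hf.setInt (by unfold Scratch; omega) m, by
      rw [MachineState.setInt_int, if_neg (by norm_num), h15]⟩
  · rintro k hk s' ⟨hf, h15⟩ h14
    have hs' := hs.scratch hf (by norm_num) (by norm_num)
    have h13' : s'.int 13 = a := by rw [hf.1 _ (by unfold Scratch; omega), h13]
    have h7 : s'.int 7 = 64 := hs'.consts.2.2.1
    have hu : s'.int (2 * k + 64) = u k := hs'.pairs k hk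
    refine (Ends.seq (T := 3) (T' := 3) (Ends.block (Q := fun s₂ => s₂ = s'.setInt 16 (u k)) ?_)
      fun s₂ hs₂ => ?_).mono le_rfl fun _ h => h
    · rw [execAll_fetch x (by norm_num) (by rw [h7]; omega), h7, h14, hu]
    · have hf₂ : Frame (Scratch 14 15) s s₂ := by
        rw [hs₂]; exact hf.setInt (by unfold Scratch; omega) _
      have e16 : s₂.int 16 = u k := by simp [hs₂, MachineState.setInt_int]
      have e13 : s₂.int 13 = a := by simp [hs₂, MachineState.setInt_int, h13']
      have e14 : s₂.int 14 = k := by simp [hs₂, MachineState.setInt_int, h14]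
      have e15 : s₂.int 15 = ((Finset.range k).filter fun k => u k = a).card := by
        simp [hs₂, MachineState.setInt_int, h15]
      have e3 : s₂.int 3 = 1 := (hs.scratch hf₂ (by norm_num) (by norm_num)).consts.1
      rw [Finset.range_add_one, Finset.filter_insert]
      refine Ends.whenEq (fun heq => Ends.instr ⟨⟨?_, ?_⟩, ?_⟩) fun hne => ⟨⟨hf₂, ?_⟩, e14⟩
      · exact hf₂.setInt (by unfold Scratch; omega) _
      · rw [e16, e13] at heq
        rw [if_pos heq, Finset.card_insert_of_notMem (by simp)]
        simp [Instr.exec, e15, e3]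
      · simp [Instr.exec, e14]
      · rw [e16, e13] at hne
        rw [if_neg hne, e15]
  · rintro s₂ ⟨hf₂, h15⟩
    have e2 : s₂.int 2 = d := (hs.scratch hf₂ (by norm_num) (by norm_num)).d_eq
    have e10 : s₂.int 10 = s.int 10 := hf₂.1 _ (by unfold Scratch; omega)
    have hsub : Frame (Scratch 14 10) s s₂ := hf₂.mono fun a ha => by unfold Scratch at *; omega
    refine Ends.ifLt (fun hlt => Ends.instr ?_) fun hlt =>
      (Ends.skip ?_).mono (Nat.zero_le _) fun _ h => h
    · rw [e2, h15] at hlt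
      exact ⟨hsub.setInt (by unfold Scratch; omega) 0, fun h => absurd h hlt.not_ge, fun _ => by
        simp [Instr.exec]⟩
    · rw [e2, h15] at hlt
      exact ⟨hsub, fun _ => e10, fun h => absurd (not_lt.1 hlt) h⟩

/-- An implication between tests: the premise is evaluated into an auxiliary flag f', and the
conclusion is tested only if that flag survives. -/
theorem Tests.guarded {P Q : Program} {T T' f f' : ℕ} {W W' : ℕ → Prop} {E : MachineState → Prop}
    {G G' : Prop} (hE : ∀ s s', E s → Frame W s s' → E s') (h25 : ∀ s, E s → s.int 25 = 0)
    (hW : ∀ a, W' a → W a) (hf : ¬ W' f) (hff : f ≠ f') (hf' : W f')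
    (h : Tests x P T W' f' E G') (h' : Tests x Q T' W f E G) :
    Tests x (.seq (.block [.const f' 1]) (.seq P (.ifLt 25 f' Q .skip))) (1 + (T + (T' + 1))) W f E
      (G' → G) := by
  intro s hs
  refine Ends.seq (Ends.block (Q := fun s' => s' = s.setInt f' 1) rfl) fun s₁ hs₁ => ?_
  have hf₁ : Frame W s s₁ := by rw [hs₁]; exact (Frame.refl _ _).setInt hf' 1
  have h1 : s₁.int f' = 1 := by rw [hs₁, MachineState.setInt_int, if_pos rfl]
  have h2 : s₁.int f = s.int f := by rw [hs₁, MachineState.setInt_int, if_neg hff]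
  refine Ends.seq (h s₁ (hE s s₁ hs hf₁)) ?_
  rintro s₂ ⟨hf₂, h3, h4⟩
  have hf₂' := hf₁.trans (hf₂.mono hW)
  have hs₂ := hE s s₂ hs hf₂'
  refine Ends.ifLt (fun hlt => (h' s₂ hs₂).mono le_rfl ?_) fun hlt =>
    (Ends.skip (Q := fun s' => s' = s₂) rfl).mono (Nat.zero_le _) ?_
  · rintro s₃ ⟨hf₃, h5, h6⟩
    have hG' : G' := by
      by_contra hG'
      rw [h25 s₂ hs₂, h4 hG'] at hlt
      exact lt_irrefl _ hlt
    refine ⟨hf₂'.trans hf₃, fun hg => ?_, fun hg => h6 fun hG => hg fun _ => hG⟩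
    rw [h5 (hg hG'), hf₂.1 f hf, h2]
  · rintro _ rfl
    have hG' : ¬ G' := by
      intro hG'
      rw [h25 _ hs₂, h3 hG', h1] at hlt
      exact hlt one_pos
    refine ⟨hf₂', fun _ => ?_, fun hg => absurd (fun h => absurd h hG') hg⟩
    rw [hf₂.1 f hf, h2]

theorem execAll_fetch_fetch (x : GraphPair n) {a a' i j b o : ℕ} {s : MachineState}
    (ha : a < 64) (ha' : a' < 64) (hba : b ≠ a) (hba' : b ≠ a') (hja : j ≠ a) (ho : 64 ≤ o)
    (hb : s.int b = o) : execAll x (fetch a i b ++ fetch a' j b) s =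
      (s.setInt a (s.int (2 * s.int i + o))).setInt a' (s.int (2 * s.int j + o)) := by
  rw [execAll_append, execAll_fetch x hba (by omega), hb, execAll_fetch x hba']
  · simp only [MachineState.setInt_int, if_neg hba, if_neg hja, hb]
    rw [if_neg (by omega)]
  · simp only [MachineState.setInt_int, if_neg hba, if_neg hja, hb]
    omega

theorem execAll_fetchImage (x : GraphPair n) {s : MachineState} {χ : ℕ → ℕ} {k : ℕ}
    (hs : PairList n N d v u s) (hχ : ArrayIs 65 v χ s) (hu : ∀ k < N + N, u k < v)
    (hk : k < N) (hi : s.int 13 = k) :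
    (execAll x fetchImage s).real = s.real ∧
      (∀ a, a ≠ 14 → a ≠ 15 → (execAll x fetchImage s).int a = s.int a) ∧
      (execAll x fetchImage s).int 14 = χ (u k) ∧
      (execAll x fetchImage s).int 15 = χ (u (N + k)) := by
  have h26 : s.int 26 = 65 := hs.consts.2.2.2
  have h1 := hχ _ (hu k (by omega))
  have h2 := hχ _ (hu (N + k) (by omega))
  rw [fetchImage, execAll_append, hs.execAll_fetchPair x hi hk (by norm_num) (by norm_num)
    (by norm_num), execAll_fetch_fetch (o := 65) x (by norm_num) (by norm_num) (by norm_num)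
    (by norm_num) (by norm_num) (by norm_num) (by simp [MachineState.setInt_int, h26])]
  have e1 : (2 * u k + 65 = 14) = False := by simp
  have e2 : (2 * u k + 65 = 15) = False := by simp
  have e3 : (2 * u (N + k) + 65 = 14) = False := by simp
  have e4 : (2 * u (N + k) + 65 = 15) = False := by simp
  refine ⟨rfl, fun a h14 h15 => ?_, ?_, ?_⟩
  · simp [MachineState.setInt_int, h14, h15]
  · simp [MachineState.setInt_int, h1, e1, e2]
  · simp [MachineState.setInt_int, h2, e3, e4]

theorem colouringTest_tests (hv : 0 < v) (hu : ∀ k < N + N, u k < v) (χ : ℕ → ℕ) :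
    Tests x colouringTest (N * 18 + v * 11 + 6) (Scratch 12 10) 10
      (fun s => PairList n N d v u s ∧ ArrayIs 65 v χ s)
      ((∀ i < N, χ (u i) = χ (u (N + i))) → ∀ a < v, χ a = χ 0) := by
  have hst : ∀ m f, 9 ≤ m → 9 ≤ f ∧ f ≤ 20 → ∀ s s' : MachineState,
      (PairList n N d v u s ∧ ArrayIs 65 v χ s) → Frame (Scratch m f) s s' →
      (PairList n N d v u s' ∧ ArrayIs 65 v χ s') := by
    rintro m f hm hf9 s s' ⟨h1, h2⟩ hf
    exact ⟨h1.scratch hf hm hf9, h2.frame hf fun k hk => by unfold Scratch; omega⟩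
  refine (Tests.guarded (T := N * 18 + 2) (T' := v * 11 + 2) (W' := Scratch 13 12)
    (hst 12 10 (by norm_num) (by norm_num)) (fun s hs => hs.1.consts.2.1)
    (fun a ha => by unfold Scratch at *; omega) (by unfold Scratch; omega) (by norm_num)
    (by unfold Scratch; omega) ?_ ?_).mono (by omega) (fun _ h => h) (fun _ h => h) Iff.rfl
  · refine Tests.forLoop (T := 16) (W' := Scratch 14 12) (hst 13 12 (by norm_num) (by norm_num))
      (fun s hs => ⟨hs.1.consts.1, hs.1.N_eq⟩) (by unfold Scratch; omega) (by norm_num)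
      (Scratch.mono (by norm_num)) (by unfold Scratch; omega) fun k hk => ?_
    refine Tests.block_seq (E' := fun s => s.int 14 = χ (u k) ∧ s.int 15 = χ (u (N + k))) (T := 3) ?_
      (Tests.requireEq (by unfold Scratch; omega) (fun s hs => hs.1) (fun s hs => hs.2))
    rintro s ⟨⟨hs, hχ⟩, hi⟩
    obtain ⟨h1, h2, h3⟩ := execAll_fetchImage x hs hχ hu hk hi
    refine ⟨⟨fun a ha => h2 a ?_ ?_, h1⟩, h2 _ (by norm_num) (by norm_num), h3⟩ <;>
      (unfold Scratch at ha; omega)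
  · refine Tests.forLoop (T := 9) (W' := Scratch 14 10) (hst 12 10 (by norm_num) (by norm_num))
      (fun s hs => ⟨hs.1.consts.1, hs.1.v_eq⟩) (by unfold Scratch; omega) (by norm_num)
      (Scratch.mono (by norm_num)) (by unfold Scratch; omega) fun a ha => ?_
    refine Tests.block_seq (E' := fun s => s.int 14 = χ a ∧ s.int 15 = χ 0) (T := 3) ?_
      (Tests.requireEq (by unfold Scratch; omega) (fun s hs => hs.1) (fun s hs => hs.2))
    rintro s ⟨⟨hs, hχ⟩, hi⟩
    have h26 : s.int 26 = 65 := hs.consts.2.2.2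
    have h25 : s.int 25 = 0 := hs.consts.2.1
    have h1 := hχ a ha
    have h2 := hχ 0 hv
    rw [execAll_fetch_fetch (o := 65) x (by norm_num) (by norm_num) (by norm_num) (by norm_num)
      (by norm_num) (by norm_num) h26, hi, h25, h1, h2]
    exact ⟨((Frame.refl _ s).setInt (by unfold Scratch; omega) _).setInt
        (by unfold Scratch; omega) _, by simp [MachineState.setInt_int],
        by simp [MachineState.setInt_int], by simp [MachineState.setInt_int]⟩

/-- The cells changed by `validTest`. -/
def TestCells (a : ℕ) : Prop := (10 ≤ a ∧ a ≤ 23) ∨ (64 ≤ a ∧ a % 2 = 1)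

theorem PairList.testCells {s s' : MachineState}
    (h : PairList n N d v u s) (hf : Frame TestCells s s') : PairList n N d v u s' :=
  h.frame hf.1 fun a ha => by unfold TestCells at ha; omega

/-- The colourings are enumerated as binary numbers. The 2^v steps are harmless beside the n^v maps,
and no graph search has to be verified. -/
theorem connectedTest_tests (hv : 0 < v) (hu : ∀ k < N + N, u k < v) :
    Tests x connectedTest (2 ^ v * (N * 18 + v * 20 + 10) + v * 5 + 4) TestCells 10
      (PairList n N d v u) (ConnectedPairs N v u) := by
  refine (Tests.enumerate (b := 26) (L := 8) (B := 4) (carry := 11) (o := 65) (len := v) (β := 2)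
    (T := N * 18 + v * 11 + 6) (W' := Scratch 12 10)
    ⟨by norm_num, by norm_num, by norm_num, by norm_num⟩ (by norm_num) (by norm_num)
    (fun s s' hs hf => hs.testCells hf)
    (fun s hs => ⟨hs.consts, hs.consts.2.2.2, hs.v_eq, hs.two_eq⟩)
    (fun a ha => by unfold ArrayCells at ha; unfold TestCells; omega) (by unfold ArrayCells; omega)
    (fun a ha => by unfold Scratch at ha; unfold TestCells; omega)
    (fun k hk => by unfold Scratch; omega)
    fun c hc => colouringTest_tests hv hu fun k => c / 2 ^ k % 2).mono (by ring_nf; omega)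
    (fun _ h => h) (fun _ h => h) Iff.rfl

theorem validTest_tests (hv : 0 < v) (hu : ∀ k < N + N, u k < v) :
    Tests x validTest ((N * (N * 14 + 13) + 2) + ((v * ((N + N) * 8 + 7) + 2) +
      (2 ^ v * (N * 18 + v * 20 + 10) + v * 5 + 4))) TestCells 10
      (PairList n N d v u) (SimplePairs N u ∧ BoundedPairs N d v u ∧ ConnectedPairs N v u) := by
  have hsc : ∀ a, Scratch 11 10 a → TestCells a := fun a ha => by
    unfold Scratch at ha; unfold TestCells; omega
  exact (simpleTest_tests.mono le_rfl hsc (fun _ h => h) Iff.rfl).seq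
    (fun s s' hs hf => hs.testCells hf)
    ((degreeTest_tests.mono le_rfl hsc (fun _ h => h) Iff.rfl).seq
      (fun s s' hs hf => hs.testCells hf) (connectedTest_tests hv hu))

end

/-! ### Evaluating the statistic -/

/-- Only integer cells in `W` and real cells in `R` may have changed. -/
def RealFrame (W R : ℕ → Prop) (s s' : MachineState) : Prop :=
  (∀ a, ¬ W a → s'.int a = s.int a) ∧ ∀ a, ¬ R a → s'.real a = s.real a

theorem RealFrame.trans {W R : ℕ → Prop} {s s' s'' : MachineState} (h : RealFrame W R s s')
    (h' : RealFrame W R s' s'') : RealFrame W R s s'' :=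
  ⟨fun a ha => (h'.1 a ha).trans (h.1 a ha), fun a ha => (h'.2 a ha).trans (h.2 a ha)⟩

theorem RealFrame.mono {W R W' R' : ℕ → Prop} {s s' : MachineState} (h : RealFrame W R s s')
    (hW : ∀ a, W a → W' a) (hR : ∀ a, R a → R' a) : RealFrame W' R' s s' :=
  ⟨fun a ha => h.1 a fun hw => ha (hW a hw), fun a ha => h.2 a fun hw => ha (hR a hw)⟩

theorem Frame.realFrame {W W' R : ℕ → Prop} {s s' : MachineState} (h : Frame W s s')
    (hW : ∀ a, W a → W' a) : RealFrame W' R s s' :=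
  ⟨fun a ha => h.1 a fun hw => ha (hW a hw), fun a _ => by rw [h.2]⟩

/-- Test whether the map in the second array is injective. -/
def injectiveTest : Program :=
  .forLoop 13 8 (.seq (.block (fetch 14 13 26)) (.forLoop 16 13
    (.seq (.block (fetch 17 16 26)) (whenEq 14 17 (.instr (.const 12 0))))))

/-- Multiply the real cell `r` by the weight of a pair of vertices; the cell `c` holds the answer
to the adjacency query. -/
def multiplyWeight (c r : ℕ) : Program :=
  .ifLt 25 c (.instr (.realOp .mul r r 13)) (.instr (.realOp .mul r r 14))

/-- Multiply the products by the weights of the image of one pair. -/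
def productStep : Program :=
  .seq (.block (fetchImage ++ [.edge₁ 16 14 15, .edge₂ 17 14 15]))
    (.seq (multiplyWeight 16 9) (multiplyWeight 17 10))

/-- Compute the products of the weights of the images of all pairs. -/
def productLoop : Program :=
  .seq (.block [.realConst 9 1, .realConst 10 1]) (.forLoop 13 1 productStep)

/-- Add the contribution of the map in the second array, if it is injective. -/
def embeddingStep : Program :=
  .seq (.instr (.const 12 1)) (.seq injectiveTest (.ifLt 25 12
    (.seq productLoop (.block [.realOp .add 6 6 9, .realOp .add 7 7 10, .realOp .add 8 8 12]))
    .skip))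

/-- The values `φ 0, …, φ (v - 1)` are distinct. -/
def InjectiveBelow (v : ℕ) (φ : ℕ → ℕ) : Prop := ∀ i < v, ∀ j < i, φ i = φ j → False

/-- The weight of the image of the pair `(a, b)` of numbers. -/
noncomputable def pairWeight {n : ℕ} (p : ℝ) (G : SimpleGraph (Fin n)) (a b : ℕ) : ℝ :=
  if 0 < edgeQuery G a b then 1 - p else -p

/-- The product of the weights of the images of the pairs in a list. -/
noncomputable def listWeight {n : ℕ} (p : ℝ) (G : SimpleGraph (Fin n)) (N : ℕ) (u φ : ℕ → ℕ) : ℝ :=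
  ∏ i ∈ Finset.range N, pairWeight p G (φ (u i)) (φ (u (N + i)))

section

variable {n : ℕ} {x : GraphPair n} {N d v : ℕ} {u φ : ℕ → ℕ} {p : ℝ}

theorem injectiveTest_tests : Tests x injectiveTest (v * (v * 8 + 7) + 2) (Scratch 13 12) 12
    (fun s => PairList n N d v u s ∧ ArrayIs 65 v φ s) (InjectiveBelow v φ) := by
  have hst : ∀ m f, 9 ≤ m → 9 ≤ f ∧ f ≤ 20 → ∀ s s' : MachineState,
      (PairList n N d v u s ∧ ArrayIs 65 v φ s) → Frame (Scratch m f) s s' →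
      (PairList n N d v u s' ∧ ArrayIs 65 v φ s') := by
    rintro m f hm hf9 s s' ⟨h1, h2⟩ hf
    exact ⟨h1.scratch hf hm hf9, h2.frame hf fun k hk => by unfold Scratch; omega⟩
  refine Tests.forLoop (T := v * 8 + 5) (W' := Scratch 14 12) (hst 13 12 (by norm_num) (by norm_num))
    (fun s hs => ⟨hs.1.consts.1, hs.1.v_eq⟩) (by unfold Scratch; omega) (by norm_num)
    (Scratch.mono (by norm_num)) (by unfold Scratch; omega) fun i hi => ?_
  refine (Tests.block_seq (W := Scratch 14 12) (E' := fun s =>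
    (PairList n N d v u s ∧ ArrayIs 65 v φ s) ∧ s.int 13 = i ∧ s.int 14 = φ i)
    (T := i * 8 + 2) ?_ ?_).mono (by simp only [fetch, List.length_cons, List.length_nil]; omega)
    (fun _ h => h) (fun _ h => h) Iff.rfl
  · rintro s ⟨hs, h13⟩
    have h26 : s.int 26 = 65 := hs.1.consts.2.2.2
    rw [execAll_fetch x (by norm_num) (by omega), h26, h13, hs.2 i hi]
    have hf : Frame (Scratch 14 12) s (s.setInt 14 (φ i)) :=
      (Frame.refl _ s).setInt (by unfold Scratch; omega) _
    exact ⟨hf, by simp [MachineState.setInt_int], hst 14 12 (by norm_num) (by norm_num) _ _ hs hf,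
      by simp [MachineState.setInt_int, h13], by simp [MachineState.setInt_int]⟩
  · refine (Tests.forLoop (T := 6) (len := i) (W := Scratch 16 12) (W' := Scratch 17 12) ?_
      (fun s hs => ⟨hs.1.1.consts.1, hs.2.1⟩) (by unfold Scratch; omega) (by norm_num)
      (Scratch.mono (by norm_num)) (by unfold Scratch; omega) fun j hj => ?_).mono le_rfl
      (Scratch.mono (by norm_num)) (fun _ h => h) Iff.rfl
    · rintro s s' ⟨h1, h2, h3⟩ hf
      exact ⟨hst 16 12 (by norm_num) (by norm_num) s s' h1 hf,
        by rw [hf.1 _ (by unfold Scratch; omega), h2],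
        by rw [hf.1 _ (by unfold Scratch; omega), h3]⟩
    · refine Tests.block_seq (E' := fun s => s.int 14 = φ i ∧ s.int 17 = φ j) (T := 3) ?_
        (Tests.whenEq (fun s hs => hs.1) (fun s hs => hs.2) (Tests.fail (by unfold Scratch; omega)))
      rintro s ⟨⟨hs, h13, h14⟩, h16⟩
      have h26 : s.int 26 = 65 := hs.1.consts.2.2.2
      rw [execAll_fetch x (by norm_num) (by omega), h26, h16, hs.2 j (by omega)]
      exact ⟨(Frame.refl _ s).setInt (by unfold Scratch; omega) _,
        by simp [MachineState.setInt_int], by simp [MachineState.setInt_int, h14],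
        by simp [MachineState.setInt_int]⟩

/-- The real cells `l, …, m`. -/
def RealCells (l m a : ℕ) : Prop := l ≤ a ∧ a ≤ m

theorem multiplyWeight_ends {s : MachineState} {c r a b : ℕ} {G : SimpleGraph (Fin n)}
    (h25 : s.int 25 = 0) (hc : s.int c = edgeQuery G a b) (h13 : s.real 13 = 1 - p)
    (h14 : s.real 14 = -p) : Ends x (multiplyWeight c r) s 2 fun s' => s'.int = s.int ∧
      (∀ i, i ≠ r → s'.real i = s.real i) ∧ s'.real r = s.real r * pairWeight p G a b := by
  refine Ends.ifLt (fun hlt => Ends.instr ?_) fun hlt => Ends.instr ?_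
  all_goals rw [h25, hc] at hlt
  · refine ⟨rfl, fun i hi => Function.update_of_ne hi _ _, ?_⟩
    rw [pairWeight, if_pos hlt, ← h13]
    exact Function.update_self ..
  · refine ⟨rfl, fun i hi => Function.update_of_ne hi _ _, ?_⟩
    rw [pairWeight, if_neg hlt, ← h14]
    exact Function.update_self ..

theorem productStep_ends {s : MachineState} {k : ℕ} (hs : PairList n N d v u s)
    (hφ : ArrayIs 65 v φ s) (hu : ∀ k < N + N, u k < v) (hk : k < N) (hi : s.int 13 = k)
    (h13 : s.real 13 = 1 - p) (h14 : s.real 14 = -p) :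
    Ends x productStep s 19 fun s' => RealFrame (Scratch 14 14) (RealCells 9 10) s s' ∧
      s'.real 9 = s.real 9 * pairWeight p x.1 (φ (u k)) (φ (u (N + k))) ∧
      s'.real 10 = s.real 10 * pairWeight p x.2 (φ (u k)) (φ (u (N + k))) := by
  obtain ⟨g1, g2, g3, g4⟩ := execAll_fetchImage x hs hφ hu hk hi
  have h25 : s.int 25 = 0 := hs.consts.2.1
  refine Ends.seq (T := 15) (T' := 2 + 2) (Ends.block (Q := fun s₂ => s₂.real = s.real ∧
    (∀ a, a ≠ 14 → a ≠ 15 → a ≠ 16 → a ≠ 17 → s₂.int a = s.int a) ∧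
    s₂.int 16 = edgeQuery x.1 (φ (u k)) (φ (u (N + k))) ∧
    s₂.int 17 = edgeQuery x.2 (φ (u k)) (φ (u (N + k)))) ?_) ?_
  · rw [execAll_append]
    generalize execAll x fetchImage s = s₁ at g1 g2 g3 g4 ⊢
    refine ⟨g1, fun a a14 a15 a16 a17 => ?_, ?_, ?_⟩
    · simp [execAll, Instr.exec, a16, a17, g2 a a14 a15]
    · simp [execAll, Instr.exec, g3, g4]
    · simp [execAll, Instr.exec, g3, g4]
  · rintro s₂ ⟨hr, hi, h16, h17⟩
    have e25 : s₂.int 25 = 0 := by rw [hi 25] <;> omega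
    refine Ends.seq (multiplyWeight_ends e25 h16 (by rw [hr, h13]) (by rw [hr, h14])) ?_
    rintro s₃ ⟨hi₃, hr₃, h9₃⟩
    refine (multiplyWeight_ends (by rw [hi₃, e25]) (by rw [hi₃, h17])
      (by rw [hr₃ _ (by norm_num), hr, h13]) (by rw [hr₃ _ (by norm_num), hr, h14])).mono le_rfl ?_
    rintro s₄ ⟨hi₄, hr₄, h10₄⟩
    refine ⟨⟨fun a ha => ?_, fun a ha => ?_⟩, ?_, ?_⟩
    · rw [hi₄, hi₃, hi a] <;> (unfold Scratch at ha; omega)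
    · rw [hr₄ a, hr₃ a, hr] <;> (unfold RealCells at ha; omega)
    · rw [hr₄ 9 (by norm_num), h9₃, hr]
    · rw [h10₄, hr₃ 10 (by norm_num), hr]

theorem productLoop_ends {s : MachineState} (hs : PairList n N d v u s) (hφ : ArrayIs 65 v φ s)
    (hu : ∀ k < N + N, u k < v) (h13 : s.real 13 = 1 - p) (h14 : s.real 14 = -p) :
    Ends x productLoop s (N * 21 + 4) fun s' => RealFrame (Scratch 13 12) (RealCells 9 10) s s' ∧
      s'.real 9 = listWeight p x.1 N u φ ∧ s'.real 10 = listWeight p x.2 N u φ := by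
  refine Ends.mono (T := 2 + (N * (19 + 2) + 2)) ?_ (by omega) fun _ h => h
  refine Ends.seq (Ends.block (Q := fun s₁ => RealFrame (Scratch 13 12) (RealCells 9 10) s s₁ ∧
    s₁.real 9 = 1 ∧ s₁.real 10 = 1) ?_) ?_
  · refine ⟨⟨fun _ _ => rfl, fun a ha => ?_⟩, ?_, ?_⟩
    · have h9 : a ≠ 9 := by rintro rfl; exact ha (by unfold RealCells; omega)
      have h10 : a ≠ 10 := by rintro rfl; exact ha (by unfold RealCells; omega)
      simp [execAll, Instr.exec, h9, h10]
    · simp [execAll, Instr.exec]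
    · simp [execAll, Instr.exec]
  · rintro s₁ ⟨hf₁, h9, h10⟩
    refine Ends.forLoop (T := 19) (len := N) (fun k s' =>
      RealFrame (Scratch 13 12) (RealCells 9 10) s s' ∧
      s'.real 9 = ∏ i ∈ Finset.range k, pairWeight p x.1 (φ (u i)) (φ (u (N + i))) ∧
      s'.real 10 = ∏ i ∈ Finset.range k, pairWeight p x.2 (φ (u i)) (φ (u (N + i))))
      ⟨hf₁, by simp [h9], by simp [h10]⟩ ?_ ?_ ?_
    · rintro k s' ⟨hf, -⟩
      have := hs.frame hf.1 fun a ha => by unfold Scratch at ha; omega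
      exact ⟨this.consts.1, this.N_eq⟩
    · rintro k s' m ⟨hf, h⟩
      refine ⟨⟨fun a ha => ?_, hf.2⟩, h⟩
      rw [MachineState.setInt_int, if_neg (by rintro rfl; exact ha (by unfold Scratch; omega)),
        hf.1 a ha]
    · rintro k hk s' ⟨hf, h9, h10⟩ hik
      have hs' := hs.frame hf.1 fun a ha => by unfold Scratch at ha; omega
      have hφ' : ArrayIs 65 v φ s' := fun j hj => by
        rw [hf.1 _ (by unfold Scratch; omega), hφ j hj]
      refine (productStep_ends hs' hφ' hu hk hik (by rw [hf.2 _ (by unfold RealCells; omega), h13])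
        (by rw [hf.2 _ (by unfold RealCells; omega), h14])).mono le_rfl ?_
      rintro s'' ⟨g1, g2, g3⟩
      refine ⟨⟨hf.trans (g1.mono (fun a ha => by unfold Scratch at *; omega) fun _ h => h), ?_, ?_⟩,
        by rw [g1.1 _ (by unfold Scratch; omega), hik]⟩
      · rw [Finset.prod_range_succ, g2, h9]
      · rw [Finset.prod_range_succ, g3, h10]

open Classical in
-- Real cells 6 and 7 collect the two embedding sums and real cell 8 the number of injective maps; a
-- map that is not injective adds nothing.
theorem embeddingStep_ends {s : MachineState} (hs : PairList n N d v u s) (hφ : ArrayIs 65 v φ s)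
    (hu : ∀ k < N + N, u k < v) (h12 : s.real 12 = 1) (h13 : s.real 13 = 1 - p)
    (h14 : s.real 14 = -p) :
    Ends x embeddingStep s (v * (v * 8 + 7) + N * 21 + 11) fun s' =>
      RealFrame (Scratch 12 12) (RealCells 6 10) s s' ∧
      s'.real 6 = s.real 6 + (if InjectiveBelow v φ then listWeight p x.1 N u φ else 0) ∧
      s'.real 7 = s.real 7 + (if InjectiveBelow v φ then listWeight p x.2 N u φ else 0) ∧
      s'.real 8 = s.real 8 + (if InjectiveBelow v φ then 1 else 0) := by
  refine Ends.mono (T := 1 + ((v * (v * 8 + 7) + 2) + (((N * 21 + 4) + 3) + 1))) ?_ (by omega)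
    fun _ h => h
  refine Ends.seq (Ends.instr (Q := fun s' => s' = s.setInt 12 1) rfl) fun s₁ hs₁ => ?_
  have hf₁ : Frame (Scratch 12 12) s s₁ := by
    rw [hs₁]; exact (Frame.refl _ _).setInt (by unfold Scratch; omega) 1
  have h1 : s₁.int 12 = 1 := by rw [hs₁, MachineState.setInt_int, if_pos rfl]
  refine Ends.seq (injectiveTest_tests s₁ ⟨hs.scratch hf₁ (by norm_num) (by norm_num),
    hφ.frame hf₁ fun k hk => by unfold Scratch; omega⟩) ?_
  rintro s₂ ⟨hf₂, h3, h4⟩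
  have hf : Frame (Scratch 12 12) s s₂ := hf₁.trans (hf₂.mono (Scratch.mono (by norm_num)))
  have hs₂ := hs.scratch hf (by norm_num) (by norm_num)
  have h25 : s₂.int 25 = 0 := hs₂.consts.2.1
  have hr : s₂.real = s.real := hf.2
  refine Ends.ifLt (fun hlt => ?_) fun hlt =>
    (Ends.skip (Q := fun s' => s' = s₂) rfl).mono (Nat.zero_le _) ?_
  · have hG : InjectiveBelow v φ := by
      by_contra hG
      rw [h25, h4 hG] at hlt
      exact lt_irrefl _ hlt
    simp only [if_pos hG]
    refine Ends.seq (T := N * 21 + 4) (T' := 3) (productLoop_ends hs₂ (hφ.frame hf fun k hk => by unfold Scratch; omega) hu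
      (by rw [hr, h13]) (by rw [hr, h14])) ?_
    rintro s₃ ⟨hf₃, h9, h10⟩
    refine Ends.block (l := [.realOp .add 6 6 9, .realOp .add 7 7 10, .realOp .add 8 8 12]) ?_
    refine ⟨⟨fun a ha => ?_, fun a ha => ?_⟩, ?_, ?_, ?_⟩
    · exact (hf₃.1 a fun h => ha (Scratch.mono (by norm_num) a h)).trans (hf.1 a ha)
    · have e : s₃.real a = s.real a := by
        rw [hf₃.2 a fun h => ha (by unfold RealCells at *; omega), hr]
      have e6 : a ≠ 6 := by rintro rfl; exact ha (by unfold RealCells; omega)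
      have e7 : a ≠ 7 := by rintro rfl; exact ha (by unfold RealCells; omega)
      have e8 : a ≠ 8 := by rintro rfl; exact ha (by unfold RealCells; omega)
      simp [execAll, Instr.exec, e6, e7, e8, e]
    · have e : s₃.real 6 = s.real 6 := by rw [hf₃.2 6 (by unfold RealCells; omega), hr]
      simp [execAll, Instr.exec, RealOp.eval, h9, e]
    · have e : s₃.real 7 = s.real 7 := by rw [hf₃.2 7 (by unfold RealCells; omega), hr]
      simp [execAll, Instr.exec, RealOp.eval, h10, e]
    · have e : s₃.real 8 = s.real 8 := by rw [hf₃.2 8 (by unfold RealCells; omega), hr]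
      have e12 : s₃.real 12 = 1 := by rw [hf₃.2 12 (by unfold RealCells; omega), hr, h12]
      simp [execAll, Instr.exec, RealOp.eval, e12, e]
  · rintro _ rfl
    have hG : ¬ InjectiveBelow v φ := by
      intro hG
      rw [h25, h3 hG, h1] at hlt
      exact hlt one_pos
    simp only [if_neg hG, add_zero, hr, and_self, and_true]
    exact hf.realFrame fun _ h => h

end

/-- Sum the contributions of all injective maps of the vertices of a list of pairs. -/
def countEmbeddings : Program :=
  .seq (.block [.realConst 6 0, .realConst 7 0, .realConst 8 0]) (enumerate 26 8 0 11 embeddingStep)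

/-- Add the contribution of a list of pairs to the statistic. -/
def listStep : Program :=
  .seq (.instr (.const 10 1)) (.seq validTest (.ifLt 25 10 (.seq countEmbeddings
    (.block [.realOp .mul 11 8 4, .realOp .div 11 3 11, .realOp .mul 11 11 6, .realOp .mul 11 11 7,
      .realOp .add 2 2 11])) .skip))

/-- Add the contributions of all lists of pairs on a given number of vertices. -/
def sizeStep : Program :=
  .seq (.block [.add 8 27 3, .realOp .add 5 5 12, .realOp .mul 4 4 5]) (enumerate 7 5 8 9 listStep)

/-- Set the cells which hold constants. -/
def setupBlock : List Instr :=
  [.const 3 1, .const 4 2, .const 7 64, .const 26 65, .add 5 1 1, .add 6 1 3, .realConst 3 1,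
    .realConst 4 1, .realConst 12 1, .realOp .sub 13 12 0, .realOp .sub 14 15 0,
    .realOp .mul 16 0 13, .realOp .div 16 1 16]

/-- Compute the factor common to all contributions. -/
def coefficientLoop : Program :=
  .forLoop 13 1 (.block [.realOp .add 17 17 12, .realOp .div 11 16 17, .realOp .mul 3 3 11])

/-- The program that evaluates the statistic. -/
def statProgram : Program :=
  .ifLt 25 0 (.seq (.block setupBlock) (.seq coefficientLoop (.seq (.forLoop 27 6 sizeStep)
    (.instr (.realOp .add 0 2 15))))) (.instr (.realConst 0 0))

/-- The digits of `c` in base `β`. -/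
def digit (β c k : ℕ) : ℕ := c / β ^ k % β

open Classical in
/-- The sum over all injective maps of the weights of the image of a list of pairs. -/
noncomputable def embeddingSum {n : ℕ} (p : ℝ) (G : SimpleGraph (Fin n)) (N v : ℕ) (u : ℕ → ℕ) :
    ℝ :=
  ∑ c ∈ Finset.range (n ^ v), if InjectiveBelow v (digit n c) then listWeight p G N u (digit n c)
    else 0

open Classical in
/-- The number of injective maps. -/
noncomputable def embeddingCount (n v : ℕ) : ℝ :=
  ∑ c ∈ Finset.range (n ^ v), if InjectiveBelow v (digit n c) then 1 else 0

/-- The list is that of the edges of a connected graph with bounded degrees. -/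
def ValidPairs (N d v : ℕ) (u : ℕ → ℕ) : Prop :=
  SimplePairs N u ∧ BoundedPairs N d v u ∧ ConnectedPairs N v u

open Classical in
/-- The contribution of all lists of pairs on `v` vertices. -/
noncomputable def sizeSum {n : ℕ} (p : ℝ) (N d v : ℕ) (cc : ℝ) (x : GraphPair n) : ℝ :=
  ∑ c ∈ Finset.range (v ^ (N + N)), if ValidPairs N d v (digit v c) then
    cc / (embeddingCount n v * (v.factorial : ℝ)) * embeddingSum p x.1 N v (digit v c) *
      embeddingSum p x.2 N v (digit v c) else 0

/-! ### Step bounds and correctness of the evaluation program. -/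

/-- A bound on the number of steps of `countEmbeddings`. -/
def countTime (n N v : ℕ) : ℕ :=
  3 + (n ^ v * ((v * (v * 8 + 7) + N * 21 + 11) + v * 9 + 4) + v * 5 + 4)

/-- A bound on the number of steps of `listStep`. -/
def listTime (n N v : ℕ) : ℕ :=
  1 + (((N * (N * 14 + 13) + 2) + ((v * ((N + N) * 8 + 7) + 2) +
    (2 ^ v * (N * 18 + v * 20 + 10) + v * 5 + 4))) + ((countTime n N v + 5) + 1))

/-- A bound on the number of steps of `sizeStep`. -/
def sizeTime (n N v : ℕ) : ℕ :=
  3 + (v ^ (N + N) * (listTime n N v + (N + N) * 9 + 4) + (N + N) * 5 + 4)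

/-- A bound on the number of steps of `statProgram`. -/
def statTime (n N : ℕ) : ℕ :=
  13 + ((N * 5 + 2) + (((N + 1) * (sizeTime n N (N + 1) + 2) + 2) + 1)) + 1

theorem sizeTime_mono {n N v v' : ℕ} (hn : 1 ≤ n) (h : v ≤ v') :
    sizeTime n N v ≤ sizeTime n N v' := by
  unfold sizeTime listTime countTime
  have h1 : n ^ v ≤ n ^ v' := Nat.pow_le_pow_right hn h
  have h2 : 2 ^ v ≤ 2 ^ v' := Nat.pow_le_pow_right (by norm_num) h
  gcongr

/-- The real cells that hold parameters. -/
structure RealParams (cc vr vf p : ℝ) (s : MachineState) : Prop where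
  coeff_eq : s.real 3 = cc
  fact_eq : s.real 4 = vf
  size_eq : s.real 5 = vr
  one_eq : s.real 12 = 1
  present_eq : s.real 13 = 1 - p
  absent_eq : s.real 14 = -p
  zero_eq : s.real 15 = 0

/-- The real cells used as scratch memory and the accumulator. -/
def SumCells (a : ℕ) : Prop := a = 2 ∨ (6 ≤ a ∧ a ≤ 11)

theorem RealParams.frame {cc vr vf p : ℝ} {s s' : MachineState} (h : RealParams cc vr vf p s)
    (hf : ∀ a, ¬ SumCells a → s'.real a = s.real a) : RealParams cc vr vf p s' := by
  obtain ⟨h1, h2, h3, h4, h5, h6, h7⟩ := h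
  refine ⟨?_, ?_, ?_, ?_, ?_, ?_, ?_⟩
  · rw [hf _ (by unfold SumCells; omega), h1]
  · rw [hf _ (by unfold SumCells; omega), h2]
  · rw [hf _ (by unfold SumCells; omega), h3]
  · rw [hf _ (by unfold SumCells; omega), h4]
  · rw [hf _ (by unfold SumCells; omega), h5]
  · rw [hf _ (by unfold SumCells; omega), h6]
  · rw [hf _ (by unfold SumCells; omega), h7]

section

variable {n : ℕ} {x : GraphPair n} {N d v : ℕ} {u : ℕ → ℕ} {p cc vr vf : ℝ}

open Classical in
-- The second array runs through all v-digit numbers in base n. Counting the injective maps along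
-- the way yields the falling factorial as a real number.
theorem countEmbeddings_ends {s : MachineState} (hn : 1 ≤ n) (hs : PairList n N d v u s)
    (hr : RealParams cc vr vf p s) (hu : ∀ k < N + N, u k < v) :
    Ends x countEmbeddings s (countTime n N v) fun s' =>
      RealFrame TestCells (RealCells 6 10) s s' ∧ s'.real 6 = embeddingSum p x.1 N v u ∧
      s'.real 7 = embeddingSum p x.2 N v u ∧ s'.real 8 = embeddingCount n v := by
  refine Ends.seq (T := 3) (Ends.block (l := [.realConst 6 0, .realConst 7 0, .realConst 8 0])
    (Q := fun s₁ => RealFrame TestCells (RealCells 6 10) s s₁ ∧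
    s₁.real 6 = 0 ∧ s₁.real 7 = 0 ∧ s₁.real 8 = 0) ?_) ?_
  · refine ⟨⟨fun _ _ => rfl, fun a ha => ?_⟩, ?_, ?_, ?_⟩
    · have e6 : a ≠ 6 := by rintro rfl; exact ha (by unfold RealCells; omega)
      have e7 : a ≠ 7 := by rintro rfl; exact ha (by unfold RealCells; omega)
      have e8 : a ≠ 8 := by rintro rfl; exact ha (by unfold RealCells; omega)
      simp [execAll, Instr.exec, e6, e7, e8]
    all_goals simp [execAll, Instr.exec]
  · rintro s₁ ⟨hf₁, h6, h7, h8⟩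
    refine Ends.enumerate (b := 26) (L := 8) (B := 0) (carry := 11) (o := 65) (len := v) (β := n)
      (T := v * (v * 8 + 7) + N * 21 + 11)
      ⟨by norm_num, by norm_num, by norm_num, by norm_num⟩ (by norm_num) hn
      (fun k s' => RealFrame TestCells (RealCells 6 10) s s' ∧
        (s'.real 6 = ∑ c ∈ Finset.range k, if InjectiveBelow v (digit n c) then
          listWeight p x.1 N u (digit n c) else 0) ∧
        (s'.real 7 = ∑ c ∈ Finset.range k, if InjectiveBelow v (digit n c) then
          listWeight p x.2 N u (digit n c) else 0) ∧
        s'.real 8 = ∑ c ∈ Finset.range k, if InjectiveBelow v (digit n c) then 1 else 0)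
      ⟨hf₁, by simp [h6], by simp [h7], by simp [h8]⟩ ?_ ?_ ?_
    · rintro k s' ⟨hf, -⟩
      have := hs.frame hf.1 fun a ha => by unfold TestCells at ha; omega
      exact ⟨this.consts, this.consts.2.2.2, this.v_eq, this.n_eq⟩
    · rintro k s' s'' ⟨hf, h⟩ hf'
      rw [hf'.2]
      exact ⟨hf.trans (hf'.realFrame fun a ha => by unfold ArrayCells at ha; unfold TestCells; omega), h⟩
    · rintro k hk s' ⟨hf, h6, h7, h8⟩ hd
      have hs' := hs.frame hf.1 fun a ha => by unfold TestCells at ha; omega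
      have hr' := hr.frame (s' := s') fun a ha => hf.2 a fun h => ha (by
        unfold RealCells at h; unfold SumCells; omega)
      refine (embeddingStep_ends (φ := digit n k) hs' hd hu hr'.one_eq hr'.present_eq
        hr'.absent_eq).mono le_rfl ?_
      rintro s'' ⟨g1, g2, g3, g4⟩
      refine ⟨⟨hf.trans (g1.mono (fun a ha => by unfold Scratch at ha; unfold TestCells; omega)
        fun _ h => h), ?_, ?_, ?_⟩, fun j hj => ?_⟩
      · rw [Finset.sum_range_succ, g2, h6]
      · rw [Finset.sum_range_succ, g3, h7]
      · rw [Finset.sum_range_succ, g4, h8]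
      · rw [g1.1 _ (by unfold Scratch; omega), hd j hj]

open Classical in
theorem listStep_ends {s : MachineState} (hn : 1 ≤ n) (hv : 0 < v) (hs : PairList n N d v u s)
    (hr : RealParams cc vr vf p s) (hu : ∀ k < N + N, u k < v) :
    Ends x listStep s (listTime n N v) fun s' => RealFrame TestCells SumCells s s' ∧
      s'.real 2 = s.real 2 + if ValidPairs N d v u then
        cc / (embeddingCount n v * vf) * embeddingSum p x.1 N v u * embeddingSum p x.2 N v u
        else 0 := by
  refine Ends.seq (T := 1) (Ends.instr (Q := fun s' => s' = s.setInt 10 1) rfl) fun s₁ hs₁ => ?_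
  have hf₁ : Frame TestCells s s₁ := by
    rw [hs₁]; exact (Frame.refl _ _).setInt (by unfold TestCells; omega) 1
  have h1 : s₁.int 10 = 1 := by rw [hs₁, MachineState.setInt_int, if_pos rfl]
  refine Ends.seq (validTest_tests hv hu s₁ (hs.testCells hf₁)) ?_
  rintro s₂ ⟨hf₂, h3, h4⟩
  have hf : Frame TestCells s s₂ := hf₁.trans hf₂
  have hs₂ := hs.testCells hf
  have h25 : s₂.int 25 = 0 := hs₂.consts.2.1
  have hr₂ : RealParams cc vr vf p s₂ := hr.frame fun a _ => by rw [hf.2]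
  refine Ends.ifLt (fun hlt => ?_) fun hlt =>
    (Ends.skip (Q := fun s' => s' = s₂) rfl).mono (Nat.zero_le _) ?_
  · have hG : ValidPairs N d v u := by
      by_contra hG
      rw [h25, h4 hG] at hlt
      exact lt_irrefl _ hlt
    rw [if_pos hG]
    refine Ends.seq (T := countTime n N v) (T' := 5) (countEmbeddings_ends hn hs₂ hr₂ hu) ?_
    rintro s₃ ⟨hf₃, h6, h7, h8⟩
    have hR : ∀ a, RealCells 6 10 a → SumCells a := fun a ha => by
      unfold RealCells at ha; unfold SumCells; omega
    have hf₃' : RealFrame TestCells SumCells s s₃ :=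
      (hf.realFrame fun _ h => h).trans (hf₃.mono (fun _ h => h) hR)
    have hr₃ := hr.frame hf₃'.2
    have e2 : s₃.real 2 = s.real 2 := by rw [hf₃.2 2 (by unfold RealCells; omega), hf.2]
    refine Ends.block (l := [.realOp .mul 11 8 4, .realOp .div 11 3 11, .realOp .mul 11 11 6,
      .realOp .mul 11 11 7, .realOp .add 2 2 11]) ?_
    refine ⟨⟨fun a ha => hf₃'.1 a ha, fun a ha => ?_⟩, ?_⟩
    · have e2 : a ≠ 2 := by rintro rfl; exact ha (by unfold SumCells; omega)
      have e11 : a ≠ 11 := by rintro rfl; exact ha (by unfold SumCells; omega)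
      simp [execAll, Instr.exec, e2, e11, hf₃'.2 a ha]
    · simp [execAll, Instr.exec, RealOp.eval, h6, h7, h8, e2, hr₃.coeff_eq, hr₃.fact_eq]
  · rintro _ rfl
    have hG : ¬ ValidPairs N d v u := by
      intro hG
      rw [h25, h3 hG, h1] at hlt
      exact hlt one_pos
    rw [if_neg hG, add_zero, hf.2]
    exact ⟨hf.realFrame fun _ h => h, rfl⟩

/-- The machine cannot convert integers to reals, so v and v! are maintained in real cells 5 and 4
alongside the integer v in cell 8. -/
theorem sizeStep_ends {s : MachineState} {w : ℕ} (hn : 1 ≤ n)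
    (hs : Params n N d v s) (hr : RealParams cc (w : ℝ) (w.factorial : ℝ) p s)
    (hw : s.int 27 = w) : Ends x sizeStep s (sizeTime n N (w + 1)) fun s' =>
      Params n N d (w + 1) s' ∧
      RealParams cc ((w + 1 : ℕ) : ℝ) ((w + 1).factorial : ℝ) p s' ∧ s'.int 27 = w ∧
      s'.real 2 = s.real 2 + sizeSum p N d (w + 1) cc x := by
  classical
  refine Ends.seq (T := 3) (Ends.block (l := [.add 8 27 3, .realOp .add 5 5 12,
    .realOp .mul 4 4 5]) (Q := fun s₁ => Params n N d (w + 1) s₁ ∧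
    RealParams cc ((w + 1 : ℕ) : ℝ) ((w + 1).factorial : ℝ) p s₁ ∧ s₁.int 27 = w ∧
    s₁.real 2 = s.real 2) ?_) ?_
  · obtain ⟨⟨h1, h2, h3, h4⟩, h5, h6, h7, h8, h9, h10, h11⟩ := hs
    obtain ⟨g1, g2, g3, g4, g5, g6, g7⟩ := hr
    refine ⟨⟨⟨?_, ?_, ?_, ?_⟩, ?_, ?_, ?_, ?_, ?_, ?_, ?_⟩, ⟨?_, ?_, ?_, ?_, ?_, ?_, ?_⟩, ?_, ?_⟩
    all_goals simp [execAll, Instr.exec, RealOp.eval, h1, h2, h3, h4, h5, h6, h7, h8, h9, h10,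
      g1, g2, g3, g4, g5, g6, g7, hw, Nat.factorial_succ, mul_comm]
  · rintro s₁ ⟨hs₁, hr₁, hw₁, h2⟩
    refine (Ends.enumerate (b := 7) (L := 5) (B := 8) (carry := 9) (o := 64) (len := N + N)
      (β := w + 1) (T := listTime n N (w + 1))
      ⟨by norm_num, by norm_num, by norm_num, by norm_num⟩ (by norm_num) (by omega)
      (fun k s' => Params n N d (w + 1) s' ∧
        RealParams cc ((w + 1 : ℕ) : ℝ) ((w + 1).factorial : ℝ) p s' ∧ s'.int 27 = w ∧
        s'.real 2 = s.real 2 + ∑ c ∈ Finset.range k, if ValidPairs N d (w + 1) (digit (w + 1) c)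
          then cc / (embeddingCount n (w + 1) * ((w + 1).factorial : ℝ)) *
            embeddingSum p x.1 N (w + 1) (digit (w + 1) c) *
            embeddingSum p x.2 N (w + 1) (digit (w + 1) c) else 0)
      ⟨hs₁, hr₁, hw₁, by simp [h2]⟩ ?_ ?_ ?_).mono le_rfl ?_
    · rintro k s' ⟨h, -⟩
      exact ⟨h.consts, h.consts.2.2.1, h.len_eq, h.v_eq⟩
    · rintro k s' s'' ⟨h1, h2, h3, h4⟩ hf
      refine ⟨h1.frame hf.1 fun a ha => by unfold ArrayCells at ha; omega,
        h2.frame fun a _ => by rw [hf.2], by rw [hf.1 _ (by unfold ArrayCells; omega), h3], ?_⟩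
      rw [hf.2, h4]
    · rintro k hk s' ⟨h1, h2, h3, h4⟩ hd
      refine (listStep_ends (u := digit (w + 1) k) hn (by omega) ⟨h1, hd⟩ h2
        fun j _ => Nat.mod_lt _ (by omega)).mono le_rfl ?_
      rintro s'' ⟨g1, g2⟩
      refine ⟨⟨h1.frame g1.1 fun a ha => by unfold TestCells at ha; omega,
        h2.frame g1.2, by rw [g1.1 _ (by unfold TestCells; omega), h3], ?_⟩, fun j hj => ?_⟩
      · rw [Finset.sum_range_succ, g2, h4, add_assoc]
      · rw [g1.1 _ (by unfold TestCells; omega), hd j hj]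
    · rintro s' ⟨h1, h2, h3, h4⟩
      exact ⟨h1, h2, h3, h4⟩

/-- Real cell 2 is the accumulator and real cell 3 the common factor, which starts at 1 and becomes
the product of ρ/(p(1-p))/(i+1), that is (ρ/(p(1-p)))^N / N!. The size loop, with counter in cell
27, is charged N + 1 times the cost of the largest size. -/
theorem statProgram_ends (x : GraphPair n) (N d : ℕ) (p ρ : ℝ) (hn : 1 ≤ n) :
    Ends x statProgram (initState n N d p ρ) (statTime n N) fun s' =>
      s'.real 0 = ∑ w ∈ Finset.range (N + 1), sizeSum p N d (w + 1)
        (∏ i ∈ Finset.range N, ρ / (p * (1 - p)) / ((i : ℝ) + 1)) x := by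
  -- Cell 25 still holds its initial 0, so the guard tests 0 < n; base n digits need n ≥ 1.
  refine Ends.ifLt (fun _ => ?_) fun h => absurd (show (0 : ℕ) < n by omega) (by
    simpa [initState] using h)
  refine Ends.seq (T := 13) (Ends.block (l := setupBlock) (Q := fun s => Params n N d 0 s ∧
    RealParams 1 ((0 : ℕ) : ℝ) ((Nat.factorial 0 : ℕ) : ℝ) p s ∧ s.real 2 = 0 ∧
    s.real 16 = ρ / (p * (1 - p)) ∧ s.real 17 = 0) ?_) ?_
  · refine ⟨⟨⟨?_, ?_, ?_, ?_⟩, ?_, ?_, ?_, ?_, ?_, ?_, ?_⟩, ⟨?_, ?_, ?_, ?_, ?_, ?_, ?_⟩, ?_, ?_, ?_⟩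
    all_goals simp [setupBlock, execAll, Instr.exec, RealOp.eval, initState]
  rintro s₁ ⟨hs₁, hr₁, h2, h16, h17⟩
  refine Ends.seq (T := N * 5 + 2) (Ends.forLoop (T := 3) (len := N) (fun k s =>
    Params n N d 0 s ∧ RealParams (∏ i ∈ Finset.range k, ρ / (p * (1 - p)) / ((i : ℝ) + 1))
      ((0 : ℕ) : ℝ) ((Nat.factorial 0 : ℕ) : ℝ) p s ∧ s.real 2 = 0 ∧
    s.real 16 = ρ / (p * (1 - p)) ∧ s.real 17 = k) ⟨hs₁, by simpa using hr₁, h2, h16, by simp [h17]⟩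
    ?_ ?_ ?_) ?_
  · rintro k s ⟨h, -⟩
    exact ⟨h.consts.1, h.N_eq⟩
  · rintro k s m ⟨h1, h2, h3⟩
    refine ⟨h1.frame (W := fun a => a = 13) (fun a ha => ?_) fun a ha => ?_, h2.frame fun _ _ => rfl,
      h3⟩
    · rw [MachineState.setInt_int, if_neg ha]
    · left
      have : a = 13 := ha
      omega
  · rintro k hk s ⟨h1, h2, h3, h4, h5⟩ hi
    refine Ends.block (l := [.realOp .add 17 17 12, .realOp .div 11 16 17, .realOp .mul 3 3 11]) ?_
    obtain ⟨g1, g2, g3, g4, g5, g6, g7⟩ := h2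
    refine ⟨⟨h1.frame (W := fun _ => False) (fun _ _ => rfl) fun _ h => h.elim,
      ⟨?_, ?_, ?_, ?_, ?_, ?_, ?_⟩, ?_, ?_, ?_⟩, hi⟩
    · rw [Finset.prod_range_succ, ← g1, ← h4]
      simp [execAll, Instr.exec, RealOp.eval, h5, g4]
    all_goals simp [execAll, Instr.exec, RealOp.eval, g2, g3, g4, g5, g6, g7, h3, h4, h5]
  rintro s₂ ⟨hs₂, hr₂, h2, -⟩
  refine Ends.seq (T := (N + 1) * (sizeTime n N (N + 1) + 2) + 2) (T' := 1)
    (Ends.forLoop (T := sizeTime n N (N + 1)) (len := N + 1)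
    (fun w s => (∃ v, Params n N d v s) ∧
      RealParams (∏ i ∈ Finset.range N, ρ / (p * (1 - p)) / ((i : ℝ) + 1)) (w : ℝ)
        (w.factorial : ℝ) p s ∧
      s.real 2 = ∑ w ∈ Finset.range w, sizeSum p N d (w + 1)
        (∏ i ∈ Finset.range N, ρ / (p * (1 - p)) / ((i : ℝ) + 1)) x)
    ⟨⟨0, hs₂⟩, hr₂, by simpa using h2⟩ ?_ ?_ ?_) ?_
  · rintro k s ⟨⟨v, h⟩, -⟩
    exact ⟨h.consts.1, h.bound_eq⟩
  · rintro k s m ⟨⟨v, h1⟩, h2, h3⟩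
    refine ⟨⟨v, h1.frame (W := fun a => a = 27) (fun a ha => ?_) fun a ha => ?_⟩,
      h2.frame fun _ _ => rfl, h3⟩
    · rw [MachineState.setInt_int, if_neg ha]
    · right
      have : a = 27 := ha
      omega
  · rintro w hw s ⟨⟨v, h1⟩, h2, h3⟩ hi
    refine (sizeStep_ends hn h1 h2 hi).mono (sizeTime_mono hn (by omega)) ?_
    rintro s' ⟨g1, g2, g3, g4⟩
    exact ⟨⟨⟨w + 1, g1⟩, g2, by rw [Finset.sum_range_succ, g4, h3]⟩, g3⟩
  rintro s₃ ⟨-, hr₃, h2⟩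
  refine Ends.instr ?_
  simp [Instr.exec, RealOp.eval, h2, hr₃.zero_eq]

theorem statProgram_ends_zero (x : GraphPair 0) (N d : ℕ) (p ρ : ℝ) :
    Ends x statProgram (initState 0 N d p ρ) (statTime 0 N) fun s' => s'.real 0 = 0 := by
  refine (Ends.ifLt (T := 1) (fun h => absurd h (by simp [initState])) fun _ =>
    Ends.instr (by simp [Instr.exec])).mono (by unfold statTime; omega) fun _ h => h

end

/-! ### The statistic as a sum over labelled graphs -/

/-- A connected graph with `N` edges and all degrees at most `d`. -/
def SimpleGraph.IsBounded {v : ℕ} (N d : ℕ) (H : SimpleGraph (Fin v)) : Prop :=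
  H.Connected ∧ H.edgeSet.ncard = N ∧ ∀ x, (H.neighborSet x).ncard ≤ d

/-- The weighted number of embeddings of a labelled graph into the centered graph of `G`. -/
noncomputable def graphCount {v n : ℕ} (p : ℝ) (H : SimpleGraph (Fin v)) (G : SimpleGraph (Fin n)) :
    ℝ :=
  ∑ φ : Fin v ↪ Fin n, weightProd p (edgesOf (H.map φ)) G

theorem graphCount_congr {v n : ℕ} {p : ℝ} {H H' : SimpleGraph (Fin v)} (f : H ≃g H')
    (G : SimpleGraph (Fin n)) : graphCount p H G = graphCount p H' G := by
  symm
  refine Fintype.sum_equiv (Equiv.embeddingCongr f.symm.toEquiv (Equiv.refl _)) _ _ fun φ => ?_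
  rw [← SimpleGraph.map_iso f]
  rfl

theorem graphCount_eq_zero {v n : ℕ} {p : ℝ} {H : SimpleGraph (Fin v)} (h : n < v)
    (G : SimpleGraph (Fin n)) : graphCount p H G = 0 := by
  have : IsEmpty (Fin v ↪ Fin n) := ⟨fun φ => by
    have := Fintype.card_le_of_embedding φ
    simp only [Fintype.card_fin] at this
    omega⟩
  exact Finset.sum_of_isEmpty _

theorem SimpleGraph.IsBounded.iso {v N d : ℕ} {H H' : SimpleGraph (Fin v)} (h : H.IsBounded N d)
    (f : H ≃g H') : H'.IsBounded N d := by
  obtain ⟨h1, h2, h3⟩ := h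
  refine ⟨f.connected_iff.1 h1, ?_, fun y => ?_⟩
  · rw [← h2, ← Nat.card_coe_set_eq, ← Nat.card_coe_set_eq]
    exact Nat.card_congr f.mapEdgeSet.symm
  · refine le_trans (le_of_eq ?_) (h3 (f.symm y))
    rw [← Nat.card_coe_set_eq, ← Nat.card_coe_set_eq]
    exact Nat.card_congr (f.symm.mapNeighborSet y)

open Classical in
-- Orbit and stabiliser: the permutations of the vertices act on labelled graphs, the orbit of a
-- representative is its class, and each fibre of the orbit map is a coset of the automorphisms.
theorem card_class_mul_aut {v : ℕ} (q : Quotient (graphIsoSetoid v)) :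
    (Finset.univ.filter fun H : SimpleGraph (Fin v) => (⟦H⟧ : Quotient (graphIsoSetoid v)) = q).card *
      Motif.aut ⟨v, q⟩ = v.factorial := by
  have hmap : ∀ σ : Equiv.Perm (Fin v), (⟦q.out.map σ.toEmbedding⟧ : Quotient (graphIsoSetoid v)) = q :=
    fun σ => by
      conv_rhs => rw [← Quotient.out_eq q]
      exact Quotient.sound ⟨(SimpleGraph.Iso.map σ q.out).symm⟩
  have h := Finset.card_eq_sum_card_fiberwise (s := Finset.univ)
    (f := fun σ : Equiv.Perm (Fin v) => q.out.map σ.toEmbedding)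
    (t := Finset.univ.filter fun H : SimpleGraph (Fin v) => (⟦H⟧ : Quotient (graphIsoSetoid v)) = q)
    fun σ _ => by simpa using hmap σ
  rw [Finset.card_univ, Fintype.card_perm, Fintype.card_fin] at h
  rw [h, Finset.sum_const_nat (m := Motif.aut ⟨v, q⟩)]
  intro H hH
  have hH' : (⟦q.out⟧ : Quotient (graphIsoSetoid v)) = ⟦H⟧ := by
    rw [Quotient.out_eq, (Finset.mem_filter.1 hH).2]
  obtain ⟨f⟩ : Nonempty (q.out ≃g H) := Quotient.exact hH'
  rw [← Fintype.card_subtype, ← Nat.card_eq_fintype_card]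
  refine (Nat.card_congr (Equiv.ofBijective (fun e : q.out ≃g q.out =>
    (⟨e.toEquiv.trans f.toEquiv, ?_⟩ : {σ : Equiv.Perm (Fin v) // q.out.map σ.toEmbedding = H}))
    ⟨?_, ?_⟩)).symm
  · have := SimpleGraph.map_iso (e.trans f) (Function.Embedding.refl _)
    simpa [Function.Embedding.coe_refl, SimpleGraph.map_id] using this
  · intro e e' he
    have := Subtype.mk.inj he
    ext x
    have h := DFunLike.congr_fun this x
    exact congrArg Fin.val (f.injective h)
  · rintro ⟨σ, hσ⟩
    subst hσ
    refine ⟨(SimpleGraph.Iso.map σ q.out).trans f.symm, Subtype.ext ?_⟩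
    ext x
    simp [SimpleGraph.Iso.map]

open Classical in
-- A class has v!/aut labelled members, on all of which g takes the same value.
theorem sum_quotient_eq_sum_graphs {v : ℕ} (g : SimpleGraph (Fin v) → ℝ)
    (hg : ∀ H H' : SimpleGraph (Fin v), (H ≃g H') → g H = g H') :
    ∑ q : Quotient (graphIsoSetoid v), g (Motif.graph ⟨v, q⟩) / (Motif.aut ⟨v, q⟩ : ℝ) =
      ∑ H, g H / (v.factorial : ℝ) := by
  rw [← Finset.sum_fiberwise (s := Finset.univ)
    (g := fun H : SimpleGraph (Fin v) => (⟦H⟧ : Quotient (graphIsoSetoid v)))]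
  refine Finset.sum_congr rfl fun q _ => ?_
  have h1 : ∀ H ∈ Finset.univ.filter fun H : SimpleGraph (Fin v) =>
      (⟦H⟧ : Quotient (graphIsoSetoid v)) = q, g H / (v.factorial : ℝ) =
      g (Motif.graph ⟨v, q⟩) / (v.factorial : ℝ) := by
    intro H hH
    have hH' : (⟦H⟧ : Quotient (graphIsoSetoid v)) = ⟦q.out⟧ := by
      rw [Quotient.out_eq, (Finset.mem_filter.1 hH).2]
    obtain ⟨f⟩ : Nonempty (H ≃g q.out) := Quotient.exact hH'
    rw [hg _ _ f]
    rfl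
  rw [Finset.sum_congr rfl h1, Finset.sum_const, nsmul_eq_mul]
  have h2 := card_class_mul_aut q
  have h3 := Motif.aut_pos ⟨v, q⟩
  have h4 : ((Motif.aut ⟨v, q⟩ : ℕ) : ℝ) ≠ 0 := by exact_mod_cast h3.ne'
  have h5 : (v.factorial : ℝ) ≠ 0 := by positivity
  rw [← h2]
  rw [← h2] at h5
  push_cast at h5 ⊢
  have h6 := left_ne_zero_of_mul h5
  field_simp

open Classical in
theorem motifStat_eq_sum_graphs {n : ℕ} (p ρ : ℝ) (N d : ℕ) (x : GraphPair n) :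
    motifStat p ρ N d x = ∑ w ∈ Finset.range (N + 1), ∑ H : SimpleGraph (Fin (w + 1)),
      if H.IsBounded N d then (ρ / (p * (1 - p))) ^ N /
        ((n.descFactorial (w + 1) : ℝ) * ((w + 1).factorial : ℝ)) * graphCount p H x.1 *
        graphCount p H x.2 else 0 := by
  rw [motifStat, motifFamily, Finset.sum_filter, Finset.sum_sigma, Finset.sum_range_succ']
  -- Connected graphs are nonempty, so the size 0 can be split off and sizes are w + 1.
  have h0 : ∀ q, ¬ Motif.IsBounded N d ⟨0, q⟩ := fun q h => by
    obtain ⟨a⟩ := h.1.nonempty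
    exact a.elim0
  rw [Finset.sum_eq_zero fun q _ => if_neg (h0 q), add_zero]
  refine Finset.sum_congr rfl fun w _ => ?_
  have := sum_quotient_eq_sum_graphs (v := w + 1) (fun H => if H.IsBounded N d then
    (ρ / (p * (1 - p))) ^ N / (n.descFactorial (w + 1) : ℝ) * graphCount p H x.1 *
        graphCount p H x.2 else 0) fun H H' f => by
    simp only [graphCount_congr f, eq_iff_iff.2 ⟨fun h : H.IsBounded N d => h.iso f,
      fun h => h.iso f.symm⟩]
  refine Eq.trans (Finset.sum_congr rfl fun q _ => ?_) (this.trans ?_)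
  · change (if Motif.IsBounded N d ⟨w + 1, q⟩ then _ else (0 : ℝ)) =
      (if Motif.IsBounded N d ⟨w + 1, q⟩ then _ else (0 : ℝ)) / _
    split_ifs with h
    · have hE : Motif.numEdges ⟨w + 1, q⟩ = N := h.2.1
      rw [injCount_eq, injCount_eq, motifWeight, hE]
      change _ * graphCount p (Motif.graph ⟨w + 1, q⟩) x.1 *
        graphCount p (Motif.graph ⟨w + 1, q⟩) x.2 = _
      -- If n < w + 1 the truncated subtraction makes the factorials meaningless, but there are no
      -- embeddings and both sides are 0.
      rcases lt_or_ge n (w + 1) with hn | hn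
      · rw [graphCount_eq_zero hn]; simp
      · have h := Nat.factorial_mul_descFactorial hn
        have hf : ((n - (w + 1)).factorial : ℝ) ≠ 0 := by positivity
        rw [← h, div_pow]
        push_cast
        simp only [div_eq_mul_inv, mul_inv]
        field_simp
    · rw [zero_div]
  · refine Finset.sum_congr rfl fun H _ => ?_
    split_ifs
    · simp only [div_eq_mul_inv, mul_inv]
      ring
    · rw [zero_div]

/-! ### Lists of vertex pairs and graphs -/

theorem sum_range_pow_eq_sum_digits {β L : ℕ} (g : ℕ → ℝ) (h : (Fin L → Fin β) → ℝ)
    (hgh : ∀ c (f : Fin L → Fin β), (∀ k : Fin L, (f k : ℕ) = digit β c k) → g c = h f) :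
    ∑ c ∈ Finset.range (β ^ L), g c = ∑ f, h f := by
  rw [Finset.sum_range]
  exact Fintype.sum_equiv finFunctionFinEquiv.symm _ _ fun c => hgh c _ fun k => rfl

theorem exists_digits {β L : ℕ} (f : Fin L → Fin β) :
    ∃ c < β ^ L, ∀ k : Fin L, digit β c k = f k := by
  refine ⟨finFunctionFinEquiv f, Fin.is_lt _, fun k => ?_⟩
  conv_rhs => rw [← finFunctionFinEquiv.symm_apply_apply f]
  rfl

/-- The unordered pairs in a list. -/
def pairEdge {N v : ℕ} (f : Fin (N + N) → Fin v) (i : Fin N) : Sym2 (Fin v) :=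
  s(f (Fin.castAdd N i), f (Fin.natAdd N i))

/-- The graph whose edges are the pairs in a list. -/
def pairGraph {N v : ℕ} (f : Fin (N + N) → Fin v) : SimpleGraph (Fin v) :=
  SimpleGraph.fromEdgeSet (Set.range (pairEdge f))

/-- The pairs are increasing and distinct. -/
def SimpleList {N v : ℕ} (f : Fin (N + N) → Fin v) : Prop :=
  (∀ i, f (Fin.castAdd N i) < f (Fin.natAdd N i)) ∧ Function.Injective (pairEdge f)

section

variable {n N d v : ℕ} {f : Fin (N + N) → Fin v} {u : ℕ → ℕ}

theorem simplePairs_iff (hf : ∀ k, (f k : ℕ) = u k) : SimplePairs N u ↔ SimpleList f := by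
  have h1 : ∀ i : Fin N, (f (Fin.castAdd N i) : ℕ) = u i := fun i => hf _
  have h2 : ∀ i : Fin N, (f (Fin.natAdd N i) : ℕ) = u (N + i) := fun i => hf _
  constructor
  · intro h
    refine ⟨fun i => ?_, fun i j hij => ?_⟩
    · rw [Fin.lt_def, h1, h2]
      exact (h i i.2).1
    · have hlt : ∀ i : Fin N, u i < u (N + i) := fun i => (h i i.2).1
      unfold pairEdge at hij
      rw [Sym2.eq_iff] at hij
      simp only [Fin.ext_iff, h1, h2] at hij
      have h3 := hlt i
      have h4 := hlt j
      by_contra hne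
      rcases lt_or_gt_of_ne (fun h : (i : ℕ) = j => hne (Fin.ext h)) with hlt | hlt
      · exact (h j j.2).2 i hlt (by omega) (by omega)
      · exact (h i i.2).2 j hlt (by omega) (by omega)
  · rintro ⟨hlt, hinj⟩ i hi
    refine ⟨?_, fun j hj e1 e2 => ?_⟩
    · have := hlt ⟨i, hi⟩
      rwa [Fin.lt_def, h1, h2] at this
    · have : (⟨i, hi⟩ : Fin N) = ⟨j, hj.trans hi⟩ := hinj (by
        unfold pairEdge
        rw [Sym2.eq_iff]
        left
        simp only [Fin.ext_iff, h1, h2]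
        exact ⟨e1, e2⟩)
      have := Fin.mk.inj this
      omega

theorem SimpleList.edgeSet_eq (hf : SimpleList f) :
    (pairGraph f).edgeSet = Set.range (pairEdge f) := by
  rw [pairGraph, SimpleGraph.edgeSet_fromEdgeSet]
  refine sdiff_eq_left.2 (Set.disjoint_left.2 ?_)
  rintro _ ⟨i, rfl⟩ h
  have h' : f (Fin.castAdd N i) = f (Fin.natAdd N i) := by simpa [pairEdge] using h
  exact (hf.1 i).ne h'

theorem SimpleList.edgesOf_eq (hf : SimpleList f) :
    edgesOf (pairGraph f) = Finset.univ.map ⟨pairEdge f, hf.2⟩ := by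
  ext e
  rw [mem_edgesOf, hf.edgeSet_eq]
  simp

theorem SimpleList.ncard_edgeSet (hf : SimpleList f) : (pairGraph f).edgeSet.ncard = N := by
  rw [← card_edgesOf, hf.edgesOf_eq, Finset.card_map, Finset.card_univ, Fintype.card_fin]

theorem pairWeight_eq {p : ℝ} {G : SimpleGraph (Fin n)} (a b : Fin n) :
    pairWeight p G a b = centeredWeight p G s(a, b) := by
  classical
  unfold pairWeight centeredWeight edgeQuery
  have h : (∃ (ha : (a : ℕ) < n) (hb : (b : ℕ) < n), G.Adj ⟨a, ha⟩ ⟨b, hb⟩) ↔ s(a, b) ∈ G.edgeSet :=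
    ⟨fun ⟨_, _, h⟩ => h, fun h => ⟨a.2, b.2, h⟩⟩
  simp only [h]
  split_ifs <;> simp_all

theorem injectiveBelow_iff {φ : Fin v → Fin n} {c : ℕ} (hφ : ∀ k : Fin v, (φ k : ℕ) = digit n c k) :
    InjectiveBelow v (digit n c) ↔ Function.Injective φ := by
  constructor
  · intro h i j hij
    have hij' : digit n c i = digit n c j := by rw [← hφ, ← hφ, hij]
    by_contra hne
    rcases lt_or_gt_of_ne (fun h : (i : ℕ) = j => hne (Fin.ext h)) with hlt | hlt
    · exact h j j.2 i hlt hij'.symm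
    · exact h i i.2 j hlt hij'
  · intro h i hi j hj hij
    have : (⟨i, hi⟩ : Fin v) = ⟨j, hj.trans hi⟩ := h (Fin.ext (by rw [hφ, hφ]; exact hij))
    have := Fin.mk.inj this
    omega

open Classical in
theorem sum_injective (g : (Fin v → Fin n) → ℝ) :
    (∑ φ : Fin v → Fin n, if Function.Injective φ then g φ else 0) =
      ∑ φ : Fin v ↪ Fin n, g φ := by
  rw [← Finset.sum_filter, Finset.sum_subtype (p := Function.Injective) _ (by simp) g]
  exact Fintype.sum_equiv (Equiv.subtypeInjectiveEquivEmbedding _ _) _ _ fun φ => rfl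

/-- For a simple list the pairs enumerate the edges of its graph without repetition, so the product
over the list is the product over the edge set. -/
theorem embeddingSum_eq {p : ℝ} {G : SimpleGraph (Fin n)} (hf : ∀ k, (f k : ℕ) = u k)
    (hs : SimpleList f) : embeddingSum p G N v u = graphCount p (pairGraph f) G := by
  classical
  rw [embeddingSum, sum_range_pow_eq_sum_digits _ (fun φ : Fin v → Fin n => if Function.Injective φ then
    ∏ i : Fin N, centeredWeight p G ((pairEdge f i).map φ) else 0), sum_injective]
  · refine Finset.sum_congr rfl fun φ _ => ?_
    rw [edgesOf_map, hs.edgesOf_eq, weightProd, Finset.prod_map, Finset.prod_map]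
    rfl
  · intro c φ hφ
    simp only [injectiveBelow_iff hφ]
    congr 1
    rw [listWeight, Finset.prod_range]
    refine Finset.prod_congr rfl fun i _ => ?_
    have h1 : (f (Fin.castAdd N i) : ℕ) = u i := hf _
    have h2 : (f (Fin.natAdd N i) : ℕ) = u (N + i) := hf _
    rw [← h1, ← h2, ← hφ, ← hφ, pairWeight_eq]
    rfl

theorem embeddingCount_eq : embeddingCount n v = (n.descFactorial v : ℝ) := by
  classical
  rw [embeddingCount, sum_range_pow_eq_sum_digits _ (fun φ : Fin v → Fin n => if Function.Injective φ then
    1 else 0), sum_injective, Finset.sum_const, Finset.card_univ, Fintype.card_embedding_eq,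
    Fintype.card_fin, Fintype.card_fin, nsmul_one]
  intro c φ hφ
  simp only [injectiveBelow_iff hφ]

/-- A colouring that is constant on edges is constant along walks; conversely the component of
vertex 0 is such a colouring. -/
theorem connectedPairs_iff (hv : 0 < v) (hf : ∀ k, (f k : ℕ) = u k) :
    ConnectedPairs N v u ↔ (pairGraph f).Connected := by
  classical
  have h1 : ∀ i : Fin N, (f (Fin.castAdd N i) : ℕ) = u i := fun i => hf _
  have h2 : ∀ i : Fin N, (f (Fin.natAdd N i) : ℕ) = u (N + i) := fun i => hf _
  have hadj : ∀ a b, (pairGraph f).Adj a b → ∃ i : Fin N, pairEdge f i = s(a, b) := by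
    intro a b hab
    rw [pairGraph, SimpleGraph.fromEdgeSet_adj] at hab
    exact hab.1
  constructor
  · intro h
    have : Nonempty (Fin v) := ⟨⟨0, hv⟩⟩
    have key : ∀ a : Fin v, (pairGraph f).Reachable ⟨0, hv⟩ a := by
      -- The binary number that encodes the indicator of the component of vertex 0.
      obtain ⟨c, hc, hd⟩ := exists_digits (β := 2) fun a : Fin v =>
        if (pairGraph f).Reachable ⟨0, hv⟩ a then 1 else 0
      have := h c hc fun i hi => by
        have e1 := hd (f (Fin.castAdd N ⟨i, hi⟩))
        have e2 := hd (f (Fin.natAdd N ⟨i, hi⟩))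
        rw [h1] at e1
        rw [h2] at e2
        change digit 2 c (u i) = digit 2 c (u (N + i))
        rw [e1, e2]
        by_cases heq : f (Fin.castAdd N ⟨i, hi⟩) = f (Fin.natAdd N ⟨i, hi⟩)
        · rw [heq]
        · have hadj : (pairGraph f).Adj (f (Fin.castAdd N ⟨i, hi⟩)) (f (Fin.natAdd N ⟨i, hi⟩)) := by
            rw [pairGraph, SimpleGraph.fromEdgeSet_adj]
            exact ⟨⟨⟨i, hi⟩, rfl⟩, heq⟩
          simp only [(⟨fun h => h.trans hadj.reachable, fun h => h.trans hadj.symm.reachable⟩ :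
            (pairGraph f).Reachable ⟨0, hv⟩ (f (Fin.castAdd N ⟨i, hi⟩)) ↔
            (pairGraph f).Reachable ⟨0, hv⟩ (f (Fin.natAdd N ⟨i, hi⟩)))]
      intro a
      have ha : digit 2 c a = digit 2 c (⟨0, hv⟩ : Fin v) := this a a.2
      rw [hd, hd, if_pos (SimpleGraph.Reachable.refl _)] at ha
      by_contra hn
      rw [if_neg hn] at ha
      simp at ha
    exact ⟨fun a b => (key a).symm.trans (key b)⟩
  · intro h c _ hc a ha
    have key : ∀ a b : Fin v, (pairGraph f).Adj a b → digit 2 c a = digit 2 c b := by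
      intro a b hab
      obtain ⟨i, hi⟩ := hadj a b hab
      have hci : digit 2 c (u i) = digit 2 c (u (N + i)) := hc i i.2
      rw [← h1, ← h2] at hci
      unfold pairEdge at hi
      rw [Sym2.eq_iff] at hi
      rcases hi with ⟨e1, e2⟩ | ⟨e1, e2⟩
      · rw [← e1, ← e2, hci]
      · rw [← e1, ← e2, hci]
    obtain ⟨w⟩ := h.preconnected ⟨a, ha⟩ ⟨0, hv⟩
    have key' : ∀ a b : Fin v, (pairGraph f).Walk a b → digit 2 c a = digit 2 c b := by
      intro a b w
      induction w with
      | nil => rfl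
      | cons hab _ ih => exact (key _ _ hab).trans ih
    exact key' _ _ w

/-- Sending a position to the pair containing it is a bijection onto the edges at a: entries within
a pair differ and the pairs are distinct. -/
theorem SimpleList.card_eq_ncard_neighborSet (hf : SimpleList f) (a : Fin v) :
    (Finset.univ.filter fun k => f k = a).card = ((pairGraph f).neighborSet a).ncard := by
  classical
  rw [Set.ncard_eq_toFinset_card', Set.toFinset_card, SimpleGraph.card_neighborSet_eq_degree,
    ← SimpleGraph.card_incidenceFinset_eq_degree]
  let j : Fin (N + N) → Fin N := Fin.addCases id id
  have hj1 : ∀ i, j (Fin.castAdd N i) = i := fun i => Fin.addCases_left i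
  have hj2 : ∀ i, j (Fin.natAdd N i) = i := fun i => Fin.addCases_right i
  refine Finset.card_bij (fun k _ => pairEdge f (j k)) ?_ ?_ ?_
  · intro k hk
    rw [SimpleGraph.mem_incidenceFinset, SimpleGraph.incidenceSet, Set.mem_sep_iff, hf.edgeSet_eq]
    refine ⟨⟨_, rfl⟩, ?_⟩
    have hk := (Finset.mem_filter.1 hk).2
    induction k using Fin.addCases with
    | left i => rw [hj1, ← hk]; exact Sym2.mem_mk_left _ _
    | right i => rw [hj2, ← hk]; exact Sym2.mem_mk_right _ _
  · intro k hk l hl hkl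
    have hk := (Finset.mem_filter.1 hk).2
    have hl := (Finset.mem_filter.1 hl).2
    have := hf.2 hkl
    induction k using Fin.addCases with
    | left i =>
      induction l using Fin.addCases with
      | left k =>
        rw [hj1, hj1] at this
        rw [this]
      | right k =>
        rw [hj1, hj2] at this
        subst this
        exact absurd (hk.trans hl.symm) (hf.1 _).ne
    | right i =>
      induction l using Fin.addCases with
      | left k =>
        rw [hj1, hj2] at this
        subst this
        exact absurd (hl.trans hk.symm) (hf.1 _).ne
      | right k =>
        rw [hj2, hj2] at this
        rw [this]
  · intro e he
    rw [SimpleGraph.mem_incidenceFinset, SimpleGraph.incidenceSet, Set.mem_sep_iff,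
      hf.edgeSet_eq] at he
    obtain ⟨⟨i, rfl⟩, ha⟩ := he
    unfold pairEdge at ha
    rw [Sym2.mem_iff] at ha
    rcases ha with ha | ha
    · exact ⟨Fin.castAdd N i, by simp [ha], by rw [hj1]⟩
    · exact ⟨Fin.natAdd N i, Finset.mem_filter.2 ⟨Finset.mem_univ _, ha.symm⟩, by rw [hj2]⟩

theorem boundedPairs_iff (hf : ∀ k, (f k : ℕ) = u k) (hs : SimpleList f) :
    BoundedPairs N d v u ↔ ∀ a, ((pairGraph f).neighborSet a).ncard ≤ d := by
  classical
  have h : ∀ a : Fin v, ((Finset.range (N + N)).filter fun k => u k = a).card =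
      ((pairGraph f).neighborSet a).ncard := by
    intro a
    rw [← hs.card_eq_ncard_neighborSet]
    symm
    refine Finset.card_bij (fun k _ => (k : ℕ)) ?_ ?_ ?_
    · intro k hk
      simp only [Finset.mem_filter, Finset.mem_univ, true_and] at hk
      simp [← hf, hk]
    · intro k _ l _ hkl
      exact Fin.ext hkl
    · intro k hk
      simp only [Finset.mem_filter, Finset.mem_range] at hk
      refine ⟨⟨k, hk.1⟩, ?_, rfl⟩
      simp only [Finset.mem_filter, Finset.mem_univ, true_and]
      exact Fin.ext ((hf _).trans hk.2)
  constructor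
  · intro hb a
    rw [← h a]
    exact hb a a.2
  · intro hb a ha
    have := hb ⟨a, ha⟩
    rwa [← h ⟨a, ha⟩] at this

theorem validPairs_iff (hv : 0 < v) (hf : ∀ k, (f k : ℕ) = u k) :
    ValidPairs N d v u ↔ SimpleList f ∧ (pairGraph f).IsBounded N d := by
  unfold ValidPairs
  rw [simplePairs_iff hf, connectedPairs_iff hv hf]
  constructor
  · rintro ⟨h1, h2, h3⟩
    exact ⟨h1, h3, h1.ncard_edgeSet, (boundedPairs_iff hf h1).1 h2⟩
  · rintro ⟨h1, h2, -, h3⟩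
    exact ⟨h1, (boundedPairs_iff hf h1).2 h3, h2⟩

open Classical in
/-- The number of lists of the edges of a graph. -/
theorem card_simpleList {H : SimpleGraph (Fin v)} (hH : H.edgeSet.ncard = N) :
    (Finset.univ.filter fun f : Fin (N + N) → Fin v => SimpleList f ∧ pairGraph f = H).card =
      N.factorial := by
  have hc : Fintype.card H.edgeSet = N := by
    rw [← hH, ← Nat.card_eq_fintype_card, Nat.card_coe_set_eq]
  have e₀ : Fin N ≃ H.edgeSet := (Fintype.equivFinOfCardEq hc).symm
  have hfac : Fintype.card (Fin N ≃ H.edgeSet) = N.factorial := by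
    rw [Fintype.card_equiv e₀, Fintype.card_fin]
  rw [← hfac, ← Finset.card_univ]
  symm
  -- Since pairs must be increasing, an ordering of the edges determines the list: smaller endpoints
  -- first, then larger ones.
  let F : (Fin N ≃ H.edgeSet) → Fin (N + N) → Fin v := fun e =>
    Fin.addCases (fun i => (e i : Sym2 (Fin v)).inf) fun i => (e i : Sym2 (Fin v)).sup
  have hF : ∀ e i, pairEdge (F e) i = e i := by
    intro e i
    simp only [F, pairEdge, Fin.addCases_left, Fin.addCases_right]
    exact Sym2.sortEquiv.symm_apply_apply (e i : Sym2 (Fin v))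
  have hlt : ∀ s : Sym2 (Fin v), s ∈ H.edgeSet → s.inf < s.sup := by
    intro s
    induction s with | _ a b =>
    intro h
    rw [SimpleGraph.mem_edgeSet] at h
    simpa [eq_comm] using h.ne
  have hsimple : ∀ e, SimpleList (F e) := by
    refine fun e => ⟨fun i => ?_, fun i j hij => ?_⟩
    · simp only [F, Fin.addCases_left, Fin.addCases_right]
      exact hlt _ (e i).2
    · rw [hF, hF] at hij
      exact e.injective (Subtype.ext hij)
  have hgraph : ∀ e, pairGraph (F e) = H := by
    intro e
    rw [← SimpleGraph.edgeSet_inj, (hsimple e).edgeSet_eq]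
    ext s
    constructor
    · rintro ⟨i, rfl⟩
      rw [hF]
      exact (e i).2
    · intro hs
      exact ⟨e.symm ⟨s, hs⟩, by rw [hF]; simp⟩
  refine Finset.card_bij (fun e _ => F e) (fun e _ => by simp [hsimple, hgraph]) ?_ ?_
  · intro e _ e' _ hee
    ext1 i
    exact Subtype.ext (by rw [← hF, ← hF e', hee])
  · intro f hf
    obtain ⟨-, hs, rfl⟩ := Finset.mem_filter.1 hf
    have hmem : ∀ i, pairEdge f i ∈ (pairGraph f).edgeSet := fun i => by
      rw [hs.edgeSet_eq]; exact ⟨i, rfl⟩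
    refine ⟨Equiv.ofBijective (fun i => ⟨pairEdge f i, hmem i⟩) ⟨?_, ?_⟩, Finset.mem_univ _, ?_⟩
    · intro i j hij
      exact hs.2 (Subtype.mk.inj hij)
    · rintro ⟨s, hs'⟩
      rw [hs.edgeSet_eq] at hs'
      obtain ⟨i, hi⟩ := hs'
      exact ⟨i, Subtype.ext hi⟩
    · funext k
      induction k using Fin.addCases with
      | left i =>
        exact (Fin.addCases_left i).trans (inf_eq_left.2 (hs.1 i).le)
      | right i =>
        exact (Fin.addCases_right i).trans (sup_eq_right.2 (hs.1 i).le)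

open Classical in
-- Lists are grouped by their graph; each bounded graph occurs N! times by `card_simpleList`, which
-- the N! in the denominator of the common factor later undoes.
theorem sizeSum_eq (p cc : ℝ) (hv : 0 < v) (x : GraphPair n) :
    sizeSum p N d v cc x = ∑ H : SimpleGraph (Fin v), if H.IsBounded N d then
      (N.factorial * cc) / ((n.descFactorial v : ℝ) * (v.factorial : ℝ)) * graphCount p H x.1 *
        graphCount p H x.2 else 0 := by
  rw [sizeSum, sum_range_pow_eq_sum_digits _ fun f => if SimpleList f ∧ (pairGraph f).IsBounded N d then
    cc / ((n.descFactorial v : ℝ) * (v.factorial : ℝ)) * graphCount p (pairGraph f) x.1 *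
      graphCount p (pairGraph f) x.2 else 0]
  · rw [← Finset.sum_fiberwise (s := Finset.univ) (g := fun f : Fin (N + N) → Fin v => pairGraph f)]
    refine Finset.sum_congr rfl fun H _ => ?_
    split_ifs with hH
    · rw [← Finset.sum_filter, Finset.filter_filter]
      have he : (Finset.univ.filter fun f : Fin (N + N) → Fin v =>
          pairGraph f = H ∧ SimpleList f ∧ (pairGraph f).IsBounded N d) =
          Finset.univ.filter fun f : Fin (N + N) → Fin v => SimpleList f ∧ pairGraph f = H := by
        refine Finset.filter_congr fun f _ => ?_
        constructor
        · rintro ⟨h1, h2, -⟩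
          exact ⟨h2, h1⟩
        · rintro ⟨h1, h2⟩
          exact ⟨h2, h1, h2 ▸ hH⟩
      rw [he, Finset.sum_congr rfl (g := fun _ => cc / ((n.descFactorial v : ℝ) *
        (v.factorial : ℝ)) * graphCount p H x.1 * graphCount p H x.2) fun f hf => by
          rw [(Finset.mem_filter.1 hf).2.2], Finset.sum_const, card_simpleList hH.2.1, nsmul_eq_mul]
      ring
    · refine Finset.sum_eq_zero fun f hf => if_neg fun h => hH ?_
      rw [← (Finset.mem_filter.1 hf).2]
      exact h.2
  · intro c f hf
    simp only [validPairs_iff hv hf]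
    split_ifs with h
    · rw [embeddingCount_eq, embeddingSum_eq hf h.1, embeddingSum_eq hf h.1]
    · rfl

theorem motifStat_eq_sum_sizeSum (p ρ : ℝ) (N d : ℕ) (x : GraphPair n) :
    ∑ w ∈ Finset.range (N + 1), sizeSum p N d (w + 1)
      (∏ i ∈ Finset.range N, ρ / (p * (1 - p)) / ((i : ℝ) + 1)) x = motifStat p ρ N d x := by
  classical
  rw [motifStat_eq_sum_graphs]
  refine Finset.sum_congr rfl fun w _ => ?_
  rw [sizeSum_eq _ _ (Nat.succ_pos w)]
  have hcc : (N.factorial : ℝ) * ∏ i ∈ Finset.range N, ρ / (p * (1 - p)) / ((i : ℝ) + 1) =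
      (ρ / (p * (1 - p))) ^ N := by
    have h : (N.factorial : ℝ) = ∏ i ∈ Finset.range N, ((i : ℝ) + 1) := by
      rw [← Finset.prod_range_add_one_eq_factorial]
      push_cast
      rfl
    have h0 : ∏ i ∈ Finset.range N, ((i : ℝ) + 1) ≠ 0 :=
      Finset.prod_ne_zero_iff.2 fun i _ => by positivity
    rw [Finset.prod_div_distrib, h, Finset.prod_const, Finset.card_range]
    field_simp
  rw [hcc]

end

/-! ### The running time -/

theorem statProgram_computes : ComputesStatWithin statProgram fun n N _ => statTime n N := by
  intro n N d p ρ _ _ _ _ x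
  rcases Nat.eq_zero_or_pos n with rfl | hn
  · obtain ⟨t, ht, s, hs, h⟩ := statProgram_ends_zero x N d p ρ
    refine ⟨t, ht, s, hs, ?_⟩
    rw [h, ← motifStat_eq_sum_sizeSum]
    refine (Finset.sum_eq_zero fun w _ => ?_).symm
    classical
    rw [sizeSum_eq _ _ (Nat.succ_pos w)]
    refine Finset.sum_eq_zero fun H _ => ?_
    rw [graphCount_eq_zero (Nat.succ_pos w)]
    simp
  · obtain ⟨t, ht, s, hs, h⟩ := statProgram_ends x N d p ρ hn
    exact ⟨t, ht, s, hs, by rw [h, motifStat_eq_sum_sizeSum]⟩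

theorem countTime_le {n : ℕ} (hn : 1 ≤ n) (N : ℕ) :
    countTime n N (N + 1) ≤ 40 * (N + 2) ^ 2 * n ^ (N + 1) := by
  have hA : 1 ≤ n ^ (N + 1) := Nat.one_le_pow _ _ hn
  unfold countTime
  generalize n ^ (N + 1) = A at hA ⊢
  have h : ((N + 1) * ((N + 1) * 8 + 7) + N * 21 + 11 + (N + 1) * 9 + 4) +
      (3 + (N + 1) * 5 + 4) ≤ 40 * (N + 2) ^ 2 := by nlinarith
  have h1 := Nat.mul_le_mul_right A h
  have h2 := Nat.mul_le_mul_left (3 + (N + 1) * 5 + 4) hA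
  rw [add_mul] at h1
  linarith

theorem listTime_le {n : ℕ} (hn : 1 ≤ n) (N : ℕ) :
    listTime n N (N + 1) ≤ 200 * (N + 2) ^ 2 * (2 ^ (N + 1) * n ^ (N + 1)) := by
  have hA : 1 ≤ n ^ (N + 1) := Nat.one_le_pow _ _ hn
  have hB : 1 ≤ 2 ^ (N + 1) := Nat.one_le_two_pow
  have hc := countTime_le hn N
  unfold listTime
  generalize n ^ (N + 1) = A at hA hc ⊢
  generalize 2 ^ (N + 1) = B at hB ⊢
  have hBA : B ≤ B * A := Nat.le_mul_of_pos_right B hA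
  have hAB : A ≤ B * A := Nat.le_mul_of_pos_left A hB
  have h1 := Nat.mul_le_mul_left (N * 18 + (N + 1) * 20 + 10) hBA
  have h2 := Nat.mul_le_mul_left (40 * (N + 2) ^ 2) hAB
  have h3 := Nat.mul_le_mul_left (1 + ((N * (N * 14 + 13) + 2) + ((N + 1) * ((N + N) * 8 + 7) + 2) +
    (N + 1) * 5 + 4) + 6) (hA.trans hAB)
  have h : (N * 18 + (N + 1) * 20 + 10) + 40 * (N + 2) ^ 2 + (1 + ((N * (N * 14 + 13) + 2) +
    ((N + 1) * ((N + N) * 8 + 7) + 2) + (N + 1) * 5 + 4) + 6) ≤ 200 * (N + 2) ^ 2 := by nlinarith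
  have h4 := Nat.mul_le_mul_right (B * A) h
  rw [add_mul, add_mul] at h4
  linarith

/-- Lists contribute (N+1)^(2N), colourings 2^(N+1) and maps n^(N+1). Everything but the last is
absorbed, with the polynomial factors, into a power of N + 2. -/
theorem statTime_le {n : ℕ} (hn : 1 ≤ n) (N : ℕ) :
    statTime n N ≤ 400 * (N + 2) ^ (3 * N + 9) * n ^ (N + 1) := by
  have hl := listTime_le hn N
  have hA : 1 ≤ n ^ (N + 1) := Nat.one_le_pow _ _ hn
  have hB : 1 ≤ 2 ^ (N + 1) := Nat.one_le_two_pow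
  have hD : 1 ≤ (N + 1) ^ (N + N) := Nat.one_le_pow _ _ (by omega)
  have hpow : (N + 2) ^ 3 * ((N + 1) ^ (N + N) * 2 ^ (N + 1)) ≤ (N + 2) ^ (3 * N + 9) := by
    calc (N + 2) ^ 3 * ((N + 1) ^ (N + N) * 2 ^ (N + 1))
        ≤ (N + 2) ^ 3 * ((N + 2) ^ (N + N) * (N + 2) ^ (N + 1)) := by gcongr <;> omega
      _ = (N + 2) ^ (3 * N + 4) := by rw [← pow_add, ← pow_add]; congr 1; ring
      _ ≤ (N + 2) ^ (3 * N + 9) := Nat.pow_le_pow_right (by omega) (by omega)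
  refine le_trans ?_ (Nat.mul_le_mul_right _ (Nat.mul_le_mul_left 400 hpow))
  unfold statTime sizeTime
  generalize n ^ (N + 1) = A at *
  generalize 2 ^ (N + 1) = B at *
  generalize (N + 1) ^ (N + N) = D at *
  generalize listTime n N (N + 1) = L at *
  have hBA : 1 ≤ B * A := Nat.mul_pos hB hA
  have hDBA : 1 ≤ D * (B * A) := Nat.mul_pos hD hBA
  have hD' : D ≤ D * (B * A) := Nat.le_mul_of_pos_right D hBA
  have h1 := Nat.mul_le_mul_left ((N + 1) * D) hl
  have h2 := Nat.mul_le_mul_left ((N + 1) * ((N + N) * 9 + 4)) hD'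
  have h3 := Nat.mul_le_mul_left (13 + N * 5 + 6 + (N + 1) * (3 + (N + N) * 5 + 4 + 2)) hDBA
  have h : (N + 1) * (200 * (N + 2) ^ 2) + (N + 1) * ((N + N) * 9 + 4) +
      (13 + N * 5 + 6 + (N + 1) * (3 + (N + N) * 5 + 4 + 2)) ≤ 400 * (N + 2) ^ 3 := by
    nlinarith [sq_nonneg N, pow_nonneg (Nat.zero_le N) 3]
  have h4 := Nat.mul_le_mul_right (D * (B * A)) h
  rw [add_mul, add_mul] at h4
  linarith

theorem statTime_isLittleO {ρ : ℕ → ℝ} {N : ℕ → ℕ} (h : SmallMotifs N ρ) :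
    ∃ δ : ℕ → ℝ, Tendsto δ atTop (nhds 0) ∧
      ∀ᶠ n : ℕ in atTop, (statTime n (N n) : ℝ) ≤ (n : ℝ) ^ ((N n : ℝ) + 1 + δ n) := by
  have hll := tendsto_log_log_natCast.eventually_ge_atTop 1
  have hl := tendsto_log_natCast.eventually_ge_atTop 2
  -- Chosen so that n^(δ n) is exactly the prefactor of n^(N+1) in `statTime_le`.
  refine ⟨fun n => Real.log (400 * ((N n : ℝ) + 2) ^ (3 * N n + 9)) / Real.log n, ?_, ?_⟩
  · rw [Metric.tendsto_nhds]
    intro ε hε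
    -- The power of N + 2 takes at most 18 ε/40 of log n and the constant 400 at most ε/4, together
    -- less than ε.
    filter_upwards [hll, hl, h.eventually one_pos, h.eventually (c := ε / 40) (by positivity),
      tendsto_log_natCast.eventually_ge_atTop (4 * Real.log 400 / ε)] with n h1 h2 h3 h4 h5
    have hN : (0 : ℝ) ≤ N n := Nat.cast_nonneg _
    have hNl : (N n : ℝ) + 1 ≤ Real.log n := by nlinarith [h3.1]
    have hlog : Real.log ((N n : ℝ) + 2) ≤ 2 * Real.log (Real.log n) := by
      rw [← Real.log_rpow (by linarith), Real.rpow_two]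
      exact Real.log_le_log (by linarith) (by nlinarith)
    have hpos : 0 < Real.log n := by linarith
    have hlog0 : 0 ≤ Real.log ((N n : ℝ) + 2) := Real.log_nonneg (by linarith)
    have h400 : 0 ≤ Real.log 400 := Real.log_nonneg (by norm_num)
    rw [Real.log_mul (by norm_num) (by positivity), Real.log_pow, Real.dist_0_eq_abs, abs_of_nonneg
      (by positivity), div_lt_iff₀ hpos]
    rw [div_le_iff₀ hε] at h5
    have h6 : ((3 * N n + 9 : ℕ) : ℝ) * Real.log ((N n : ℝ) + 2) ≤
        18 * (((N n : ℝ) + 1) * Real.log (Real.log n)) := by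
      push_cast
      nlinarith [mul_le_mul_of_nonneg_left hlog (show (0 : ℝ) ≤ 3 * N n + 9 by positivity)]
    nlinarith [h4.1, mul_pos hε hpos]
  · filter_upwards [hl, eventually_ge_atTop 1] with n h2 hn
    have hpos : (0 : ℝ) < n := by exact_mod_cast hn
    have hlog : Real.log n ≠ 0 := by linarith
    rw [Real.rpow_add hpos, Real.rpow_def_of_pos hpos (Real.log _ / _), mul_div_cancel₀ _ hlog,
      Real.exp_log (by positivity), mul_comm, ← Nat.cast_add_one, Real.rpow_natCast]
    exact_mod_cast statTime_le hn (N n)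

theorem exists_statProgram : ∃ (P : Program) (time : ℕ → ℕ → ℕ → ℕ), ComputesStatWithin P time ∧
    ∀ (d : ℕ) (ρ : ℕ → ℝ) (N : ℕ → ℕ), (∀ n, 0 < ρ n ∧ ρ n ≤ 1) → SmallMotifs N ρ →
      ∃ δ : ℕ → ℝ, Tendsto δ atTop (nhds 0) ∧
        ∀ᶠ n : ℕ in atTop, (time n (N n) d : ℝ) ≤ (n : ℝ) ^ ((N n : ℝ) + 1 + δ n) :=
  ⟨statProgram, fun n N _ => statTime n N, statProgram_computes,
    fun _ _ _ _ h => statTime_isLittleO h⟩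

theorem mainTheorem4 :
    -- edge probability `n ^ (-a)` with a constant `0 < a < 2 / 3`
    (∃ C₁ : ℕ → ℝ, (∀ d, 0 < C₁ d) ∧
      ∀ a : ℝ, 0 < a → a < 2 / 3 → ∀ d : ℕ, d = degreeBound a →
      ∀ (ρ : ℕ → ℝ) (N : ℕ → ℕ), (∀ n, 0 < ρ n ∧ ρ n ≤ 1) → SmallMotifs N ρ →
        (∀ᶠ n in atTop, C₁ d / ρ n ^ (2 * (d : ℝ) / ((d : ℝ) - 2)) ≤ (N n : ℝ)) →
        ∀ᶠ n in atTop, totalError n ((n : ℝ) ^ (-a)) (ρ n) (N n) d ≤ 0.05) ∧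
    -- edge probability `n ^ (-o(1))`
    (∃ C₂ : ℝ → ℝ, (∀ ε, 0 < C₂ ε) ∧
      ∀ ε : ℝ, 0 < ε → ∀ d : ℕ, d = ⌊4 / ε⌋₊ + 3 →
      ∀ (p ρ : ℕ → ℝ) (N : ℕ → ℕ), (∀ n, 0 < p n ∧ p n < 1) →
        Tendsto (fun n : ℕ => Real.log (p n) / Real.log n) atTop (nhds 0) →
        Tendsto (fun n : ℕ => Real.log (1 - p n) / Real.log n) atTop (nhds 0) →
        (∀ n, 0 < ρ n ∧ ρ n ≤ 1) → SmallMotifs N ρ →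
        (∀ᶠ n in atTop, C₂ ε / ρ n ^ (2 + ε) ≤ (N n : ℝ)) →
        ∀ᶠ n in atTop, totalError n (p n) (ρ n) (N n) d ≤ 0.05) ∧
    -- running time `n ^ (N + 1 + o(1))`
    (∃ (P : Program) (time : ℕ → ℕ → ℕ → ℕ), ComputesStatWithin P time ∧
      ∀ (d : ℕ) (ρ : ℕ → ℝ) (N : ℕ → ℕ), (∀ n, 0 < ρ n ∧ ρ n ≤ 1) → SmallMotifs N ρ →
        ∃ δ : ℕ → ℝ, Tendsto δ atTop (nhds 0) ∧
          ∀ᶠ n : ℕ in atTop, (time n (N n) d : ℝ) ≤ (n : ℝ) ^ ((N n : ℝ) + 1 + δ n)) := by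
  exact ⟨polynomial_density_detection, subpolynomial_density_detection, exists_statProgram⟩
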